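/- Theorem D. Let $G$ be a countable discrete group, and let $\Sigma=(\sigma_n:G\to\mathrm{Sym}(V_n))_{n\ge 1}$ be a sofic approximation to $G$: the $V_n$ are nonempty finite sets, and as $n\to\infty$, for all $g,h\in G$ one has $\sigma_n^g(\sigma_n^h(v))=\sigma_n^{gh}(v)$ for a proportion tending to $1$ of all $v\in V_n$, and, if $g\neq e$, $\sigma_n^g(v)\ne v$ for a proportion tending to $1$ of all $v\in V_n$. Let $(X,\mu,T)$ be a $G$-system: a standard Borel probability space with a measurable, $\mu$-preserving action $T$ of $G$. Definitions. Let $(\mathcal X,d)$ be a compact metric space and let $\nu\in\mathrm{Pr}(\mathcal X^G)$. For $\mathbf x\in\mathcal X^{V_n}$ and $v\in V_n$ put $\Pi^{\sigma_n}_v(\mathbf x)=(x_{\sigma_n^g(v)})_{g\in G}\in\mathcal X^G$ and $P^{\sigma_n}_{\mathbf x}=\frac1{|V_n|}\sum_{v\in V_n}\delta_{\Pi^{\sigma_n}_v(\mathbf x)}$, and for a weak$^*$-neighbourhood $\mathcal O$ of $\nu$ put $\Omega(\mathcal O,\sigma_n)=\{\mathbf x\in\mathcal X^{V_n}:P^{\sigma_n}_{\mathbf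 x}\in\mathcal O\}$. Let $d^{(V)}(\mathbf x,\mathbf y)=\frac1{|V|}\sum_{v\in V} d(x_v,y_v)$, let $B_\delta(F)$ be the open $\delta$-neighbourhood of $F$ for this metric, let $\mathrm{cov}_\delta(Z)$ be the least cardinality of a set $F\subseteq Z$ with $Z\subseteq B_\delta(F)$, and let $\mathrm{cov}_{\varepsilon,\delta}(m)$ be the least cardinality of a set $F$ with $m(B_\delta(F))>1-\varepsilon$. Define $$\mathrm h_\Sigma(\nu)=\sup_{\delta>0}\ \inf_{\mathcal O}\ \limsup_{n\to\infty}\frac1{|V_n|}\log\mathrm{cov}_\delta(\Omega(\mathcal O,\sigma_n)),$$ with $\log 0=-\infty$. A sequence $m_i\in\mathrm{Pr}(\mathcal X^{V_{n_i}})$ quenched converges to $\nu$ over $(\sigma_{n_i})$ if for every weak$^*$-neighbourhood $\mathcal O$ of $\nu$ the proportion of $v\in V_{n_i}$ with $(\Pi^{\sigma_{n_i}}_v)_*m_i\in\mathcal O$ tends to $1$, and $m_i(\Omega(\mathcal O,\sigma_{n_i}))\to1$. It doubly-quenched converges to $\nu$ if $m_i\times m_i$ quenched converges to $\nu\times\nu$.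 Define $$\mathrm h^{\mathrm{dq}}_\Sigma(\nu)=\sup\Big\{\sup_{\delta,\varepsilon>0}\limsup_{i\to\infty}\frac1{|V_{n_i}|}\log\mathrm{cov}_{\varepsilon,\delta}(m_i)\Big\},$$ where the outer supremum is over all $n_1<n_2<\cdots$ and all $(m_i)$ that doubly-quenched converge to $\nu$ over $(\sigma_{n_i})_{i\ge1}$ (and $\sup\emptyset=-\infty$). For the system $(X,\mu,T)$, the values $\mathrm h_\Sigma(\mu,T)$ and $\mathrm h^{\mathrm{dq}}_\Sigma(\mu,T)$ are those obtained with $\mathcal X=X$, with a compact metric $d$ on $X$ whose Borel $\sigma$-algebra is the $\sigma$-algebra of $X$, and with $\nu$ the image of $\mu$ under $x\mapsto(T^hx)_{h\in G}$; they do not depend on the choice of $d$. Statement. The limit $$\mathrm h^{\mathrm{ps}}_\Sigma(\mu,T)=\lim_{k\to\infty}\frac1k\,\mathrm h_\Sigma(\mu^{\times k},T^{\times k})$$ exists in $[-\infty,+\infty]$, where $T^{\times k}$ is the diagonal action on $X^k$. It always satisfies $\mathrm h^{\mathrm{ps}}_\Sigma(\mu,T)\ \ge\ \mathrm h^{\mathrm{dq}}_\Sigma(\mu,T)$,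 and this is an equality if $(X,\mu,T)$ has a finite generating partition, that is, a partition of $X$ into finitely many measurable sets whose translates under $G$ generate the $\sigma$-algebra of $X$ modulo $\mu$-null sets. -/

import Mathlib

open Filter Topology MeasureTheory
open scoped ENNReal

namespace SoficEntropy

noncomputable section

universe u v w

/-! ### Sofic approximations -/

/-- The proportion of elements of a finite set `V` that satisfy `P`. -/
def proportion {V : Type w} [Fintype V] (P : V → Prop) : ℝ :=
  (Nat.card {v : V // P v} : ℝ) / (Fintype.card V : ℝ)

/-- A sequence of properties `P n` of points of the finite sets `V n` holds with high probability
(with respect to the uniform distributions). -/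
def WHP {V : ℕ → Type w} [∀ n, Fintype (V n)] (P : ∀ n, V n → Prop) : Prop :=
  Tendsto (fun n => proportion (P n)) atTop (𝓝 1)

/-- A sofic approximation to the group `G`: nonempty finite sets `V n` and maps
`σ n : G → Sym (V n)` that are asymptotically multiplicative and asymptotically free. -/
structure SoficApproximation (G : Type u) [Group G] where
  /-- the finite sets -/
  V : ℕ → Type w
  [fintypeV : ∀ n, Fintype (V n)]
  [nonemptyV : ∀ n, Nonempty (V n)]
  /-- the maps into the symmetric groups -/
  σ : ∀ n, G → Equiv.Perm (V n)
  mul_whp : ∀ g h : G, WHP (fun n (v : V n) => σ n g (σ n h v) = σ n (g * h) v)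
  free_whp : ∀ g : G, g ≠ 1 → WHP (fun n (v : V n) => σ n g v ≠ v)

attribute [instance] SoficApproximation.fintypeV SoficApproximation.nonemptyV

/-! ### Pullback names, empirical distributions and good models -/

section Models

variable {G : Type u} {V : Type w} {𝒳 : Type v}

/-- The pullback name `(x_{σ^g(v)})_{g ∈ G}` of `x ∈ 𝒳^V` at `v`. -/
def pullbackName (σ : G → Equiv.Perm V) (v : V) (x : V → 𝒳) : G → 𝒳 :=
  fun g => x (σ g v)

theorem measurable_pullbackName [MeasurableSpace 𝒳] (σ : G → Equiv.Perm V) (v : V) :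
    Measurable (pullbackName (𝒳 := 𝒳) σ v) :=
  measurable_pi_lambda _ fun _ => measurable_pi_apply _

/-- The empirical distribution of `x ∈ 𝒳^V`: the average over `v` of the Dirac masses at the
pullback names of `x`. -/
def empirical [Fintype V] [Nonempty V] [MeasurableSpace 𝒳] (σ : G → Equiv.Perm V) (x : V → 𝒳) :
    ProbabilityMeasure (G → 𝒳) :=
  ⟨((Fintype.card V : ℝ≥0∞))⁻¹ • ∑ v : V, Measure.dirac (pullbackName σ v x), ⟨by
    simp [ENNReal.inv_mul_cancel]⟩⟩

/-- The set `Ω(𝒪, σ)` of those `x ∈ 𝒳^V` whose empirical distribution lies in `𝒪`. -/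
def goodModels [Fintype V] [Nonempty V] [MeasurableSpace 𝒳]
    (O : Set (ProbabilityMeasure (G → 𝒳))) (σ : G → Equiv.Perm V) : Set (V → 𝒳) :=
  {x | empirical σ x ∈ O}

end Models

/-! ### Hamming averages and covering numbers -/

section Covering

variable {V : Type w} [Fintype V] {𝒳 : Type v} [MetricSpace 𝒳]

/-- The Hamming average `d^(V)` of the metric of `𝒳` over `V`. -/
def hammingAvg (x y : V → 𝒳) : ℝ := (∑ v, dist (x v) (y v)) / (Fintype.card V : ℝ)

/-- The open `δ`-neighbourhood of `F` for the Hamming average metric. -/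
def hammingNhd (δ : ℝ) (F : Set (V → 𝒳)) : Set (V → 𝒳) := {y | ∃ x ∈ F, hammingAvg y x < δ}

/-- `cov_δ(Z, d^(V))`: the least cardinality of a `δ`-dense subset of `Z`. -/
def cov (δ : ℝ) (Z : Set (V → 𝒳)) : ℕ∞ :=
  ⨅ (F : Set (V → 𝒳)) (_ : F ⊆ Z) (_ : Z ⊆ hammingNhd δ F), F.encard

/-- `cov_{ε,δ}(μ, d^(V))`: the least cardinality of a set whose `δ`-neighbourhood has `μ`-measure
greater than `1 - ε`. -/
def covMeasure [MeasurableSpace 𝒳] (ε δ : ℝ) (μ : ProbabilityMeasure (V → 𝒳)) : ℕ∞ :=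
  ⨅ (F : Set (V → 𝒳)) (_ : 1 - ε < (μ : Measure (V → 𝒳)).real (hammingNhd δ F)), F.encard

/-- `(1 / |V|) log N`, with `log 0 = -∞`. -/
def logRate (V : Type w) [Fintype V] (N : ℕ∞) : EReal :=
  ENNReal.log (N : ℝ≥0∞) / ((Fintype.card V : ℕ) : EReal)

end Covering

/-! ### Convergence of measures on model spaces

These notions depend on the metric of the state space only through its topology. -/

section Convergence

variable {G : Type u} [Countable G] {V : ℕ → Type w} [∀ n, Fintype (V n)] [∀ n, Nonempty (V n)]
  {𝒳 : Type v} [TopologicalSpace 𝒳] [SecondCountableTopology 𝒳] [MeasurableSpace 𝒳] [BorelSpace 𝒳]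

/-- Local weak* convergence of `m n ∈ Pr(𝒳^(V n))` to `μ ∈ Pr(𝒳^G)` over `σ`. -/
def LocalWeakStarConverges (σ : ∀ n, G → Equiv.Perm (V n))
    (m : ∀ n, ProbabilityMeasure (V n → 𝒳)) (μ : ProbabilityMeasure (G → 𝒳)) : Prop :=
  ∀ O ∈ 𝓝 μ, WHP (fun n (v : V n) =>
    (m n).map (measurable_pullbackName (σ n) v).aemeasurable ∈ O)

/-- Quenched convergence of `m n ∈ Pr(𝒳^(V n))` to `μ ∈ Pr(𝒳^G)` over `σ`. -/
def QuenchedConverges (σ : ∀ n, G → Equiv.Perm (V n))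
    (m : ∀ n, ProbabilityMeasure (V n → 𝒳)) (μ : ProbabilityMeasure (G → 𝒳)) : Prop :=
  LocalWeakStarConverges σ m μ ∧
    ∀ O ∈ 𝓝 μ, Tendsto (fun n => (m n : Measure (V n → 𝒳)).real (goodModels O (σ n))) atTop (𝓝 1)

/-- The canonical identification of `𝒳^I × 𝒳^I` with `(𝒳 × 𝒳)^I`. -/
def zip {I : Type w} {𝒳 : Type v} (p : (I → 𝒳) × (I → 𝒳)) : I → 𝒳 × 𝒳 := fun i => (p.1 i, p.2 i)

theorem measurable_zip {I : Type w} {𝒳 : Type v} [MeasurableSpace 𝒳] :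
    Measurable (zip (I := I) (𝒳 := 𝒳)) :=
  measurable_pi_lambda _ fun i =>
    ((measurable_pi_apply i).comp measurable_fst).prodMk
      ((measurable_pi_apply i).comp measurable_snd)

/-- The Cartesian square `μ × μ`, as a measure on `(𝒳 × 𝒳)^I`. -/
def square {I : Type w} {𝒳 : Type v} [MeasurableSpace 𝒳] (μ : ProbabilityMeasure (I → 𝒳)) :
    ProbabilityMeasure (I → 𝒳 × 𝒳) :=
  (μ.prod μ).map measurable_zip.aemeasurable

/-- Doubly-quenched convergence: `m n × m n` quenched converges to `μ × μ`. -/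
def DoublyQuenchedConverges (σ : ∀ n, G → Equiv.Perm (V n))
    (m : ∀ n, ProbabilityMeasure (V n → 𝒳)) (μ : ProbabilityMeasure (G → 𝒳)) : Prop :=
  QuenchedConverges σ (fun n => square (m n)) (square μ)

end Convergence

/-! ### Entropies of metric `G`-processes -/

section ProcessEntropy

variable {G : Type u} [Group G] [Countable G]
  {𝒳 : Type v} [MetricSpace 𝒳] [CompactSpace 𝒳] [MeasurableSpace 𝒳] [BorelSpace 𝒳]

/-- The sofic entropy of the metric `G`-process on `𝒳^G` with law `μ`. -/
def processEntropy (S : SoficApproximation.{u, w} G) (μ : ProbabilityMeasure (G → 𝒳)) : EReal :=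
  ⨆ (δ : ℝ) (_ : 0 < δ), ⨅ O ∈ 𝓝 μ,
    limsup (fun n => logRate (S.V n) (cov δ (goodModels O (S.σ n)))) atTop

/-- The doubly-quenched model-measure sofic entropy of the metric `G`-process on `𝒳^G` with
law `μ`. The first supremum is over all subsequences of the sofic approximation and all sequences
of measures that doubly-quenched converge to `μ` along them. -/
def processDQEntropy (S : SoficApproximation.{u, w} G) (μ : ProbabilityMeasure (G → 𝒳)) : EReal :=
  ⨆ (φ : ℕ → ℕ) (_ : StrictMono φ) (m : ∀ i, ProbabilityMeasure (S.V (φ i) → 𝒳))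
    (_ : DoublyQuenchedConverges (fun i => S.σ (φ i)) m μ),
    ⨆ (δ : ℝ) (_ : 0 < δ) (ε : ℝ) (_ : 0 < ε),
      limsup (fun i => logRate (S.V (φ i)) (covMeasure ε δ (m i))) atTop

end ProcessEntropy

/-! ### Entropies of `G`-systems -/

/-- A compact generating metric on a measurable space: a compact metric whose Borel `σ`-algebra is
the given `σ`-algebra. -/
structure CompactGeneratingMetric (X : Type v) [MeasurableSpace X] where
  /-- the metric -/
  metric : MetricSpace X
  compact : CompactSpace X
  borel : BorelSpace X

/-- Every standard Borel space is Borel isomorphic to a compact subset of `ℝ`. -/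
theorem exists_measurableEquiv_compact (X : Type v) [MeasurableSpace X] [StandardBorelSpace X] :
    ∃ K : Set ℝ, IsCompact K ∧ Nonempty (X ≃ᵐ K) := by
  suffices h : ∃ K : Set ℝ, IsCompact K ∧ Nonempty (X ≃ K) by
    obtain ⟨K, hK, ⟨e⟩⟩ := h
    have : StandardBorelSpace K := hK.isClosed.measurableSet.standardBorel
    exact ⟨K, hK, ⟨PolishSpace.Equiv.measurableEquiv e⟩⟩
  by_cases hX : Countable X
  · rcases finite_or_infinite X with hfin | hinf
    · obtain ⟨f, hf⟩ := Countable.exists_injective_nat X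
      exact ⟨Set.range (fun x => (f x : ℝ)), (Set.finite_range _).isCompact,
        ⟨Equiv.ofInjective _ (Nat.cast_injective.comp hf)⟩⟩
    · have ht : Tendsto (fun n : ℕ => 1 / ((n : ℝ) + 1)) atTop (𝓝 0) :=
        tendsto_one_div_add_atTop_nhds_zero_nat
      have hinj : Function.Injective (fun n : ℕ => 1 / ((n : ℝ) + 1)) := by
        intro a b hab
        have hab' : (1 : ℝ) / ((a : ℝ) + 1) = 1 / ((b : ℝ) + 1) := hab
        rw [one_div, one_div, inv_inj] at hab'
        exact_mod_cast add_right_cancel hab'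
      have hc : (insert (0 : ℝ) (Set.range (fun n : ℕ => 1 / ((n : ℝ) + 1)))).Countable :=
        (Set.countable_range _).insert 0
      have hi : (insert (0 : ℝ) (Set.range (fun n : ℕ => 1 / ((n : ℝ) + 1)))).Infinite :=
        (Set.infinite_range_of_injective hinj).mono (Set.subset_insert _ _)
      have := hc.to_subtype
      have := hi.to_subtype
      exact ⟨_, ht.isCompact_insert_range,
        ⟨(nonempty_equiv_of_countable (α := X)).some⟩⟩
  · refine ⟨Set.Icc 0 1, isCompact_Icc,
      ⟨(PolishSpace.measurableEquivOfNotCountable hX ?_).toEquiv⟩⟩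
    rw [Set.countable_coe_iff]
    intro h
    have h1 := Cardinal.mk_Icc_real (zero_lt_one (α := ℝ))
    have h2 := Cardinal.le_aleph0_iff_set_countable.mpr h
    rw [h1] at h2
    exact absurd h2 (not_le.mpr Cardinal.aleph0_lt_continuum)

/-- Every standard Borel space has a compact generating metric. -/
theorem nonempty_compactGeneratingMetric (X : Type v) [MeasurableSpace X] [StandardBorelSpace X] :
    Nonempty (CompactGeneratingMetric X) := by
  obtain ⟨K, hK, ⟨e⟩⟩ := exists_measurableEquiv_compact X
  have : CompactSpace K := isCompact_iff_compactSpace.mp hK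
  let m : MetricSpace X := MetricSpace.induced e e.injective inferInstance
  have hind : Topology.IsInducing e := ⟨rfl⟩
  let H : X ≃ₜ K := e.toEquiv.toHomeomorphOfIsInducing hind
  refine ⟨⟨m, H.symm.compactSpace, ⟨?_⟩⟩⟩
  have h1 : ‹MeasurableSpace X› = MeasurableSpace.comap e inferInstance :=
    e.measurableEmbedding.comap_eq.symm
  have h2 : ∀ f : X → K, MeasurableSpace.comap f inferInstance
      = MeasurableSpace.comap f (borel K) := fun f => by
    rw [BorelSpace.measurable_eq (α := K)]
  exact h1.trans ((h2 e).trans borel_comap.symm)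

/-- A choice of compact generating metric on a standard Borel space. -/
def someMetric (X : Type v) [MeasurableSpace X] [StandardBorelSpace X] :
    CompactGeneratingMetric X :=
  (nonempty_compactGeneratingMetric X).some

section System

variable {G : Type u} [Group G] [Countable G] {X : Type v} [MeasurableSpace X]
  [StandardBorelSpace X] [MulAction G X] [MeasurableConstSMul G X]

/-- The `G`-process on `X^G` isomorphic to the system `(X, μ, T)`: the image of `μ` under
`x ↦ (T^h x)_{h ∈ G}`. -/
def orbitProcess (G : Type u) [Group G] [MulAction G X] [MeasurableConstSMul G X]
    (μ : ProbabilityMeasure X) : ProbabilityMeasure (G → X) :=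
  μ.map (f := fun x h => h • x)
    (measurable_pi_lambda _ fun h => measurable_const_smul h).aemeasurable

/-- The sofic entropy `h_Σ(μ, T)` of a `G`-system, computed from the isomorphic process on `X^G`
and a compact generating metric on `X`. -/
def soficEntropy (S : SoficApproximation.{u, w} G) (μ : ProbabilityMeasure X) : EReal :=
  letI := (someMetric X).metric
  haveI := (someMetric X).compact
  haveI := (someMetric X).borel
  processEntropy S (orbitProcess G μ)

/-- The doubly-quenched model-measure sofic entropy `h^dq_Σ(μ, T)` of a `G`-system, computed from
the isomorphic process on `X^G` and a compact generating metric on `X`. -/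
def dqEntropy (S : SoficApproximation.{u, w} G) (μ : ProbabilityMeasure X) : EReal :=
  letI := (someMetric X).metric
  haveI := (someMetric X).compact
  haveI := (someMetric X).borel
  processDQEntropy S (orbitProcess G μ)

/-- The power-stabilized sofic entropy `lim_k (1 / k) h_Σ(μ^{×k}, T^{×k})`, where `G` acts
diagonally on `X^k`; the limit is written as an upper limit so that it is always defined. -/
def psEntropy (S : SoficApproximation.{u, w} G) (μ : ProbabilityMeasure X) : EReal :=
  limsup (fun k : ℕ =>
    soficEntropy S (ProbabilityMeasure.pi (fun _ : Fin k => μ)) / (k : EReal)) atTop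

/-- The system `(X, μ, T)` has a finite generating partition: there is a measurable partition of
`X` into finitely many cells (the fibres of `f`) whose translates under `G` generate, modulo
`μ`-null sets, the whole `σ`-algebra of `X`. -/
def HasFiniteGeneratingPartition (G : Type u) [Group G] [MulAction G X]
    (μ : ProbabilityMeasure X) : Prop :=
  ∃ (r : ℕ) (f : X → Fin r), Measurable f ∧
    ∀ A : Set X, MeasurableSet A →
      ∃ B : Set X, MeasurableSet[⨆ g : G, MeasurableSpace.comap (fun x => f (g • x)) ⊤] B ∧
        A =ᵐ[(μ : Measure X)] B

end System

end

end SoficEntropy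

/-! Three mechanisms carry the proof.

Recoding. Models are tested by weak* neighbourhoods, yet entropy is stable under recodings that are
only measurable. A measurable map of compact metric alphabets is an almost sure limit of almost
everywhere continuous maps, so good models of a process lift to good models of its graph joining
(`exists_lift`). Conversely, if one coordinate of a joining is a measurable function of the other
process, an `L¹` approximation of that function by a continuous one, nearly Lipschitz in finitely
many coordinates, shows that closeness of models in the second alphabet forces closeness in the
first (`exists_separation`). Together they give `processEntropy_le_mul`. It shows that the entropy
does not depend on the metric. Writing `h_k` for the entropy of the `k`-th power, it also gives `h_n
≤ (⌊n/k⌋ + 1) h_k`, because `n` coordinates are covered by that many blocks of length `k`. Since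
each `h_k` is `-∞` or nonnegative, a Fekete argument yields the limit and identifies it with the
infimum of `h_k / k`.

Decorrelation. Doubly-quenched convergence of `m_n` is equivalent to a linear condition: for every
continuous `f`, the averages over `v` of `w_v (f(Π_v x) - ∫ f dν)` are small in `L²(m_n)`, uniformly
over weights bounded by `1` (`UniformlyDecorrelated`). One direction is Cauchy–Schwarz for the
correlation matrix; in the other, an independent copy supplies the weights. By induction on `k`, the
same condition shows that the `k`-th power of `m_n` is concentrated on good models of the `k`-th
power of the system. Covering more than `1 - ε^k` of that power takes at least `cov_{ε,δ}(m_n)^k`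
products of balls (`covMeasure_pow_le`). Hence the doubly-quenched entropy is at most `h_k / k` for
every `k`.

The reverse inequality. Let `c < c'`, with `c'` below the power-stabilized entropy. For every `k`
there are infinitely many `n` with at least `exp(k c' |V_n|)` distinct tuples of names, each coming
from a `k`-tuple of models that pairwise look like `μ × μ` (`frequently_exists_models`). With `k`
tending to infinity, let `m` be the uniform average of the point masses at all entries of these
tuples. The entries of one tuple are almost orthogonal, so by Bessel's inequality a bounded weight
correlates with few of them; thus `m` is decorrelated (`uniformlyDecorrelated_uniformLaw`). If a set
`F` covered most of `m`, most entries of most tuples would have names near a set of at most `|F|`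
words. Over a finite alphabet the exceptional entries contribute little to the count, so the number
of tuples is at most `(|F| exp(o(1)|V_n|))^k` (`card_le_of_sum_card_le`), which forces `|F| ≥ exp(c
|V_n|)`. -/

namespace SoficEntropy

noncomputable section

set_option linter.unusedSectionVars false

/-! ### Weak convergence of probability measures -/

section WeakConvergence

/-- A measurable map that is continuous at almost every point induces a map of measures that is
weakly continuous at the given measure. -/
theorem tendsto_map_of_ae_continuousAt {Ω Ω' : Type*} [TopologicalSpace Ω] [MeasurableSpace Ω]
    [BorelSpace Ω] [TopologicalSpace.PseudoMetrizableSpace Ω] [TopologicalSpace.SeparableSpace Ω]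
    [TopologicalSpace Ω'] [MeasurableSpace Ω'] [BorelSpace Ω'] [HasOuterApproxClosed Ω']
    (ν : ProbabilityMeasure Ω) {f : Ω → Ω'} (hf : Measurable f)
    (hc : ∀ᵐ x ∂(ν : Measure Ω), ContinuousAt f x) :
    Tendsto (fun P : ProbabilityMeasure Ω => P.map hf.aemeasurable) (𝓝 ν)
      (𝓝 (ν.map hf.aemeasurable)) := by
  refine tendsto_of_forall_isClosed_limsup_le' fun F hF => ?_
  have h1 : ∀ P : ProbabilityMeasure Ω,
      (P.map hf.aemeasurable : Measure Ω') F = (P : Measure Ω) (f ⁻¹' F) := fun P => by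
    rw [ProbabilityMeasure.toMeasure_map, Measure.map_apply hf hF.measurableSet]
  simp only [h1]
  calc limsup (fun P : ProbabilityMeasure Ω => (P : Measure Ω) (f ⁻¹' F)) (𝓝 ν)
      ≤ limsup (fun P : ProbabilityMeasure Ω => (P : Measure Ω) (closure (f ⁻¹' F))) (𝓝 ν) :=
        limsup_le_limsup (Eventually.of_forall fun P => measure_mono subset_closure)
    _ ≤ (ν : Measure Ω) (closure (f ⁻¹' F)) :=
        ProbabilityMeasure.limsup_measure_closed_le_of_tendsto tendsto_id isClosed_closure
    _ ≤ (ν : Measure Ω) (f ⁻¹' F) := by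
        refine measure_mono_ae ?_
        filter_upwards [hc] with x hx hxF
        have : f x ∈ closure F := hx.continuousWithinAt.mem_closure hxF (fun y hy => hy)
        rwa [hF.closure_eq] at this

variable {K : Type*} [TopologicalSpace K] [CompactSpace K] [MeasurableSpace K] [BorelSpace K]

theorem integrable_continuousMap (f : C(K, ℝ)) (P : Measure K) [IsFiniteMeasure P] :
    Integrable f P :=
  (BoundedContinuousFunction.mkOfCompact f).integrable P

/-- Weak convergence on a compact space can be tested on a multiplicatively closed family of
functions that separates points. -/
theorem tendsto_of_submonoid {ι : Type*} {L : Filter ι} {P : ι → ProbabilityMeasure K}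
    {ν : ProbabilityMeasure K} (S : Submonoid C(K, ℝ))
    (hS : ∀ x y : K, x ≠ y → ∃ f ∈ S, f x ≠ f y)
    (h : ∀ f ∈ S, Tendsto (fun i => ∫ x, f x ∂(P i : Measure K)) L
      (𝓝 (∫ x, f x ∂(ν : Measure K)))) :
    Tendsto P L (𝓝 ν) := by
  have hA : ∀ f ∈ Algebra.adjoin ℝ (S : Set C(K, ℝ)),
      Tendsto (fun i => ∫ x, f x ∂(P i : Measure K)) L (𝓝 (∫ x, f x ∂(ν : Measure K))) := by
    intro f hf
    -- Closure under products makes the generated subalgebra equal to the linear span, so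
    -- convergence extends to it by linearity alone; Stone–Weierstrass then gives density.
    rw [← Subalgebra.mem_toSubmodule, Algebra.adjoin_eq_span, Submonoid.closure_eq] at hf
    induction hf using Submodule.span_induction with
    | mem x hx => exact h x hx
    | zero => simpa using tendsto_const_nhds
    | add f g _ _ hf hg =>
      have key : ∀ Q : ProbabilityMeasure K, ∫ x, (f + g) x ∂(Q : Measure K)
          = ∫ x, f x ∂(Q : Measure K) + ∫ x, g x ∂(Q : Measure K) := fun Q => by
        simp only [ContinuousMap.add_apply]
        exact integral_add (integrable_continuousMap f _) (integrable_continuousMap g _)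
      simp only [key]
      exact hf.add hg
    | smul a f _ hf =>
      simp only [ContinuousMap.smul_apply, smul_eq_mul, integral_const_mul]
      exact hf.const_mul a
  have htop : (Algebra.adjoin ℝ (S : Set C(K, ℝ))).topologicalClosure = ⊤ :=
    ContinuousMap.subalgebra_topologicalClosure_eq_top_of_separatesPoints _ (by
      intro x y hxy
      obtain ⟨f, hf, hne⟩ := hS x y hxy
      exact ⟨f, ⟨f, Algebra.subset_adjoin hf, rfl⟩, hne⟩)
  rw [ProbabilityMeasure.tendsto_iff_forall_integral_tendsto]
  intro f
  rw [Metric.tendsto_nhds]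
  intro ε hε
  have hmem : f.toContinuousMap ∈ (Algebra.adjoin ℝ (S : Set C(K, ℝ))).topologicalClosure := by
    rw [htop]; trivial
  obtain ⟨g, hg, hfg⟩ := Metric.mem_closure_iff.mp hmem (ε / 3) (by positivity)
  have hb : ∀ Q : ProbabilityMeasure K,
      |∫ x, f x ∂(Q : Measure K) - ∫ x, g x ∂(Q : Measure K)| ≤ ε / 3 := fun Q => by
    rw [← integral_sub (f.integrable _) (integrable_continuousMap g _)]
    have := norm_integral_le_of_norm_le_const (μ := (Q : Measure K)) (C := ε / 3)
      (f := fun x => f x - g x) (Eventually.of_forall fun x => by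
        have := ContinuousMap.dist_apply_le_dist (f := f.toContinuousMap) (g := g) x
        exact (Real.dist_eq _ _).symm.le.trans (this.trans hfg.le))
    simpa using this
  filter_upwards [Metric.tendsto_nhds.mp (hA g hg) (ε / 3) (by positivity)] with i hi
  rw [Real.dist_eq] at hi ⊢
  have h1 := hb (P i)
  have h2 := hb ν
  rw [abs_le] at h1 h2
  rw [abs_lt] at hi ⊢
  constructor <;> linarith [hi.1, hi.2, h1.1, h1.2, h2.1, h2.2]

/-- Weak neighbourhoods are described by finitely many functions from a multiplicatively closed
family that separates points. -/
theorem exists_finset_of_mem_nhds (S : Submonoid C(K, ℝ))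
    (hS : ∀ x y : K, x ≠ y → ∃ f ∈ S, f x ≠ f y) (ν : ProbabilityMeasure K)
    {O : Set (ProbabilityMeasure K)} (hO : O ∈ 𝓝 ν) :
    ∃ (T : Finset S) (ε : ℝ), 0 < ε ∧ ∀ P : ProbabilityMeasure K,
      (∀ f ∈ T, |∫ x, f.1 x ∂(P : Measure K) - ∫ x, f.1 x ∂(ν : Measure K)| < ε) → P ∈ O := by
  let I : ProbabilityMeasure K → (S → ℝ) := fun P f => ∫ x, f.1 x ∂(P : Measure K)
  -- The convergence criterion, applied to the identity along the filter pulled back by all the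
  -- integrals, says that these integrals generate the neighbourhoods of `ν`.
  have ht : Tendsto id (comap I (𝓝 (I ν))) (𝓝 ν) := by
    refine tendsto_of_submonoid S hS fun f hf => ?_
    have : Tendsto I (comap I (𝓝 (I ν))) (𝓝 (I ν)) := tendsto_comap
    exact (tendsto_pi_nhds.mp this) ⟨f, hf⟩
  obtain ⟨W, hW, hWO⟩ := ht hO
  rw [nhds_pi, Filter.mem_pi] at hW
  obtain ⟨J, hJ, t, ht, hJt⟩ := hW
  choose r hr hrt using fun f => Metric.mem_nhds_iff.mp (ht f)
  obtain ⟨ε, hε, hεr⟩ : ∃ ε > 0, ∀ f ∈ hJ.toFinset, ε ≤ r f := by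
    rcases hJ.toFinset.eq_empty_or_nonempty with he | hne
    · exact ⟨1, one_pos, by simp [he]⟩
    · exact ⟨hJ.toFinset.inf' hne r, (Finset.lt_inf'_iff _).mpr fun f _ => hr f,
        fun f hf => Finset.inf'_le _ hf⟩
  refine ⟨hJ.toFinset, ε, hε, fun P hP => hWO (hJt fun f hf => hrt f ?_)⟩
  rw [Metric.mem_ball, Real.dist_eq]
  exact (hP f (by simpa using hf)).trans_le (hεr f (by simpa using hf))

theorem integral_lt_mem_nhds {ν : ProbabilityMeasure K} (f : C(K, ℝ)) {a : ℝ}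
    (h : ∫ x, f x ∂(ν : Measure K) < a) :
    {P : ProbabilityMeasure K | ∫ x, f x ∂(P : Measure K) < a} ∈ 𝓝 ν :=
  (ProbabilityMeasure.continuous_integral_continuousMap f).continuousAt.eventually_lt
    continuousAt_const h

end WeakConvergence

/-! ### Recoding of models -/

section Recode

variable {G : Type*} {V : Type*} {𝒳 𝒴 𝒵 : Type*}

/-- The coordinatewise application of a map of alphabets. -/
def recode (φ : 𝒳 → 𝒴) (ω : G → 𝒳) : G → 𝒴 := fun g => φ (ω g)

theorem measurable_recode [MeasurableSpace 𝒳] [MeasurableSpace 𝒴] {φ : 𝒳 → 𝒴}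
    (hφ : Measurable φ) : Measurable (recode (G := G) φ) :=
  measurable_pi_lambda _ fun g => hφ.comp (measurable_pi_apply g)

theorem continuous_recode [TopologicalSpace 𝒳] [TopologicalSpace 𝒴] {φ : 𝒳 → 𝒴}
    (hφ : Continuous φ) : Continuous (recode (G := G) φ) :=
  continuous_pi fun g => hφ.comp (continuous_apply g)

/-- The law of a recoded process. -/
def recodeLaw [MeasurableSpace 𝒳] [MeasurableSpace 𝒴] {φ : 𝒳 → 𝒴} (hφ : Measurable φ)
    (ν : ProbabilityMeasure (G → 𝒳)) : ProbabilityMeasure (G → 𝒴) :=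
  ν.map (measurable_recode hφ).aemeasurable

theorem toMeasure_recodeLaw [MeasurableSpace 𝒳] [MeasurableSpace 𝒴] {φ : 𝒳 → 𝒴}
    (hφ : Measurable φ) (ν : ProbabilityMeasure (G → 𝒳)) :
    (recodeLaw hφ ν : Measure (G → 𝒴)) = (ν : Measure (G → 𝒳)).map (recode φ) := rfl

theorem recodeLaw_recodeLaw [MeasurableSpace 𝒳] [MeasurableSpace 𝒴] [MeasurableSpace 𝒵]
    {φ : 𝒳 → 𝒴} (hφ : Measurable φ) {ψ : 𝒴 → 𝒵} (hψ : Measurable ψ)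
    (ν : ProbabilityMeasure (G → 𝒳)) :
    recodeLaw hψ (recodeLaw hφ ν) = recodeLaw (hψ.comp hφ) ν := by
  apply Subtype.ext
  change ((ν : Measure (G → 𝒳)).map (recode φ)).map (recode ψ) = _
  rw [Measure.map_map (measurable_recode hψ) (measurable_recode hφ)]
  rfl

theorem recodeLaw_id [MeasurableSpace 𝒳] (ν : ProbabilityMeasure (G → 𝒳)) :
    recodeLaw measurable_id ν = ν := by
  apply Subtype.ext
  change ((ν : Measure (G → 𝒳)).map (recode id)) = _
  exact Measure.map_id

variable [Fintype V] [Nonempty V] [MeasurableSpace 𝒳] [MeasurableSpace 𝒴]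

theorem toMeasure_empirical (σ : G → Equiv.Perm V) (x : V → 𝒳) :
    (empirical σ x : Measure (G → 𝒳))
      = ((Fintype.card V : ℝ≥0∞))⁻¹ • ∑ v : V, Measure.dirac (pullbackName σ v x) := rfl

theorem integral_empirical [Countable G] [MeasurableSingletonClass 𝒳] (σ : G → Equiv.Perm V)
    (x : V → 𝒳) (f : (G → 𝒳) → ℝ) :
    ∫ ω, f ω ∂(empirical σ x : Measure (G → 𝒳))
      = (∑ v, f (pullbackName σ v x)) / (Fintype.card V : ℝ) := by
  rw [toMeasure_empirical, integral_smul_measure, integral_finsetSum_measure]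
  · simp [div_eq_inv_mul]
  · intro v _
    exact integrable_dirac (by simp)

theorem empirical_recode (σ : G → Equiv.Perm V) {φ : 𝒳 → 𝒴} (hφ : Measurable φ) (x : V → 𝒳) :
    empirical σ (fun v => φ (x v)) = recodeLaw hφ (empirical σ x) := by
  apply Subtype.ext
  change (empirical σ (fun v => φ (x v)) : Measure (G → 𝒴)) = _
  rw [← ProbabilityMeasure.val_eq_to_measure, ProbabilityMeasure.val_eq_to_measure (recodeLaw _ _),
    toMeasure_recodeLaw]
  change ((Fintype.card V : ℝ≥0∞))⁻¹ • ∑ v : V, Measure.dirac (pullbackName σ v fun v => φ (x v))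
    = (((Fintype.card V : ℝ≥0∞))⁻¹ • ∑ v : V, Measure.dirac (pullbackName σ v x)).map (recode φ)
  rw [Measure.map_smul, Measure.map_finset_sum (measurable_recode hφ).aemeasurable]
  simp only [Measure.map_dirac' (measurable_recode hφ)]
  rfl

/-- Continuous maps of alphabets preserve good models. -/
theorem exists_nhds_recode [Countable G] [TopologicalSpace 𝒳] [TopologicalSpace 𝒴]
    [BorelSpace 𝒳] [BorelSpace 𝒴] [SecondCountableTopology 𝒳] [SecondCountableTopology 𝒴]
    {φ : 𝒳 → 𝒴} (hφ : Continuous φ) (ν : ProbabilityMeasure (G → 𝒳))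
    {O : Set (ProbabilityMeasure (G → 𝒴))} (hO : O ∈ 𝓝 (recodeLaw hφ.measurable ν)) :
    (recodeLaw hφ.measurable) ⁻¹' O ∈ 𝓝 ν :=
  (ProbabilityMeasure.continuous_map (continuous_recode hφ)).continuousAt hO

end Recode

/-! ### Approximation of measurable maps between compact metric spaces -/

section Approximation

variable {𝒳 𝒴 : Type*} [MetricSpace 𝒳] [CompactSpace 𝒳]
  [MetricSpace 𝒴] [CompactSpace 𝒴]

/-- The Kuratowski embedding of a compact metric space into its continuous functions. -/
def distMap (y : 𝒴) : C(𝒴, ℝ) := ⟨fun z => dist y z, by fun_prop⟩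

/-- Places `𝒴` in a Banach space, where Bochner integration and the `L¹` density of continuous
functions are available for maps into `𝒴`. -/
theorem isometry_distMap : Isometry (distMap (𝒴 := 𝒴)) := by
  refine Isometry.of_dist_eq fun y z => le_antisymm ?_ ?_
  · exact (ContinuousMap.dist_le dist_nonneg).mpr fun w => by
      simpa [distMap, Real.dist_eq] using abs_dist_sub_le y z w
  · have := ContinuousMap.dist_apply_le_dist (f := distMap y) (g := distMap z) z
    simpa [distMap, Real.dist_eq] using this

/-- A finite open cover by sets with null frontiers supports maps with prescribed constant values
that are almost everywhere continuous. -/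
theorem exists_ae_continuousAt_of_finset [MeasurableSpace 𝒳] [BorelSpace 𝒳] [MeasurableSpace 𝒴]
    [Nonempty 𝒴] (μ : Measure 𝒳) {ι : Type*} (s : Finset ι) (U : ι → Set 𝒳) (y : ι → 𝒴)
    (hU : ∀ i, IsOpen (U i)) (hU0 : ∀ i, μ (frontier (U i)) = 0) :
    ∃ ψ : 𝒳 → 𝒴, Measurable ψ ∧ (∀ᵐ x ∂μ, ContinuousAt ψ x) ∧
      ∀ x, (∃ i ∈ s, x ∈ U i) → ∃ i ∈ s, x ∈ U i ∧ ψ x = y i := by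
  classical
  induction s using Finset.induction_on with
  | empty =>
    exact ⟨fun _ => Classical.arbitrary 𝒴, measurable_const,
      Eventually.of_forall fun _ => continuousAt_const, by simp⟩
  | insert a s _ ih =>
    obtain ⟨ψ, hm, hc, hv⟩ := ih
    refine ⟨(U a).piecewise (fun _ => y a) ψ,
      Measurable.piecewise (hU a).measurableSet measurable_const hm, ?_, ?_⟩
    · filter_upwards [hc, measure_eq_zero_iff_ae_notMem.mp (hU0 a)] with x hx hxa
      by_cases hxU : x ∈ U a
      · have : (U a).piecewise (fun _ => y a) ψ =ᶠ[𝓝 x] fun _ => y a := by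
          filter_upwards [(hU a).mem_nhds hxU] with z hz
          exact Set.piecewise_eq_of_mem _ _ _ hz
        exact continuousAt_const.congr this.symm
      · have hxc : x ∈ (closure (U a))ᶜ := fun h => hxa ⟨h, fun h' => hxU (interior_subset h')⟩
        have : (U a).piecewise (fun _ => y a) ψ =ᶠ[𝓝 x] ψ := by
          filter_upwards [isClosed_closure.isOpen_compl.mem_nhds hxc] with z hz
          exact Set.piecewise_eq_of_notMem _ _ _ fun h => hz (subset_closure h)
        exact hx.congr this.symm
    · intro x hx
      by_cases hxU : x ∈ U a
      · exact ⟨a, Finset.mem_insert_self _ _, hxU, Set.piecewise_eq_of_mem _ _ _ hxU⟩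
      · obtain ⟨i, hi, hiU⟩ := hx
        rcases Finset.mem_insert.mp hi with rfl | hi
        · exact absurd hiU hxU
        · obtain ⟨j, hj, hjU, hjy⟩ := hv x ⟨i, hi, hiU⟩
          exact ⟨j, Finset.mem_insert_of_mem hj, hjU,
            (Set.piecewise_eq_of_notMem _ _ _ hxU).trans hjy⟩

variable [MeasurableSpace 𝒳] [BorelSpace 𝒳] [MeasurableSpace 𝒴] [BorelSpace 𝒴]

theorem stronglyMeasurable_distMap_comp {Ω : Type*} [MeasurableSpace Ω] {φ : Ω → 𝒴}
    (hφ : Measurable φ) : StronglyMeasurable fun x => distMap (φ x) :=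
  isometry_distMap.continuous.comp_stronglyMeasurable hφ.stronglyMeasurable

theorem integrable_distMap_comp {Ω : Type*} [MeasurableSpace Ω] (μ : Measure Ω)
    [IsFiniteMeasure μ] {φ : Ω → 𝒴} (hφ : Measurable φ) :
    Integrable (fun x => distMap (φ x)) μ := by
  refine Integrable.of_bound (stronglyMeasurable_distMap_comp hφ).aestronglyMeasurable
    (Metric.diam (Set.univ : Set 𝒴)) (Eventually.of_forall fun x => ?_)
  refine (ContinuousMap.norm_le _ Metric.diam_nonneg).mpr fun z => ?_
  simpa [distMap] using
    Metric.dist_le_diam_of_mem isCompact_univ.isBounded (Set.mem_univ (φ x)) (Set.mem_univ z)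

/-- Measurable maps between compact metric spaces are approximated in `L¹` by almost everywhere
continuous ones. -/
theorem exists_ae_continuousAt_integral_dist_le (μ : Measure 𝒳) [IsProbabilityMeasure μ]
    {φ : 𝒳 → 𝒴} (hφ : Measurable φ) {ε : ℝ} (hε : 0 < ε) :
    ∃ ψ : 𝒳 → 𝒴, Measurable ψ ∧ (∀ᵐ x ∂μ, ContinuousAt ψ x) ∧
      ∫ x, dist (ψ x) (φ x) ∂μ ≤ ε := by
  have hne : Nonempty 𝒳 := by
    by_contra h
    rw [not_nonempty_iff] at h
    exact IsProbabilityMeasure.ne_zero μ (Measure.eq_zero_of_isEmpty μ)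
  have : Nonempty 𝒴 := hne.map φ
  -- The approximant `θ` takes values in `C(𝒴, ℝ)`, off the image of `𝒴`. It is brought back by
  -- choosing, on each small ball, a point of `𝒴` nearest to the value of `θ` at the centre.
  obtain ⟨θ, hθ, hθi⟩ := (integrable_distMap_comp μ hφ).exists_boundedContinuous_integral_sub_le
    (ε := ε / 4) (by positivity)
  obtain ⟨s, hs, hsθ⟩ := Metric.uniformContinuous_iff.mp
    (CompactSpace.uniformContinuous_of_continuous θ.continuous) (ε / 4) (by positivity)
  -- Radii in `(s/2, s)` whose balls have null frontier, so that a map constant on the pieces is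
  -- almost everywhere continuous.
  choose r hr hr0 using fun x : 𝒳 => exists_null_frontier_thickening μ {x} (half_lt_self hs)
  let U : 𝒳 → Set 𝒳 := fun x => Metric.thickening (r x) {x}
  have hxU : ∀ x, x ∈ U x := fun x =>
    Metric.self_subset_thickening ((half_pos hs).trans (hr x).1) _ rfl
  obtain ⟨t, ht⟩ := isCompact_univ.elim_nhds_subcover U
    (fun x _ => Metric.isOpen_thickening.mem_nhds (hxU x))
  have hmin : ∀ x : 𝒳, ∃ y : 𝒴, ∀ z : 𝒴, ‖distMap y - θ x‖ ≤ ‖distMap z - θ x‖ := fun x => by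
    obtain ⟨y, -, hy⟩ := isCompact_univ.exists_isMinOn Set.univ_nonempty
      (f := fun y : 𝒴 => ‖distMap y - θ x‖)
      (isometry_distMap.continuous.sub continuous_const).norm.continuousOn
    exact ⟨y, fun z => hy (Set.mem_univ z)⟩
  choose y hy using hmin
  obtain ⟨ψ, hm, hc, hv⟩ := exists_ae_continuousAt_of_finset μ t U y
    (fun _ => Metric.isOpen_thickening) hr0
  refine ⟨ψ, hm, hc, ?_⟩
  have hint : Integrable (fun x => ‖distMap (φ x) - θ x‖) μ :=
    ((integrable_distMap_comp μ hφ).sub hθi).norm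
  -- Minimality of the chosen value costs a factor `2`, and `θ` oscillates by less than `ε/4` on a
  -- ball. After integration the two terms are at most `ε/2` each.
  have hpt : ∀ x, dist (ψ x) (φ x) ≤ 2 * ‖distMap (φ x) - θ x‖ + ε / 2 := by
    intro x
    obtain ⟨i, hi, hiU⟩ : ∃ i ∈ t, x ∈ U i := by simpa using ht.2 (Set.mem_univ x)
    obtain ⟨i, -, hiU, hiy⟩ := hv x ⟨i, hi, hiU⟩
    have hd : dist x i < s := by
      obtain ⟨z, rfl, hz⟩ := Metric.mem_thickening_iff.mp hiU
      exact hz.trans (hr _).2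
    have hθd : ‖θ x - θ i‖ < ε / 4 := by rw [← dist_eq_norm]; exact hsθ hd
    rw [hiy, ← isometry_distMap.dist_eq, dist_eq_norm]
    have h1 : ‖distMap (y i) - distMap (φ x)‖ ≤ ‖distMap (y i) - θ i‖ + ‖distMap (φ x) - θ i‖ := by
      have := norm_sub_le (distMap (y i) - θ i) (distMap (φ x) - θ i)
      simpa using this
    have h2 : ‖distMap (φ x) - θ i‖ ≤ ‖distMap (φ x) - θ x‖ + ‖θ x - θ i‖ := by
      have := norm_add_le (distMap (φ x) - θ x) (θ x - θ i)
      simpa using this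
    linarith [hy i (φ x)]
  calc ∫ x, dist (ψ x) (φ x) ∂μ ≤ ∫ x, (2 * ‖distMap (φ x) - θ x‖ + ε / 2) ∂μ :=
        integral_mono_of_nonneg (Eventually.of_forall fun _ => dist_nonneg)
          ((hint.const_mul 2).add (integrable_const _)) (Eventually.of_forall hpt)
    _ = 2 * ∫ x, ‖distMap (φ x) - θ x‖ ∂μ + ε / 2 := by
        rw [integral_add (hint.const_mul 2) (integrable_const _), integral_const_mul]
        simp
    _ ≤ ε := by linarith

/-- The `L¹` errors tend to zero, hence there is convergence in measure, and a subsequence converges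
almost everywhere. -/
theorem exists_seq_ae_continuousAt_tendsto (μ : Measure 𝒳) [IsProbabilityMeasure μ]
    {φ : 𝒳 → 𝒴} (hφ : Measurable φ) :
    ∃ ψ : ℕ → 𝒳 → 𝒴, (∀ j, Measurable (ψ j)) ∧ (∀ j, ∀ᵐ x ∂μ, ContinuousAt (ψ j) x) ∧
      ∀ᵐ x ∂μ, Tendsto (fun j => ψ j x) atTop (𝓝 (φ x)) := by
  choose ψ hm hc hd using fun j : ℕ =>
    exists_ae_continuousAt_integral_dist_le μ hφ (ε := 1 / ((j : ℝ) + 1)) (by positivity)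
  have hDm : ∀ j, Measurable fun x => dist (ψ j x) (φ x) := fun j => (hm j).dist hφ
  have hDi : ∀ j, Integrable (fun x => dist (ψ j x) (φ x)) μ := fun j =>
    Integrable.of_bound (hDm j).aestronglyMeasurable (Metric.diam (Set.univ : Set 𝒴))
      (Eventually.of_forall fun x => by
        simpa using Metric.dist_le_diam_of_mem isCompact_univ.isBounded (Set.mem_univ (ψ j x))
          (Set.mem_univ (φ x)))
  have hL : Tendsto (fun j => eLpNorm ((fun x => dist (ψ j x) (φ x)) - fun _ => (0 : ℝ)) 1 μ)
      atTop (𝓝 0) := by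
    have h1 : ∀ j, eLpNorm ((fun x => dist (ψ j x) (φ x)) - fun _ => (0 : ℝ)) 1 μ
        = ENNReal.ofReal (∫ x, dist (ψ j x) (φ x) ∂μ) := fun j => by
      rw [eLpNorm_one_eq_lintegral_enorm, ofReal_integral_eq_lintegral_ofReal (hDi j)
        (Eventually.of_forall fun _ => dist_nonneg)]
      refine lintegral_congr fun x => ?_
      simp [Real.enorm_eq_ofReal dist_nonneg]
    simp only [h1]
    rw [← ENNReal.ofReal_zero]
    exact ENNReal.tendsto_ofReal (squeeze_zero (fun j => integral_nonneg fun _ => dist_nonneg)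
      hd tendsto_one_div_add_atTop_nhds_zero_nat)
  obtain ⟨ns, -, hns⟩ := (tendstoInMeasure_of_tendsto_eLpNorm one_ne_zero
    (fun j => (hDm j).aestronglyMeasurable) aestronglyMeasurable_const hL).exists_seq_tendsto_ae
  refine ⟨fun j => ψ (ns j), fun j => hm _, fun j => hc _, ?_⟩
  filter_upwards [hns] with x hx
  exact tendsto_iff_dist_tendsto_zero.mpr hx

end Approximation

/-! ### Lifting good models through a measurable recoding -/

section Lift

variable {G : Type*} [Countable G] {𝒳 𝒴 : Type*}
  [MetricSpace 𝒳] [CompactSpace 𝒳] [MeasurableSpace 𝒳] [BorelSpace 𝒳]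
  [MetricSpace 𝒴] [CompactSpace 𝒴] [MeasurableSpace 𝒴] [BorelSpace 𝒴]

theorem measurable_graph {φ : 𝒳 → 𝒴} (hφ : Measurable φ) :
    Measurable fun x : 𝒳 => (x, φ x) := measurable_id.prodMk hφ

/-- A measurable map of alphabets lifts good models to good models of its graph joining. -/
theorem exists_lift (μ : Measure 𝒳) [IsProbabilityMeasure μ] (ν : ProbabilityMeasure (G → 𝒳))
    (hν : ∀ g, (ν : Measure (G → 𝒳)).map (fun ω => ω g) = μ) {φ : 𝒳 → 𝒴} (hφ : Measurable φ)
    {O : Set (ProbabilityMeasure (G → 𝒳 × 𝒴))} (hO : O ∈ 𝓝 (recodeLaw (measurable_graph hφ) ν)) :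
    ∃ (ψ : 𝒳 → 𝒴) (hψ : Measurable ψ), ∃ O' ∈ 𝓝 ν,
      ∀ P ∈ O', recodeLaw (measurable_graph hψ) P ∈ O := by
  obtain ⟨ψ, hm, hc, ht⟩ := exists_seq_ae_continuousAt_tendsto μ hφ
  -- Countability of `G` lets an almost sure property of one letter hold at all coordinates at once.
  have hae : ∀ {p : 𝒳 → Prop}, (∀ᵐ x ∂μ, p x) → ∀ᵐ ω ∂(ν : Measure (G → 𝒳)), ∀ g, p (ω g) := by
    intro p hp
    refine ae_all_iff.mpr fun g => ?_
    rw [← hν g] at hp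
    exact ae_of_ae_map (measurable_pi_apply g).aemeasurable hp
  have hlim : Tendsto (fun j => recodeLaw (measurable_graph (hm j)) ν) atTop
      (𝓝 (recodeLaw (measurable_graph hφ) ν)) := by
    rw [ProbabilityMeasure.tendsto_iff_forall_integral_tendsto]
    intro f
    have key : ∀ {χ : 𝒳 → 𝒴} (hχ : Measurable χ),
        ∫ ω, f ω ∂(recodeLaw (measurable_graph hχ) ν : Measure (G → 𝒳 × 𝒴))
          = ∫ ω, f (recode (fun x => (x, χ x)) ω) ∂(ν : Measure (G → 𝒳)) := fun hχ => by
      rw [toMeasure_recodeLaw]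
      exact integral_map (measurable_recode (measurable_graph hχ)).aemeasurable
        f.continuous.aestronglyMeasurable
    rw [key hφ]
    refine (tendsto_congr fun j => key (hm j)).mpr ?_
    refine tendsto_integral_of_dominated_convergence (fun _ => ‖f‖)
      (fun j => (f.continuous.measurable.comp
        (measurable_recode (measurable_graph (hm j)))).aestronglyMeasurable)
      (integrable_const _) (fun j => Eventually.of_forall fun ω => f.norm_coe_le_norm _) ?_
    filter_upwards [hae ht] with ω hω
    refine (f.continuous.tendsto _).comp (tendsto_pi_nhds.mpr fun g => ?_)
    exact tendsto_const_nhds.prodMk_nhds (hω g)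
  obtain ⟨j, hj⟩ := (hlim.eventually_mem (interior_mem_nhds.mpr hO)).exists
  -- Recoding by `φ` itself need not be weakly continuous at `ν`. Recoding by `ψ j` is, since its
  -- discontinuities are null in every coordinate, and its law at `ν` already lies in the interior
  -- of `O`.
  refine ⟨ψ j, hm j, _, tendsto_map_of_ae_continuousAt ν
    (measurable_recode (measurable_graph (hm j))) ?_ (isOpen_interior.mem_nhds hj),
    fun P hP => interior_subset hP⟩
  filter_upwards [hae (hc j)] with ω hω
  refine continuousAt_pi.mpr fun g => ?_
  exact (continuousAt_apply g ω).prodMk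
    (ContinuousAt.comp (f := fun p : G → 𝒳 => p g) (hω g) (continuousAt_apply g ω))

end Lift

/-! ### Hamming averages and covering numbers -/

section Hamming

variable {V : Type*} [Fintype V] {𝒳 𝒴 : Type*} [MetricSpace 𝒳] [MetricSpace 𝒴]

theorem hammingAvg_self (x : V → 𝒳) : hammingAvg x x = 0 := by simp [hammingAvg]

theorem hammingAvg_comm (x y : V → 𝒳) : hammingAvg x y = hammingAvg y x := by
  simp [hammingAvg, dist_comm]

theorem hammingAvg_triangle (x y z : V → 𝒳) :
    hammingAvg x z ≤ hammingAvg x y + hammingAvg y z := by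
  rw [hammingAvg, hammingAvg, hammingAvg, ← add_div, ← Finset.sum_add_distrib]
  gcongr
  exact dist_triangle _ _ _

theorem hammingAvg_mono {x y : V → 𝒳} {x' y' : V → 𝒴}
    (h : ∀ v, dist (x v) (y v) ≤ dist (x' v) (y' v)) : hammingAvg x y ≤ hammingAvg x' y' := by
  unfold hammingAvg
  gcongr with v _
  exact h v

theorem hammingAvg_pi_le {ι : Type*} [Fintype ι] (x y : V → ι → 𝒳) :
    hammingAvg x y ≤ ∑ i, hammingAvg (fun v => x v i) (fun v => y v i) := by
  unfold hammingAvg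
  rw [← Finset.sum_div, Finset.sum_comm]
  gcongr with v _
  refine (dist_pi_le_iff (Finset.sum_nonneg fun _ _ => dist_nonneg)).mpr fun i => ?_
  exact Finset.single_le_sum (f := fun i => dist (x v i) (y v i)) (fun _ _ => dist_nonneg)
    (Finset.mem_univ i)

theorem cov_le_encard {δ : ℝ} {Z F : Set (V → 𝒳)} (hF : F ⊆ Z) (hZ : Z ⊆ hammingNhd δ F) :
    cov δ Z ≤ F.encard :=
  iInf_le_of_le F (iInf_le_of_le hF (iInf_le_of_le hZ le_rfl))

theorem exists_encard_eq_cov {δ : ℝ} {Z : Set (V → 𝒳)} (h : cov δ Z ≠ ⊤) :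
    ∃ F ⊆ Z, Z ⊆ hammingNhd δ F ∧ F.encard = cov δ Z := by
  obtain ⟨F, hF⟩ := ciInf_mem (fun F : Set (V → 𝒳) =>
    ⨅ (_ : F ⊆ Z) (_ : Z ⊆ hammingNhd δ F), F.encard)
  change _ = cov δ Z at hF
  have h1 : F ⊆ Z := by
    by_contra h1
    exact h (hF ▸ by simp [h1])
  have h2 : Z ⊆ hammingNhd δ F := by
    by_contra h2
    exact h (hF ▸ by simp [h2])
  exact ⟨F, h1, h2, by simpa [h1, h2] using hF⟩

theorem cov_eq_zero_iff {δ : ℝ} {Z : Set (V → 𝒳)} : cov δ Z = 0 ↔ Z = ∅ := by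
  constructor
  · intro h
    obtain ⟨F, -, hZ, hF⟩ := exists_encard_eq_cov (δ := δ) (Z := Z) (by simp [h])
    rw [h, Set.encard_eq_zero] at hF
    subst hF
    exact Set.subset_eq_empty hZ (by simp [hammingNhd])
  · rintro rfl
    have := cov_le_encard (δ := δ) (Z := (∅ : Set (V → 𝒳))) (Set.Subset.refl _)
      (Set.empty_subset _)
    simpa using this

/-- If the points of `Z` have tuples of codes in `W` that separate them, then the covering number
of `Z` is bounded by a power of that of `W`. -/
theorem cov_le_cov_pow {δ δ' : ℝ} {q : ℕ} (hq : 0 < q) {Z : Set (V → 𝒳)} {W : Set (V → 𝒴)}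
    (Y : (V → 𝒳) → Fin q → V → 𝒴) (hY : ∀ x ∈ Z, ∀ i, Y x i ∈ W)
    (hsep : ∀ x ∈ Z, ∀ x' ∈ Z, (∀ i, hammingAvg (Y x i) (Y x' i) < 2 * δ') →
      hammingAvg x x' < δ) : cov δ Z ≤ cov δ' W ^ q := by
  classical
  by_cases htop : cov δ' W = ⊤
  · simp [htop, hq.ne']
  obtain ⟨F, -, hWF, hF⟩ := exists_encard_eq_cov htop
  have hfin : F.Finite := Set.encard_ne_top_iff.mp (by rwa [hF])
  rcases Z.eq_empty_or_nonempty with rfl | ⟨x₀, -⟩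
  · simp [cov_eq_zero_iff.mpr rfl]
  have : Nonempty (Fin q → V → 𝒴) := ⟨Y x₀⟩
  have hex : ∀ x ∈ Z, ∃ t ∈ Fintype.piFinset (fun _ : Fin q => hfin.toFinset),
      ∀ i, hammingAvg (Y x i) (t i) < δ' := fun x hx => by
    choose t ht htx using fun i => hWF (hY x hx i)
    exact ⟨t, by simpa [Fintype.mem_piFinset] using ht, htx⟩
  choose! t htF ht using hex
  -- One representative in `Z` per code tuple in use: the definition of `cov` wants the centres
  -- inside `Z`. Two points with the same tuple have codes within `2 * δ'` of each other.
  obtain ⟨Z', hZ', hbij⟩ := Set.exists_subset_bijOn Z t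
  have hnhd : Z ⊆ hammingNhd δ Z' := by
    intro x hx
    obtain ⟨x', hx', hxx'⟩ := hbij.surjOn ⟨x, hx, rfl⟩
    refine ⟨x', hx', hsep x hx x' (hZ' hx') fun i => ?_⟩
    have h1 := ht x hx i
    have h2 := ht x' (hZ' hx') i
    rw [hxx', hammingAvg_comm] at h2
    linarith [hammingAvg_triangle (Y x i) (t x i) (Y x' i)]
  calc cov δ Z ≤ Z'.encard := cov_le_encard hZ' hnhd
    _ = (t '' Z).encard := by rw [← hbij.image_eq, hbij.injOn.encard_image]
    _ ≤ ((Fintype.piFinset fun _ : Fin q => hfin.toFinset : Finset (Fin q → V → 𝒴)) :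
        Set (Fin q → V → 𝒴)).encard :=
        Set.encard_le_encard (by rintro _ ⟨x, hx, rfl⟩; exact htF x hx)
    _ = cov δ' W ^ q := by
        rw [Set.encard_coe_eq_coe_finsetCard, Fintype.card_piFinset_const, ← hF,
          hfin.encard_eq_coe_toFinset_card]
        push_cast
        simp

theorem logRate_mono {M N : ℕ∞} (h : M ≤ N) : logRate V M ≤ logRate V N :=
  EReal.div_le_div_right_of_nonneg (by positivity)
    (ENNReal.log_monotone (ENat.toENNReal_mono h))

theorem logRate_pow (N : ℕ∞) (q : ℕ) : logRate V (N ^ q) = q * logRate V N := by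
  rw [logRate, logRate, EReal.mul_div, ← ENNReal.log_pow]
  congr 2
  exact map_pow ENat.toENNRealRingHom N q

theorem logRate_zero [Nonempty V] : logRate V 0 = ⊥ := by
  rw [logRate]
  simp only [ENat.toENNReal_zero, ENNReal.log_zero]
  exact EReal.bot_div_of_pos_ne_top (by exact_mod_cast Fintype.card_pos) (EReal.natCast_ne_top _)

theorem logRate_nonneg {N : ℕ∞} (h : N ≠ 0) : 0 ≤ logRate V N := by
  refine EReal.div_nonneg ?_ (by positivity)
  rw [ENNReal.zero_le_log_iff]
  have : (1 : ℕ∞) ≤ N := Order.one_le_iff_ne_zero.mpr h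
  exact_mod_cast ENat.toENNReal_mono this

end Hamming

/-! ### Separation of good models by a generating coordinate -/

section Separation

variable {G : Type*} {𝒳 𝒴 : Type*}

/-- Continuous functions on a product of compact metric spaces are, up to a small error, Lipschitz
in finitely many coordinates. -/
theorem exists_lipschitz_bound [MetricSpace 𝒴] [CompactSpace 𝒴] {E : Type*}
    [NormedAddCommGroup E] {θ : (G → 𝒴) → E} (hθ : Continuous θ) {ε : ℝ} (hε : 0 < ε) :
    ∃ (s : Finset G) (C : ℝ), 0 ≤ C ∧
      ∀ η η' : G → 𝒴, ‖θ η - θ η'‖ ≤ ε + C * ∑ g ∈ s, dist (η g) (η' g) := by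
  obtain ⟨M, hM⟩ := (isCompact_range hθ).isBounded.exists_norm_le
  have hM0 : 0 ≤ max M 0 := le_max_right _ _
  have hu := (Metric.uniformity_basis_dist (α := E)).mem_of_mem (i := ε) hε
  have hu' := CompactSpace.uniformContinuous_of_continuous hθ hu
  rw [mem_map, Pi.uniformity, Filter.mem_iInf] at hu'
  obtain ⟨I, hI, U, hU, hIU⟩ := hu'
  choose W hW hWU using fun i => mem_comap.mp (hU i)
  choose r hr hrW using fun i => Metric.mem_uniformity_dist.mp (hW i)
  have := hI.fintype
  obtain ⟨ρ, hρ, hρr⟩ : ∃ ρ > 0, ∀ i, ρ ≤ r i := by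
    rcases isEmpty_or_nonempty I with he | hne
    · exact ⟨1, one_pos, fun i => he.elim i⟩
    · exact ⟨Finset.univ.inf' Finset.univ_nonempty r,
        (Finset.lt_inf'_iff _).mpr fun i _ => hr i,
        fun i => Finset.inf'_le _ (Finset.mem_univ i)⟩
  -- Either all the relevant coordinates are within `ρ` and uniform continuity gives `ε`, or the sum
  -- is at least `ρ` and this constant absorbs the trivial bound `2 * max M 0`.
  refine ⟨hI.toFinset, 2 * max M 0 / ρ, by positivity, fun η η' => ?_⟩
  have hsum : 0 ≤ ∑ g ∈ hI.toFinset, dist (η g) (η' g) :=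
    Finset.sum_nonneg fun _ _ => dist_nonneg
  by_cases h : ∀ i ∈ I, dist (η i) (η' i) < ρ
  · have hmem : (η, η') ∈ ⋂ i, U i := Set.mem_iInter.mpr fun i =>
      hWU i (hrW i ((h i i.2).trans_le (hρr i)))
    rw [← hIU] at hmem
    have h1 : dist (θ η) (θ η') < ε := hmem
    rw [dist_eq_norm] at h1
    have : 0 ≤ 2 * max M 0 / ρ * ∑ g ∈ hI.toFinset, dist (η g) (η' g) := by positivity
    linarith
  · push Not at h
    obtain ⟨i, hi, hir⟩ := h
    have h1 : ρ ≤ ∑ g ∈ hI.toFinset, dist (η g) (η' g) :=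
      hir.trans (Finset.single_le_sum (f := fun g => dist (η g) (η' g))
        (fun _ _ => dist_nonneg) (by simpa using hi))
    have h2 : ‖θ η - θ η'‖ ≤ 2 * max M 0 := by
      have h3 := (hM _ ⟨η, rfl⟩).trans (le_max_left M 0)
      have h4 := (hM _ ⟨η', rfl⟩).trans (le_max_left M 0)
      linarith [norm_sub_le (θ η) (θ η')]
    have h5 : 2 * max M 0 / ρ * ρ ≤ 2 * max M 0 / ρ * ∑ g ∈ hI.toFinset, dist (η g) (η' g) :=
      mul_le_mul_of_nonneg_left h1 (by positivity)
    rw [div_mul_cancel₀ _ hρ.ne'] at h5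
    linarith

variable [Countable G]
  [MetricSpace 𝒳] [CompactSpace 𝒳] [MeasurableSpace 𝒳] [BorelSpace 𝒳]
  [MetricSpace 𝒴] [CompactSpace 𝒴] [MeasurableSpace 𝒴] [BorelSpace 𝒴]

/-- If the first alphabet of a joint process is determined by the second process, then the first
coordinates of good models are close whenever the second ones are. -/
theorem exists_separation.{w} (lam : ProbabilityMeasure (G → 𝒳 × 𝒴)) {χ : (G → 𝒴) → 𝒳}
    (hχ : Measurable χ) (g₀ : G)
    (h : ∀ᵐ ω ∂(lam : Measure (G → 𝒳 × 𝒴)), χ (recode Prod.snd ω) = (ω g₀).1)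
    {δ : ℝ} (hδ : 0 < δ) :
    ∃ δ' > 0, ∃ O ∈ 𝓝 lam, ∀ {V : Type w} [Fintype V] [Nonempty V] (σ : G → Equiv.Perm V)
      (z z' : V → 𝒳 × 𝒴), z ∈ goodModels O σ → z' ∈ goodModels O σ →
      hammingAvg (fun v => (z v).2) (fun v => (z' v).2) < δ' →
      hammingAvg (fun v => (z v).1) (fun v => (z' v).1) < δ := by
  let lam₂ : ProbabilityMeasure (G → 𝒴) := recodeLaw measurable_snd lam
  -- A continuous substitute for `χ` makes the defect `F` a continuous test function; its small
  -- integral is then an open condition, inherited by empirical measures of good models.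
  obtain ⟨θ, hθ, -⟩ := (integrable_distMap_comp (lam₂ : Measure (G → 𝒴))
    hχ).exists_boundedContinuous_integral_sub_le (ε := δ / 8) (by positivity)
  obtain ⟨s, C, hC, hsC⟩ := exists_lipschitz_bound θ.continuous (ε := δ / 4) (by positivity)
  let F : C(G → 𝒳 × 𝒴, ℝ) := ⟨fun ω => ‖distMap (ω g₀).1 - θ (recode Prod.snd ω)‖, by
    have h1 : Continuous fun ω : G → 𝒳 × 𝒴 => distMap (ω g₀).1 :=
      isometry_distMap.continuous.comp (continuous_fst.comp (continuous_apply g₀))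
    have h2 : Continuous fun ω : G → 𝒳 × 𝒴 => θ (recode Prod.snd ω) :=
      θ.continuous.comp (continuous_recode continuous_snd)
    exact (h1.sub h2).norm⟩
  have hF : ∫ ω, F ω ∂(lam : Measure (G → 𝒳 × 𝒴)) < δ / 4 := by
    have h1 : ∫ ω, F ω ∂(lam : Measure (G → 𝒳 × 𝒴))
        = ∫ η, ‖distMap (χ η) - θ η‖ ∂(lam₂ : Measure (G → 𝒴)) := by
      rw [toMeasure_recodeLaw, integral_map (measurable_recode measurable_snd).aemeasurable]
      · refine integral_congr_ae ?_
        filter_upwards [h] with ω hω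
        simp [F, hω]
      · exact ((stronglyMeasurable_distMap_comp hχ).sub
          θ.continuous.stronglyMeasurable).norm.aestronglyMeasurable
    linarith
  -- Four errors of `δ/4`: the defect of `z`, the defect of `z'`, the additive error in the
  -- Lipschitz bound, and the Lipschitz term, controlled by this choice. The `+ 1` guards against `C
  -- * s.card = 0`.
  refine ⟨δ / (4 * (C * s.card + 1)), by positivity, _, integral_lt_mem_nhds F hF, ?_⟩
  intro V _ _ σ z z' hz hz' hd
  have hn : (0 : ℝ) < Fintype.card V := by exact_mod_cast Fintype.card_pos
  have hz1 : ∫ ω, F ω ∂(empirical σ z : Measure (G → 𝒳 × 𝒴)) < δ / 4 := hz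
  have hz2 : ∫ ω, F ω ∂(empirical σ z' : Measure (G → 𝒳 × 𝒴)) < δ / 4 := hz'
  rw [integral_empirical, div_lt_iff₀ hn] at hz1 hz2
  have hd' : ∑ v, dist (z v).2 (z' v).2
      < δ / (4 * (C * s.card + 1)) * Fintype.card V := by
    rw [← div_lt_iff₀ hn]; exact hd
  have hpt : ∀ v, dist (z (σ g₀ v)).1 (z' (σ g₀ v)).1
      ≤ F (pullbackName σ v z) + F (pullbackName σ v z')
        + (δ / 4 + C * ∑ g ∈ s, dist (z (σ g v)).2 (z' (σ g v)).2) := by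
    intro v
    have h1 := hsC (recode Prod.snd (pullbackName σ v z)) (recode Prod.snd (pullbackName σ v z'))
    rw [← isometry_distMap.dist_eq, dist_eq_norm]
    have h2 := norm_sub_le (distMap (z (σ g₀ v)).1 - θ (recode Prod.snd (pullbackName σ v z)))
      (distMap (z' (σ g₀ v)).1 - θ (recode Prod.snd (pullbackName σ v z')))
    have h3 := norm_add_le
      (distMap (z (σ g₀ v)).1 - θ (recode Prod.snd (pullbackName σ v z))
        - (distMap (z' (σ g₀ v)).1 - θ (recode Prod.snd (pullbackName σ v z'))))
      (θ (recode Prod.snd (pullbackName σ v z)) - θ (recode Prod.snd (pullbackName σ v z')))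
    have h4 : distMap (z (σ g₀ v)).1 - θ (recode Prod.snd (pullbackName σ v z))
        - (distMap (z' (σ g₀ v)).1 - θ (recode Prod.snd (pullbackName σ v z')))
        + (θ (recode Prod.snd (pullbackName σ v z)) - θ (recode Prod.snd (pullbackName σ v z')))
        = distMap (z (σ g₀ v)).1 - distMap (z' (σ g₀ v)).1 := by abel
    rw [h4] at h3
    exact (h3.trans (add_le_add h2 le_rfl)).trans (add_le_add le_rfl h1)
  have hsum := Finset.sum_le_sum fun v (_ : v ∈ Finset.univ) => hpt v
  -- Each `σ g` is a bijection, so shifted distances have the same sum as unshifted ones. Nothing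
  -- else about `σ` is needed.
  rw [Equiv.sum_comp (σ g₀) fun v => dist (z v).1 (z' v).1] at hsum
  simp only [Finset.sum_add_distrib, Finset.sum_const, Finset.card_univ, nsmul_eq_mul,
    ← Finset.mul_sum] at hsum
  rw [Finset.sum_comm] at hsum
  simp only [fun g => Equiv.sum_comp (σ g) fun v => dist (z v).2 (z' v).2, Finset.sum_const,
    nsmul_eq_mul] at hsum
  have hCd : C * (s.card * ∑ v, dist (z v).2 (z' v).2) ≤ δ / 4 * Fintype.card V := by
    calc C * (s.card * ∑ v, dist (z v).2 (z' v).2)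
        ≤ (C * s.card + 1) * (δ / (4 * (C * s.card + 1)) * Fintype.card V) := by
          rw [← mul_assoc]
          have h0 : 0 ≤ ∑ v, dist (z v).2 (z' v).2 := Finset.sum_nonneg fun _ _ => dist_nonneg
          have h1 : 0 ≤ C * s.card := by positivity
          exact mul_le_mul (by linarith) hd'.le h0 (by positivity)
      _ = δ / 4 * Fintype.card V := by
          field_simp
  rw [hammingAvg, div_lt_iff₀ hn]
  linarith

end Separation

/-! ### Comparison of entropies of processes -/

section Comparison

universe u w

variable {G : Type u} [Group G] [Countable G] {𝒳 𝒴 : Type*}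
  [MetricSpace 𝒳] [CompactSpace 𝒳] [MeasurableSpace 𝒳] [BorelSpace 𝒳]
  [MetricSpace 𝒴] [CompactSpace 𝒴] [MeasurableSpace 𝒴] [BorelSpace 𝒴]

/-- If finitely many recodings of a process, all with the same law, jointly determine it, then its
entropy is at most the sum of their entropies. -/
theorem processEntropy_le_mul (S : SoficApproximation.{u, w} G) (μ : Measure 𝒳)
    [IsProbabilityMeasure μ] (ν : ProbabilityMeasure (G → 𝒳))
    (hν : ∀ g, (ν : Measure (G → 𝒳)).map (fun ω => ω g) = μ) {q : ℕ} (hq : 0 < q)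
    {φ : Fin q → 𝒳 → 𝒴} (hφ : ∀ i, Measurable (φ i)) {χ : (Fin q → 𝒴) → 𝒳} (hχ : Measurable χ)
    (hχφ : ∀ x, χ (fun i => φ i x) = x) (ν' : ProbabilityMeasure (G → 𝒴))
    (hν' : ∀ i, recodeLaw (hφ i) ν = ν') :
    processEntropy S ν ≤ q * processEntropy S ν' := by
  have hq0 : (0 : EReal) < q := by exact_mod_cast hq
  have hφ' : Measurable fun x i => φ i x := measurable_pi_lambda _ hφ
  let lam := recodeLaw (measurable_graph hφ') ν
  refine iSup₂_le fun δ hδ => ?_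
  have hae : ∀ᵐ ω ∂(lam : Measure (G → 𝒳 × (Fin q → 𝒴))),
      (fun η : G → Fin q → 𝒴 => χ (η 1)) (recode Prod.snd ω) = (ω 1).1 := by
    refine (ae_map_iff (measurable_recode (measurable_graph hφ')).aemeasurable
      (measurableSet_eq_fun ?_ ?_)).mpr (Eventually.of_forall fun ω => hχφ _)
    · exact hχ.comp ((measurable_pi_apply 1).comp (measurable_recode measurable_snd))
    · exact measurable_fst.comp (measurable_pi_apply 1)
  obtain ⟨δ', hδ', O, hO, hsep⟩ := exists_separation lam
    (hχ.comp (measurable_pi_apply 1)) 1 hae hδ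
  rw [← EReal.div_le_iff_le_mul hq0 (EReal.natCast_ne_top q)]
  -- `cov_le_cov_pow` doubles the radius, and the sup distance on `Fin q → 𝒴` is bounded by the sum
  -- of `q` coordinate distances; together these give back `δ'`.
  refine le_iSup₂_of_le (δ' / (2 * q)) (by positivity) (le_iInf₂ fun O' hO' => ?_)
  rw [EReal.div_le_iff_le_mul hq0 (EReal.natCast_ne_top q)]
  have hc : ∀ i : Fin q, Continuous fun p : 𝒳 × (Fin q → 𝒴) => p.2 i := fun i =>
    (continuous_apply i).comp continuous_snd
  have hlam : ∀ i, recodeLaw (hc i).measurable lam = ν' := fun i => by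
    rw [recodeLaw_recodeLaw, ← hν' i]
  have hO2 : O ∩ ⋂ i, recodeLaw (hc i).measurable ⁻¹' O' ∈ 𝓝 lam :=
    inter_mem hO (iInter_mem.mpr fun i => exists_nhds_recode (hc i) lam (by rwa [hlam i]))
  obtain ⟨ψ, hψ, O₁, hO₁, hlift⟩ := exists_lift μ ν hν hφ' hO2
  refine (iInf₂_le O₁ hO₁).trans ?_
  rw [← EReal.limsup_const_mul_of_nonneg_of_ne_top hq0.le (EReal.natCast_ne_top q)]
  refine limsup_le_limsup (Eventually.of_forall fun n => ?_)
  change _ ≤ (q : EReal) * _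
  rw [← logRate_pow]
  have hgood : ∀ x ∈ goodModels O₁ (S.σ n),
      empirical (S.σ n) (fun v => (x v, ψ (x v))) ∈ O ∩ ⋂ i, recodeLaw (hc i).measurable ⁻¹' O' :=
    fun x hx => by
      rw [empirical_recode (S.σ n) (measurable_graph hψ) x]
      exact hlift _ hx
  refine logRate_mono (cov_le_cov_pow hq (fun x i v => ψ (x v) i) ?_ ?_)
  · intro x hx i
    have := Set.mem_iInter.mp (hgood x hx).2 i
    rw [Set.mem_preimage, ← empirical_recode] at this
    exact this
  · intro x hx x' hx' hd
    refine hsep (S.σ n) (fun v => (x v, ψ (x v))) (fun v => (x' v, ψ (x' v)))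
      (hgood x hx).1 (hgood x' hx').1 ?_
    refine (hammingAvg_pi_le _ _).trans_lt ?_
    have : Nonempty (Fin q) := ⟨⟨0, hq⟩⟩
    refine (Finset.sum_lt_sum_of_nonempty Finset.univ_nonempty fun i _ => hd i).trans_le ?_
    rw [Finset.sum_const, Finset.card_univ, Fintype.card_fin, nsmul_eq_mul]
    have : (0 : ℝ) < q := by exact_mod_cast hq
    apply le_of_eq
    field_simp

/-- A process that is isomorphic to another one by an invertible recoding has the same entropy. -/
theorem processEntropy_le_of_leftInverse (S : SoficApproximation.{u, w} G) (μ : Measure 𝒳)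
    [IsProbabilityMeasure μ] (ν : ProbabilityMeasure (G → 𝒳))
    (hν : ∀ g, (ν : Measure (G → 𝒳)).map (fun ω => ω g) = μ)
    {φ : 𝒳 → 𝒴} (hφ : Measurable φ) {χ : 𝒴 → 𝒳} (hχ : Measurable χ) (hχφ : ∀ x, χ (φ x) = x) :
    processEntropy S ν ≤ processEntropy S (recodeLaw hφ ν) := by
  have := processEntropy_le_mul S μ ν hν one_pos (φ := fun _ => φ) (fun _ => hφ)
    (χ := fun y => χ (y 0)) (hχ.comp (measurable_pi_apply 0)) hχφ _ (fun _ => rfl)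
  simpa using this

/-- Either some neighbourhood eventually has no models, which contributes `log 0`, or every
neighbourhood has models infinitely often, and then the covering numbers are at least `1`. The
Fekete argument relies on this dichotomy, since its rounding error has the right sign only for
nonnegative values. -/
theorem processEntropy_eq_bot_or_nonneg (S : SoficApproximation.{u, w} G)
    (ν : ProbabilityMeasure (G → 𝒳)) : processEntropy S ν = ⊥ ∨ 0 ≤ processEntropy S ν := by
  by_cases h : ∃ O ∈ 𝓝 ν, ∀ᶠ n in atTop, goodModels O (S.σ n) = ∅
  · left
    obtain ⟨O, hO, hempty⟩ := h
    refine eq_bot_iff.mpr (iSup₂_le fun δ _ => (iInf₂_le O hO).trans ?_)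
    refine limsup_le_of_le (h := ?_)
    filter_upwards [hempty] with n hn
    rw [hn, cov_eq_zero_iff.mpr rfl, logRate_zero]
  · right
    push Not at h
    refine le_iSup₂_of_le 1 one_pos (le_iInf₂ fun O hO => ?_)
    refine le_limsup_of_frequently_le ?_
    refine (h O hO).mono fun n hn => logRate_nonneg ?_
    rw [Ne, cov_eq_zero_iff]
    exact hn.ne_empty

end Comparison

/-! ### Powers of systems -/

section Powers

theorem pi_map_comp_injective {ι κ : Type*} [Fintype ι] [Fintype κ] {X : Type*}
    [MeasurableSpace X] (μ : Measure X) [IsProbabilityMeasure μ] {J : κ → ι}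
    (hJ : Function.Injective J) :
    (Measure.pi fun _ : ι => μ).map (fun x j => x (J j)) = Measure.pi fun _ : κ => μ := by
  classical
  refine (Measure.pi_eq fun s hs => ?_).symm
  rw [Measure.map_apply (measurable_pi_lambda _ fun j => measurable_pi_apply (J j))
    (MeasurableSet.univ_pi hs)]
  have h : (fun (x : ι → X) j => x (J j)) ⁻¹' (Set.univ.pi s)
      = Set.univ.pi (Function.extend J s fun _ => Set.univ) := by
    ext x
    simp only [Set.mem_preimage, Set.mem_univ_pi]
    refine ⟨fun hx i => ?_, fun hx j => ?_⟩
    · by_cases hi : ∃ j, J j = i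
      · obtain ⟨j, rfl⟩ := hi
        rw [hJ.extend_apply]
        exact hx j
      · rw [Function.extend_apply' _ _ _ hi]
        trivial
    · have := hx (J j)
      rwa [hJ.extend_apply] at this
  rw [h, Measure.pi_pi]
  refine (Fintype.prod_of_injective J hJ _ _ (fun i hi => ?_) fun j => ?_).symm
  · rw [Function.extend_apply' _ _ _ (by simpa using hi)]
    exact measure_univ
  · rw [hJ.extend_apply]

universe u w

variable {G : Type u} [Group G] [Countable G]

section Orbit

variable {Z Z' : Type*} [MeasurableSpace Z] [MeasurableSpace Z'] [MulAction G Z] [MulAction G Z']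
  [MeasurableConstSMul G Z] [MeasurableConstSMul G Z']

theorem toMeasure_orbitProcess (M : ProbabilityMeasure Z) :
    (orbitProcess G M : Measure (G → Z)) = (M : Measure Z).map (fun x h => h • x) := rfl

theorem measurable_orbit : Measurable fun (x : Z) (h : G) => h • x :=
  measurable_pi_lambda _ fun h => measurable_const_smul h

theorem orbitProcess_map_eval (M : ProbabilityMeasure Z)
    [SMulInvariantMeasure G Z (M : Measure Z)] (g : G) :
    (orbitProcess G M : Measure (G → Z)).map (fun ω => ω g) = (M : Measure Z) := by
  rw [toMeasure_orbitProcess, Measure.map_map (measurable_pi_apply g) measurable_orbit]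
  exact (measurePreserving_smul g (M : Measure Z)).map_eq

theorem recodeLaw_orbitProcess {φ : Z → Z'} (hφ : Measurable φ)
    (hG : ∀ (g : G) x, φ (g • x) = g • φ x) (M : ProbabilityMeasure Z) :
    recodeLaw hφ (orbitProcess G M) = orbitProcess G (M.map hφ.aemeasurable) := by
  apply Subtype.ext
  change ((M : Measure Z).map (fun x h => h • x)).map (recode φ)
    = ((M : Measure Z).map φ).map (fun x h => h • x)
  rw [Measure.map_map (measurable_recode hφ) measurable_orbit, Measure.map_map measurable_orbit hφ]
  congr 1
  funext x g
  exact hG g x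

/-- The sofic entropy of a system can be computed with any compact generating metric. -/
theorem soficEntropy_eq_processEntropy [StandardBorelSpace Z] [MetricSpace Z] [CompactSpace Z]
    [BorelSpace Z] (S : SoficApproximation.{u, w} G) (M : ProbabilityMeasure Z)
    [SMulInvariantMeasure G Z (M : Measure Z)] :
    soficEntropy S M = processEntropy S (orbitProcess G M) := by
  have h := orbitProcess_map_eval (G := G) M
  -- The identity between the two metrics is measurable but may be discontinuous, so both
  -- inequalities are cases of measurable recoding.
  have h1 := @processEntropy_le_of_leftInverse G _ _ Z Z (someMetric Z).metric
    (someMetric Z).compact _ (someMetric Z).borel ‹_› ‹_› _ ‹_› S M _ (orbitProcess G M) h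
    id measurable_id id measurable_id (fun _ => rfl)
  have h2 := @processEntropy_le_of_leftInverse G _ _ Z Z ‹_› ‹_› _ ‹_› (someMetric Z).metric
    (someMetric Z).compact _ (someMetric Z).borel S M _ (orbitProcess G M) h
    id measurable_id id measurable_id (fun _ => rfl)
  rw [recodeLaw_id] at h1 h2
  exact le_antisymm h1 h2

end Orbit

variable {X : Type*} [MeasurableSpace X] [MulAction G X] [MeasurableConstSMul G X]

instance smulInvariantMeasure_pi (μ : ProbabilityMeasure X)
    [SMulInvariantMeasure G X (μ : Measure X)] (ι : Type*) [Fintype ι] :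
    SMulInvariantMeasure G (ι → X) (ProbabilityMeasure.pi fun _ : ι => μ : Measure (ι → X)) := by
  refine ⟨fun g s hs => ?_⟩
  have h1 : (Measure.pi fun _ : ι => (μ : Measure X)).map (fun x => g • x)
      = Measure.pi fun _ : ι => (μ : Measure X) := by
    have h2 : (μ : Measure X).map (fun x => g • x) = (μ : Measure X) :=
      (measurePreserving_smul g (μ : Measure X)).map_eq
    have : ∀ _ : ι, SigmaFinite ((μ : Measure X).map (fun x => g • x)) := fun _ => by
      rw [h2]; infer_instance
    have h3 := Measure.pi_map_pi (μ := fun _ : ι => (μ : Measure X)) (f := fun _ x => g • x)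
      (fun _ => (measurable_const_smul g).aemeasurable)
    simp only [h2] at h3
    exact h3
  change (Measure.pi fun _ : ι => (μ : Measure X)) _ = (Measure.pi fun _ : ι => (μ : Measure X)) s
  rw [← Measure.map_apply (measurable_const_smul g) hs, h1]

theorem measurable_comp_index {ι κ : Type*} (J : κ → ι) :
    Measurable fun (x : ι → X) j => x (J j) :=
  measurable_pi_lambda _ fun j => measurable_pi_apply (J j)

theorem recodeLaw_orbitProcess_comp (μ : ProbabilityMeasure X) {ι κ : Type*} [Fintype ι]
    [Fintype κ] {J : κ → ι} (hJ : Function.Injective J) :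
    recodeLaw (measurable_comp_index J)
        (orbitProcess G (ProbabilityMeasure.pi fun _ : ι => μ))
      = orbitProcess G (ProbabilityMeasure.pi fun _ : κ => μ) := by
  rw [recodeLaw_orbitProcess (measurable_comp_index J) fun _ _ => rfl]
  congr 1
  apply Subtype.ext
  exact pi_map_comp_injective (μ : Measure X) hJ

variable [StandardBorelSpace X]

/-- Blocks of `k` coordinates jointly determine all `n`, and by independence each block has the law
of the `k`-th power. Overlaps are harmless, since `processEntropy_le_mul` asks only for joint
determination. -/
theorem soficEntropy_pi_le (S : SoficApproximation.{u, w} G) (μ : ProbabilityMeasure X)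
    [SMulInvariantMeasure G X (μ : Measure X)] {k n : ℕ} (hk : 0 < k) (hkn : k ≤ n) :
    soficEntropy S (ProbabilityMeasure.pi fun _ : Fin n => μ)
      ≤ (n / k + 1 : ℕ) * soficEntropy S (ProbabilityMeasure.pi fun _ : Fin k => μ) := by
  -- The minimum pushes the final block back so that it ends at `n`. Coordinate `t` lies in block `t
  -- / k`.
  let J : Fin (n / k + 1) → Fin k → Fin n := fun i s =>
    ⟨min (i * k) (n - k) + s, by have := s.2; omega⟩
  have hJ : ∀ i, Function.Injective (J i) := fun i s t h => by
    have := congrArg Fin.val h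
    simp only [J] at this
    exact Fin.ext (by omega)
  have hsurj : ∀ t : Fin n, ∃ (i : Fin (n / k + 1)) (s : Fin k), J i s = t := fun t => by
    have h1 : t.1 / k < n / k + 1 := Nat.lt_succ_of_le (Nat.div_le_div_right t.2.le)
    have h2 : t.1 / k * k ≤ t.1 := Nat.div_mul_le_self _ _
    have h3 : t.1 < t.1 / k * k + k := by
      have := Nat.lt_div_mul_add (a := t.1) hk
      exact this
    have h4 := t.2
    refine ⟨⟨t.1 / k, h1⟩, ⟨t.1 - min (t.1 / k * k) (n - k), by omega⟩, Fin.ext ?_⟩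
    simp only [J]
    omega
  choose a b hab using hsurj
  let := (someMetric (Fin n → X)).metric
  have := (someMetric (Fin n → X)).compact
  have := (someMetric (Fin n → X)).borel
  let := (someMetric (Fin k → X)).metric
  have := (someMetric (Fin k → X)).compact
  have := (someMetric (Fin k → X)).borel
  exact processEntropy_le_mul S
    (ProbabilityMeasure.pi fun _ : Fin n => μ : Measure (Fin n → X)) _
    (orbitProcess_map_eval _) (Nat.succ_pos _) (fun i => measurable_comp_index (J i))
    (χ := fun y t => y (a t) (b t))
    (measurable_pi_lambda _ fun t => (measurable_pi_apply (b t)).comp (measurable_pi_apply (a t)))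
    (fun x => funext fun t => congrArg x (hab t)) _ fun i => recodeLaw_orbitProcess_comp μ (hJ i)

/-- A version of Fekete's lemma with values in the extended reals. -/
theorem tendsto_div_of_subadditive {h : ℕ → EReal} (h0 : ∀ k, h k = ⊥ ∨ 0 ≤ h k)
    (hsub : ∀ k n, 0 < k → k ≤ n → h n ≤ (n / k + 1 : ℕ) * h k) :
    Tendsto (fun n : ℕ => h n / (n : EReal)) atTop
      (𝓝 (⨅ (k : ℕ) (_ : 0 < k), h k / (k : EReal))) := by
  -- The lower bound is immediate, as every term with `n > 0` is at least the infimum. Subadditivity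
  -- serves the upper bound, for each fixed `k`.
  refine tendsto_of_le_liminf_of_limsup_le (le_liminf_of_le (h := ?_)) (le_iInf₂ fun k hk => ?_)
  · filter_upwards [eventually_gt_atTop 0] with n hn
    exact iInf₂_le n hn
  have hk0 : (0 : EReal) < k := by exact_mod_cast hk
  rcases h0 k with hb | hnn
  · rw [hb]
    refine limsup_le_of_le (h := ?_)
    filter_upwards [eventually_ge_atTop k] with n hn
    have h1 := hsub k n hk hn
    have hn0 : (0 : EReal) < n := by exact_mod_cast hk.trans_le hn
    have hq : (0 : EReal) < (n / k + 1 : ℕ) := by exact_mod_cast Nat.succ_pos _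
    rw [hb, EReal.mul_bot_of_pos hq, le_bot_iff] at h1
    rw [h1, EReal.bot_div_of_pos_ne_top hn0 (EReal.natCast_ne_top _)]
    exact bot_le
  by_cases ht : h k = ⊤
  · rw [ht, EReal.top_div_of_pos_ne_top hk0 (EReal.natCast_ne_top _)]
    exact le_top
  obtain ⟨c, hc⟩ : ∃ c : ℝ, h k = c :=
    ⟨(h k).toReal, (EReal.coe_toReal ht (ne_bot_of_le_ne_bot EReal.zero_ne_bot hnn)).symm⟩
  rw [hc] at hnn ⊢
  have hc0 : 0 ≤ c := by exact_mod_cast hnn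
  have hlim : Tendsto (fun n : ℕ => c / k + c / n) atTop (𝓝 (c / k + 0)) :=
    tendsto_const_nhds.add (tendsto_const_div_atTop_nhds_zero_nat c)
  rw [add_zero] at hlim
  have hlim' : Tendsto (fun n : ℕ => ((c / k + c / n : ℝ) : EReal)) atTop
      (𝓝 ((c : EReal) / (k : EReal))) := by
    have : ((c : EReal) / (k : EReal)) = ((c / k : ℝ) : EReal) := by
      rw [EReal.coe_div]; rfl
    rw [this]
    exact (continuous_coe_real_ereal.tendsto _).comp hlim
  rw [← hlim'.limsup_eq]
  refine limsup_le_limsup ?_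
  filter_upwards [eventually_ge_atTop k] with n hn
  have hn0 : (0 : EReal) < n := by exact_mod_cast hk.trans_le hn
  have hnR : (0 : ℝ) < n := by exact_mod_cast hk.trans_le hn
  have hkR : (0 : ℝ) < k := by exact_mod_cast hk
  rw [EReal.div_le_iff_le_mul hn0 (EReal.natCast_ne_top _)]
  refine (hsub k n hk hn).trans ?_
  rw [hc]
  have h1 : ((n / k + 1 : ℕ) : ℝ) * c ≤ n * (c / k + c / n) := by
    have h2 : ((n / k : ℕ) : ℝ) ≤ n / k := Nat.cast_div_le
    have h3 : (n : ℝ) * (c / k + c / n) = (n / k + 1) * c := by field_simp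
    rw [h3]
    push_cast
    gcongr
  exact_mod_cast h1

theorem tendsto_soficEntropy_pi (S : SoficApproximation.{u, w} G) (μ : ProbabilityMeasure X)
    [SMulInvariantMeasure G X (μ : Measure X)] :
    Tendsto (fun k : ℕ => soficEntropy S (ProbabilityMeasure.pi fun _ : Fin k => μ) / (k : EReal))
      atTop (𝓝 (⨅ (k : ℕ) (_ : 0 < k),
        soficEntropy S (ProbabilityMeasure.pi fun _ : Fin k => μ) / (k : EReal))) :=
  tendsto_div_of_subadditive
    (fun k => @processEntropy_eq_bot_or_nonneg G _ _ (Fin k → X) (someMetric _).metric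
      (someMetric _).compact _ (someMetric _).borel S _)
    fun _ _ => soficEntropy_pi_le S μ

theorem psEntropy_eq_iInf (S : SoficApproximation.{u, w} G) (μ : ProbabilityMeasure X)
    [SMulInvariantMeasure G X (μ : Measure X)] :
    psEntropy S μ = ⨅ (k : ℕ) (_ : 0 < k),
      soficEntropy S (ProbabilityMeasure.pi fun _ : Fin k => μ) / (k : EReal) :=
  (tendsto_soficEntropy_pi S μ).limsup_eq

end Powers

/-! ### Means and proportions over finite sets -/

section Mean

variable {V : Type*} [Fintype V]

/-- The mean of a function on a finite set. -/
def mean (u : V → ℝ) : ℝ := (∑ v, u v) / Fintype.card V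

theorem mean_add (u u' : V → ℝ) : mean (fun v => u v + u' v) = mean u + mean u' := by
  simp [mean, Finset.sum_add_distrib, add_div]

theorem mean_const_mul (c : ℝ) (u : V → ℝ) : mean (fun v => c * u v) = c * mean u := by
  simp [mean, ← Finset.mul_sum, mul_div_assoc]

theorem mean_const [Nonempty V] (c : ℝ) : mean (fun _ : V => c) = c := by
  simp [mean]

theorem mean_mono {u u' : V → ℝ} (h : ∀ v, u v ≤ u' v) : mean u ≤ mean u' := by
  unfold mean
  gcongr with v _
  exact h v

theorem abs_mean_le [Nonempty V] {u : V → ℝ} {C : ℝ} (h : ∀ v, |u v| ≤ C) : |mean u| ≤ C := by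
  rw [mean, abs_div, Nat.abs_cast, div_le_iff₀ (by exact_mod_cast Fintype.card_pos)]
  calc |∑ v, u v| ≤ ∑ v, |u v| := Finset.abs_sum_le_sum_abs _ _
    _ ≤ ∑ _v : V, C := Finset.sum_le_sum fun v _ => h v
    _ = C * Fintype.card V := by simp [mul_comm]

theorem measurable_mean {Ω : Type*} [MeasurableSpace Ω] {u : V → Ω → ℝ}
    (hu : ∀ v, Measurable (u v)) : Measurable fun x => mean fun v => u v x :=
  (Finset.measurable_sum _ fun v _ => hu v).div_const _

theorem integral_mean {Ω : Type*} [MeasurableSpace Ω] {μ : Measure Ω} {u : V → Ω → ℝ}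
    (hu : ∀ v, Integrable (u v) μ) :
    ∫ x, mean (fun v => u v x) ∂μ = mean fun v => ∫ x, u v x ∂μ := by
  simp only [mean]
  rw [integral_div, integral_finsetSum _ fun v _ => hu v]

theorem proportion_eq_mean (P : V → Prop) [DecidablePred P] :
    proportion P = mean fun v => if P v then 1 else 0 := by
  classical
  rw [proportion, mean, Finset.sum_boole, Nat.card_eq_fintype_card, Fintype.card_subtype]

theorem proportion_not [Nonempty V] (P : V → Prop) :
    proportion (fun v => ¬ P v) = 1 - proportion P := by
  classical
  rw [proportion_eq_mean, proportion_eq_mean, eq_sub_iff_add_eq, ← mean_add]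
  refine Eq.trans (congrArg mean (funext fun v => ?_)) (mean_const (V := V) 1)
  by_cases h : P v <;> simp [h]

theorem proportion_le_mean {P : V → Prop} {u : V → ℝ} (h0 : ∀ v, 0 ≤ u v)
    (h : ∀ v, P v → 1 ≤ u v) : proportion P ≤ mean u := by
  classical
  rw [proportion_eq_mean]
  refine mean_mono fun v => ?_
  split_ifs with hv
  · exact h v hv
  · exact h0 v

theorem proportion_exists_le {ι : Type*} (T : Finset ι) (Q : ι → V → Prop) :
    proportion (fun v => ∃ i ∈ T, Q i v) ≤ ∑ i ∈ T, proportion (Q i) := by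
  classical
  have h : ∑ i ∈ T, proportion (Q i) = mean fun v => ∑ i ∈ T, if Q i v then (1 : ℝ) else 0 := by
    simp only [proportion_eq_mean, mean]
    rw [← Finset.sum_div, Finset.sum_comm]
  rw [h]
  refine proportion_le_mean (fun v => Finset.sum_nonneg fun i _ => by positivity) ?_
  rintro v ⟨i, hi, hQ⟩
  calc (1 : ℝ) = if Q i v then 1 else 0 := by simp [hQ]
    _ ≤ _ := Finset.single_le_sum (f := fun i => if Q i v then (1 : ℝ) else 0)
      (fun i _ => by positivity) hi

theorem proportion_mono {P Q : V → Prop} (h : ∀ v, P v → Q v) : proportion P ≤ proportion Q := by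
  classical
  rw [proportion_eq_mean Q]
  refine proportion_le_mean (fun v => by positivity) fun v hv => by simp [h v hv]

theorem whp_of_forall_proportion_not_le {V : ℕ → Type*} [∀ n, Fintype (V n)] [∀ n, Nonempty (V n)]
    {P : ∀ n, V n → Prop}
    (h : ∀ η > 0, ∀ᶠ n in atTop, proportion (fun v => ¬ P n v) ≤ η) : WHP P := by
  rw [WHP, Metric.tendsto_nhds]
  intro ε hε
  filter_upwards [h (ε / 2) (by positivity)] with n hn
  have h0 : 0 ≤ proportion (fun v => ¬ P n v) := by
    rw [proportion]; positivity
  rw [proportion_not] at hn h0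
  rw [Real.dist_eq, abs_lt]
  constructor <;> linarith

end Mean

/-! ### Second moments -/

section SecondMoment

variable {V : Type*} [Fintype V] {Ω Ω' : Type*} [MeasurableSpace Ω] [MeasurableSpace Ω']

theorem integrable_of_abs_le {μ : Measure Ω} [IsFiniteMeasure μ] {f : Ω → ℝ} (hf : Measurable f)
    {C : ℝ} (h : ∀ x, |f x| ≤ C) : Integrable f μ :=
  Integrable.of_bound hf.aestronglyMeasurable C (Eventually.of_forall h)

theorem integrable_sq_of_abs_le {μ : Measure Ω} [IsFiniteMeasure μ] {f : Ω → ℝ}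
    (hf : Measurable f) {C : ℝ} (h : ∀ x, |f x| ≤ C) : Integrable (fun x => f x ^ 2) μ :=
  integrable_of_abs_le (hf.pow_const 2) (C := C ^ 2) fun x => by
    rw [abs_pow]
    exact pow_le_pow_left₀ (abs_nonneg _) (h x) 2

/-- The mass of weighted sums of a family is controlled by the correlations of two independent
copies of the family. -/
theorem sq_integral_sq_mean_le (m : Measure Ω) [IsProbabilityMeasure m] {u : V → Ω → ℝ} {C : ℝ}
    (hu : ∀ v, Measurable (u v)) (hC : ∀ v x, |u v x| ≤ C) {w : V → ℝ} (hw : ∀ v, |w v| ≤ 1) :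
    (∫ x, mean (fun v => w v * u v x) ^ 2 ∂m) ^ 2
      ≤ ∫ p, mean (fun v => u v p.1 * u v p.2) ^ 2 ∂(m.prod m) := by
  rcases isEmpty_or_nonempty V with hV | hV
  · simp [mean]
  have hn : (0 : ℝ) < Fintype.card V := by exact_mod_cast Fintype.card_pos
  -- With this correlation matrix the left side is the square of the average of `w v * w v' * c v
  -- v'`, while independence of the two copies turns the right side into the average of `c v v' ^
  -- 2`. Cauchy–Schwarz compares them.
  set c : V → V → ℝ := fun v v' => ∫ x, u v x * u v' x ∂m with hc
  have hint : ∀ v v', Integrable (fun x => u v x * u v' x) m := fun v v' =>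
    integrable_of_abs_le ((hu v).mul (hu v')) (C := C * C) fun x => by
      rw [abs_mul]
      exact mul_le_mul (hC v x) (hC v' x) (abs_nonneg _) ((abs_nonneg _).trans (hC v x))
  have h1 : ∫ x, mean (fun v => w v * u v x) ^ 2 ∂m
      = (∑ p : V × V, w p.1 * w p.2 * c p.1 p.2) / (Fintype.card V : ℝ) ^ 2 := by
    have : ∀ x, mean (fun v => w v * u v x) ^ 2
        = (∑ p : V × V, w p.1 * w p.2 * (u p.1 x * u p.2 x)) / (Fintype.card V : ℝ) ^ 2 := by
      intro x
      rw [mean, div_pow, sq, Finset.sum_mul_sum, ← Finset.univ_product_univ,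
        Finset.sum_product]
      congr 1
      exact Finset.sum_congr rfl fun v _ => Finset.sum_congr rfl fun v' _ => by ring
    simp only [this]
    rw [integral_div, integral_finsetSum _ fun p _ => (hint p.1 p.2).const_mul _]
    congr 1
    exact Finset.sum_congr rfl fun p _ => integral_const_mul _ _
  have h2 : ∫ p, mean (fun v => u v p.1 * u v p.2) ^ 2 ∂(m.prod m)
      = (∑ p : V × V, c p.1 p.2 ^ 2) / (Fintype.card V : ℝ) ^ 2 := by
    have : ∀ q : Ω × Ω, mean (fun v => u v q.1 * u v q.2) ^ 2
        = (∑ p : V × V, (u p.1 q.1 * u p.2 q.1) * (u p.1 q.2 * u p.2 q.2))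
          / (Fintype.card V : ℝ) ^ 2 := by
      intro q
      rw [mean, div_pow, sq, Finset.sum_mul_sum, ← Finset.univ_product_univ,
        Finset.sum_product]
      congr 1
      exact Finset.sum_congr rfl fun v _ => Finset.sum_congr rfl fun v' _ => by ring
    simp only [this]
    rw [integral_div, integral_finsetSum _ fun p _ => (hint p.1 p.2).mul_prod (hint p.1 p.2)]
    congr 1
    exact Finset.sum_congr rfl fun p _ =>
      (integral_prod_mul (fun x => u p.1 x * u p.2 x) (fun x => u p.1 x * u p.2 x)).trans
        (sq _).symm
  rw [h1, h2, div_pow, div_le_div_iff₀ (by positivity) (by positivity)]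
  have hcs := Finset.sum_mul_sq_le_sq_mul_sq Finset.univ (fun p : V × V => w p.1 * w p.2)
    (fun p => c p.1 p.2)
  have hw2 : ∑ p : V × V, (w p.1 * w p.2) ^ 2 ≤ (Fintype.card V : ℝ) ^ 2 := by
    calc ∑ p : V × V, (w p.1 * w p.2) ^ 2 ≤ ∑ _p : V × V, (1 : ℝ) := by
          refine Finset.sum_le_sum fun p _ => ?_
          rw [← sq_abs, abs_mul]
          exact pow_le_one₀ (by positivity) (mul_le_one₀ (hw _) (abs_nonneg _) (hw _))
      _ = (Fintype.card V : ℝ) ^ 2 := by simp [sq]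
  have h0 : 0 ≤ ∑ p : V × V, c p.1 p.2 ^ 2 := by positivity
  calc _ ≤ (Fintype.card V : ℝ) ^ 2 * (∑ p : V × V, c p.1 p.2 ^ 2) * (Fintype.card V : ℝ) ^ 2 := by
        gcongr
        exact hcs.trans (by gcongr)
    _ = _ := by ring

theorem integral_sq_le_add_measureReal {m : Measure Ω} [IsProbabilityMeasure m] {B : Ω → ℝ}
    (hB : Measurable B) {C a : ℝ} (hC : ∀ x, |B x| ≤ C) :
    ∫ x, B x ^ 2 ∂m ≤ a ^ 2 + C ^ 2 * (1 - m.real {x | |B x| < a}) := by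
  have hs : MeasurableSet {x | |B x| < a} := measurableSet_lt hB.abs measurable_const
  have hpt : ∀ x, B x ^ 2 ≤ a ^ 2 + C ^ 2 * {x | |B x| < a}ᶜ.indicator (fun _ => (1 : ℝ)) x := by
    intro x
    by_cases hx : |B x| < a
    · have : x ∉ {x | |B x| < a}ᶜ := fun h => h hx
      rw [Set.indicator_of_notMem this, mul_zero, add_zero, ← sq_abs]
      exact pow_le_pow_left₀ (abs_nonneg _) hx.le 2
    · have : x ∈ {x | |B x| < a}ᶜ := hx
      rw [Set.indicator_of_mem this, mul_one, ← sq_abs]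
      have := pow_le_pow_left₀ (abs_nonneg _) (hC x) 2
      nlinarith [sq_nonneg a]
  have hi : Integrable (fun x => {x | |B x| < a}ᶜ.indicator (fun _ => (1 : ℝ)) x) m :=
    (integrable_const 1).indicator hs.compl
  calc ∫ x, B x ^ 2 ∂m
      ≤ ∫ x, (a ^ 2 + C ^ 2 * {x | |B x| < a}ᶜ.indicator (fun _ => (1 : ℝ)) x) ∂m :=
        integral_mono (integrable_sq_of_abs_le hB hC) ((integrable_const _).add (hi.const_mul _))
          hpt
    _ = _ := by
        rw [integral_add (integrable_const _) (hi.const_mul _), integral_const_mul,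
          integral_indicator_const _ hs.compl, probReal_compl_eq_one_sub hs]
        simp

/-- Markov's inequality for the square. -/
theorem measureReal_le_integral_sq {m : Measure Ω} [IsProbabilityMeasure m] {B : Ω → ℝ}
    (hi : Integrable (fun x => B x ^ 2) m) {a : ℝ} (ha : 0 < a) :
    m.real {x | a ≤ |B x|} ≤ (∫ x, B x ^ 2 ∂m) / a ^ 2 := by
  rw [le_div_iff₀ (by positivity), mul_comm]
  have h := mul_meas_ge_le_integral_of_nonneg (μ := m)
    (Eventually.of_forall fun x => sq_nonneg (B x)) hi (a ^ 2)
  refine le_trans (mul_le_mul_of_nonneg_left (measureReal_mono fun x hx => ?_) (by positivity)) h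
  have : a ^ 2 ≤ |B x| ^ 2 := pow_le_pow_left₀ ha.le hx 2
  simpa using this

/-- The correlation of a decorrelated family with an independent family is close to the product of
their means. -/
theorem integral_sq_mean_mul_sub_le (m : Measure Ω) [IsProbabilityMeasure m] (P : Measure Ω')
    [IsProbabilityMeasure P] [Nonempty V] {u : V → Ω → ℝ} {g : V → Ω' → ℝ} {C D : ℝ}
    (hu : ∀ v, Measurable (u v)) (hg : ∀ v, Measurable (g v)) (hC : ∀ v x, |u v x| ≤ C)
    (hD : ∀ v y, |g v y| ≤ D) {c c' η η' : ℝ}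
    (hη : ∀ w : V → ℝ, (∀ v, |w v| ≤ D) → ∫ x, mean (fun v => w v * (u v x - c)) ^ 2 ∂m ≤ η)
    (hη' : ∫ y, (mean (fun v => g v y) - c') ^ 2 ∂P ≤ η') :
    ∫ p, (mean (fun v => u v p.1 * g v p.2) - c * c') ^ 2 ∂(m.prod P)
      ≤ 2 * η + 2 * c ^ 2 * η' := by
  have hC0 : 0 ≤ C := by
    have : Nonempty Ω := by
      by_contra h
      rw [not_nonempty_iff] at h
      exact IsProbabilityMeasure.ne_zero m (Measure.eq_zero_of_isEmpty m)
    exact (abs_nonneg _).trans (hC (Classical.arbitrary V) (Classical.arbitrary Ω))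
  have hm1 : Measurable fun p : Ω × Ω' => mean fun v => g v p.2 * (u v p.1 - c) :=
    measurable_mean fun v => ((hg v).comp measurable_snd).mul
      (((hu v).comp measurable_fst).sub_const _)
  have hb1 : ∀ p : Ω × Ω', |mean fun v => g v p.2 * (u v p.1 - c)| ≤ D * (C + |c|) := fun p =>
    abs_mean_le fun v => by
      rw [abs_mul]
      exact mul_le_mul (hD _ _) ((abs_sub _ _).trans (add_le_add (hC _ _) le_rfl)) (abs_nonneg _)
        ((abs_nonneg _).trans (hD v p.2))
  have hi1 := integrable_sq_of_abs_le (μ := m.prod P) hm1 hb1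
  have hm2 : Measurable fun y => mean (fun v => g v y) - c' := (measurable_mean hg).sub_const _
  have hb2 : ∀ y, |mean (fun v => g v y) - c'| ≤ D + |c'| := fun y =>
    (abs_sub _ _).trans (add_le_add (abs_mean_le fun v => hD v y) le_rfl)
  have hi2 : Integrable (fun p : Ω × Ω' => (mean (fun v => g v p.2) - c') ^ 2) (m.prod P) :=
    (integrable_sq_of_abs_le (μ := P) hm2 hb2).comp_snd m
  -- Write `u g - c c' = g (u - c) + c (g - c')` and use `(a + b)² ≤ 2a² + 2b²`.
  have hsplit : ∀ p : Ω × Ω', (mean (fun v => u v p.1 * g v p.2) - c * c') ^ 2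
      ≤ 2 * mean (fun v => g v p.2 * (u v p.1 - c)) ^ 2
        + 2 * c ^ 2 * (mean (fun v => g v p.2) - c') ^ 2 := by
    intro p
    have : mean (fun v => u v p.1 * g v p.2)
        = mean (fun v => g v p.2 * (u v p.1 - c)) + c * mean (fun v => g v p.2) := by
      rw [← mean_const_mul, ← mean_add]
      congr 1
      funext v
      ring
    rw [this]
    nlinarith [sq_nonneg (mean (fun v => g v p.2 * (u v p.1 - c))
      - c * (mean (fun v => g v p.2) - c'))]
  have hm0 : Measurable fun p : Ω × Ω' => mean (fun v => u v p.1 * g v p.2) - c * c' :=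
    (measurable_mean fun v => ((hu v).comp measurable_fst).mul
      ((hg v).comp measurable_snd)).sub_const _
  calc ∫ p, (mean (fun v => u v p.1 * g v p.2) - c * c') ^ 2 ∂(m.prod P)
      ≤ ∫ p, (2 * mean (fun v => g v p.2 * (u v p.1 - c)) ^ 2
        + 2 * c ^ 2 * (mean (fun v => g v p.2) - c') ^ 2) ∂(m.prod P) :=
        integral_mono_of_nonneg (Eventually.of_forall fun _ => sq_nonneg _)
          ((hi1.const_mul 2).add (hi2.const_mul _)) (Eventually.of_forall hsplit)
    _ = 2 * ∫ p, mean (fun v => g v p.2 * (u v p.1 - c)) ^ 2 ∂(m.prod P)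
        + 2 * c ^ 2 * ∫ y, (mean (fun v => g v y) - c') ^ 2 ∂P := by
        rw [integral_add (hi1.const_mul 2) (hi2.const_mul _), integral_const_mul,
          integral_const_mul]
        congr 2
        rw [integral_fun_snd (fun y => (mean (fun v => g v y) - c') ^ 2)]
        simp
    _ ≤ 2 * η + 2 * c ^ 2 * η' := by
        have h1 : ∫ p, mean (fun v => g v p.2 * (u v p.1 - c)) ^ 2 ∂(m.prod P) ≤ η := by
          -- For fixed `y` the numbers `g v y` are just bounded weights; uniformity over weights is
          -- what makes Fubini conclusive.
          rw [integral_prod_symm _ hi1]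
          calc ∫ y, ∫ x, mean (fun v => g v y * (u v x - c)) ^ 2 ∂m ∂P ≤ ∫ _y, η ∂P :=
                integral_mono_of_nonneg
                  (Eventually.of_forall fun y => integral_nonneg fun x => sq_nonneg _)
                  (integrable_const _) (Eventually.of_forall fun y => hη _ fun v => hD v y)
            _ = η := by simp
        gcongr

end SecondMoment

/-! ### Doubly-quenched convergence as decorrelation -/

section Decorrelation

variable {G : Type*} [Countable G] {V : ℕ → Type*} [∀ n, Fintype (V n)] [∀ n, Nonempty (V n)]
  {𝒳 : Type*} [MetricSpace 𝒳] [CompactSpace 𝒳] [MeasurableSpace 𝒳] [BorelSpace 𝒳]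

/-- The values of a continuous function along the pullback names are asymptotically uncorrelated
with every bounded weight. -/
def UniformlyDecorrelated (σ : ∀ n, G → Equiv.Perm (V n))
    (m : ∀ n, ProbabilityMeasure (V n → 𝒳)) (ν : ProbabilityMeasure (G → 𝒳)) : Prop :=
  ∀ f : C(G → 𝒳, ℝ), ∀ η > 0, ∀ᶠ n in atTop, ∀ w : V n → ℝ, (∀ v, |w v| ≤ 1) →
    ∫ x, mean (fun v => w v * (f (pullbackName (σ n) v x) - ∫ ω, f ω ∂(ν : Measure (G → 𝒳)))) ^ 2
      ∂(m n : Measure (V n → 𝒳)) ≤ η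

theorem exists_abs_le {K : Type*} [TopologicalSpace K] [CompactSpace K] (f : C(K, ℝ)) :
    ∃ C > 0, ∀ x, |f x| ≤ C :=
  ⟨‖f‖ + 1, by positivity, fun x => (f.norm_coe_le_norm x).trans (by linarith)⟩

theorem abs_integral_le_of_abs_le {Ω : Type*} [MeasurableSpace Ω] {μ : Measure Ω}
    [IsProbabilityMeasure μ] {f : Ω → ℝ} {C : ℝ} (h : ∀ x, |f x| ≤ C) : |∫ x, f x ∂μ| ≤ C := by
  have := norm_integral_le_of_norm_le_const (μ := μ) (f := f) (Eventually.of_forall h)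
  simpa using this

theorem measurable_comp_pullbackName {W : Type*} (σ : G → Equiv.Perm W) (f : C(G → 𝒳, ℝ)) (v : W) :
    Measurable fun x : W → 𝒳 => f (pullbackName σ v x) :=
  f.continuous.measurable.comp (measurable_pullbackName σ v)

theorem UniformlyDecorrelated.eventually_of_abs_le {σ : ∀ n, G → Equiv.Perm (V n)}
    {m : ∀ n, ProbabilityMeasure (V n → 𝒳)} {ν : ProbabilityMeasure (G → 𝒳)}
    (h : UniformlyDecorrelated σ m ν) (f : C(G → 𝒳, ℝ)) {η : ℝ} (hη : 0 < η) {D : ℝ} (hD : 0 < D) :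
    ∀ᶠ n in atTop, ∀ w : V n → ℝ, (∀ v, |w v| ≤ D) →
    ∫ x, mean (fun v => w v * (f (pullbackName (σ n) v x) - ∫ ω, f ω ∂(ν : Measure (G → 𝒳)))) ^ 2
      ∂(m n : Measure (V n → 𝒳)) ≤ η := by
  filter_upwards [h f (η / D ^ 2) (by positivity)] with n hn w hw
  have h1 := hn (fun v => w v / D) fun v => by
    rw [abs_div, abs_of_pos hD]
    exact (div_le_one hD).mpr (hw v)
  have h2 : ∀ x, mean (fun v => w v / D *
      (f (pullbackName (σ n) v x) - ∫ ω, f ω ∂(ν : Measure (G → 𝒳)))) ^ 2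
      = mean (fun v => w v *
      (f (pullbackName (σ n) v x) - ∫ ω, f ω ∂(ν : Measure (G → 𝒳)))) ^ 2 / D ^ 2 := fun x => by
    rw [← div_pow]
    congr 1
    rw [div_eq_inv_mul, ← mean_const_mul]
    congr 1
    funext v
    ring
  simp only [h2] at h1
  rw [integral_div] at h1
  exact (div_le_div_iff_of_pos_right (by positivity)).mp h1

section Square

variable {I : Type*}

theorem toMeasure_square (μ : ProbabilityMeasure (I → 𝒳)) :
    (square μ : Measure (I → 𝒳 × 𝒳)) = ((μ : Measure (I → 𝒳)).prod μ).map zip := rfl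

theorem integral_square [Countable I] (μ : ProbabilityMeasure (I → 𝒳)) {f : (I → 𝒳 × 𝒳) → ℝ}
    (hf : Measurable f) :
    ∫ ω, f ω ∂(square μ : Measure (I → 𝒳 × 𝒳))
      = ∫ p, f (zip p) ∂((μ : Measure (I → 𝒳)).prod μ) := by
  rw [toMeasure_square, integral_map measurable_zip.aemeasurable hf.aestronglyMeasurable]

/-- The product of two continuous functions of the marginal processes. -/
def tensor (f f' : C(I → 𝒳, ℝ)) : C(I → 𝒳 × 𝒳, ℝ) :=
  ⟨fun ω => f (recode Prod.fst ω) * f' (recode Prod.snd ω),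
    (f.continuous.comp (continuous_recode continuous_fst)).mul
      (f'.continuous.comp (continuous_recode continuous_snd))⟩

theorem integral_tensor_square [Countable I] (μ : ProbabilityMeasure (I → 𝒳))
    (f f' : C(I → 𝒳, ℝ)) :
    ∫ ω, tensor f f' ω ∂(square μ : Measure (I → 𝒳 × 𝒳))
      = (∫ ω, f ω ∂(μ : Measure (I → 𝒳))) * ∫ ω, f' ω ∂(μ : Measure (I → 𝒳)) := by
  rw [integral_square μ (tensor f f').continuous.measurable]
  exact integral_prod_mul _ _

theorem toMeasure_square_map_pullbackName {W : Type*} (σ : G → Equiv.Perm W) (v : W)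
    (μ : ProbabilityMeasure (W → 𝒳)) :
    (square μ).map (measurable_pullbackName σ v).aemeasurable
      = square (μ.map (measurable_pullbackName σ v).aemeasurable) := by
  apply Subtype.ext
  change (((μ : Measure (W → 𝒳)).prod μ).map zip).map (pullbackName σ v)
    = (((μ : Measure (W → 𝒳)).map (pullbackName σ v)).prod
      ((μ : Measure (W → 𝒳)).map (pullbackName σ v))).map zip
  rw [Measure.map_map (measurable_pullbackName σ v) measurable_zip,
    Measure.map_prod_map _ _ (measurable_pullbackName σ v) (measurable_pullbackName σ v),
    Measure.map_map measurable_zip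
      ((measurable_pullbackName σ v).prodMap (measurable_pullbackName σ v))]
  rfl

/-- The functions of product form on the square of a process. -/
def tensorSubmonoid (I 𝒳 : Type*) [MetricSpace 𝒳] [CompactSpace 𝒳] :
    Submonoid C(I → 𝒳 × 𝒳, ℝ) where
  carrier := Set.range fun p : C(I → 𝒳, ℝ) × C(I → 𝒳, ℝ) => tensor p.1 p.2
  one_mem' := ⟨(1, 1), by ext; simp [tensor]⟩
  mul_mem' := by
    rintro _ _ ⟨p, rfl⟩ ⟨q, rfl⟩
    exact ⟨(p.1 * q.1, p.2 * q.2), by ext; simp [tensor]; ring⟩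

theorem tensorSubmonoid_separates (x y : I → 𝒳 × 𝒳) (h : x ≠ y) :
    ∃ f ∈ tensorSubmonoid I 𝒳, f x ≠ f y := by
  obtain ⟨i, hi⟩ := Function.ne_iff.mp h
  rcases not_and_or.mp (fun h' => hi (Prod.ext_iff.mpr h')) with h1 | h1
  · refine ⟨_, ⟨(⟨fun ω => dist (ω i) (x i).1, by fun_prop⟩, 1), rfl⟩, ?_⟩
    simpa [tensor, recode] using (dist_pos.mpr (Ne.symm h1)).ne
  · refine ⟨_, ⟨(1, ⟨fun ω => dist (ω i) (x i).2, by fun_prop⟩), rfl⟩, ?_⟩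
    simpa [tensor, recode] using (dist_pos.mpr (Ne.symm h1)).ne

end Square

/-- For the centred function `fc`, the integral of `fc ⊗ fc` against `ν × ν` vanishes, so `fc` has
small correlation along most pairs of models drawn from `m × m`. By `sq_integral_sq_mean_le` this
controls every bounded weight. Only the empirical half of quenched convergence enters. -/
theorem DoublyQuenchedConverges.uniformlyDecorrelated {σ : ∀ n, G → Equiv.Perm (V n)}
    {m : ∀ n, ProbabilityMeasure (V n → 𝒳)} {ν : ProbabilityMeasure (G → 𝒳)}
    (h : DoublyQuenchedConverges σ m ν) : UniformlyDecorrelated σ m ν := by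
  intro f η hη
  set c := ∫ ω, f ω ∂(ν : Measure (G → 𝒳)) with hc
  let fc : C(G → 𝒳, ℝ) := f - ContinuousMap.const _ c
  have hfc : ∫ ω, fc ω ∂(ν : Measure (G → 𝒳)) = 0 := by
    change ∫ ω, (f ω - c) ∂(ν : Measure (G → 𝒳)) = 0
    rw [integral_sub (integrable_continuousMap f _) (integrable_const _)]
    simp [hc]
  obtain ⟨C, hC, hfC⟩ := exists_abs_le fc
  have hH : ∫ ω, tensor fc fc ω ∂(square ν : Measure (G → 𝒳 × 𝒳)) = 0 := by
    rw [integral_tensor_square, hfc, mul_zero]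
  have hO : {P : ProbabilityMeasure (G → 𝒳 × 𝒳) |
      |∫ ω, tensor fc fc ω ∂(P : Measure (G → 𝒳 × 𝒳))| < η / 2} ∈ 𝓝 (square ν) :=
    (ProbabilityMeasure.continuous_integral_continuousMap
      (tensor fc fc)).abs.continuousAt.eventually_lt continuousAt_const (by simpa [hH] using hη)
  have hlim := h.2 _ hO
  -- The bad pairs then contribute at most `η²/2` to the second moment and the good pairs at most
  -- `η²/4`, below the required `η²`.
  have hev := hlim.eventually (lt_mem_nhds (show 1 - η ^ 2 / (2 * (C * C) ^ 2) < (1 : ℝ) from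
    sub_lt_self _ (by positivity)))
  filter_upwards [hev] with n hn w hw
  let B : (V n → 𝒳 × 𝒳) → ℝ := fun z => mean fun v => tensor fc fc (pullbackName (σ n) v z)
  have hBm : Measurable B := measurable_mean fun v =>
    (tensor fc fc).continuous.measurable.comp (measurable_pullbackName (σ n) v)
  have hBC : ∀ z, |B z| ≤ C * C := fun z => abs_mean_le fun v => by
    change |fc _ * fc _| ≤ _
    rw [abs_mul]
    exact mul_le_mul (hfC _) (hfC _) (abs_nonneg _) hC.le
  have hgood : goodModels {P : ProbabilityMeasure (G → 𝒳 × 𝒳) |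
      |∫ ω, tensor fc fc ω ∂(P : Measure (G → 𝒳 × 𝒳))| < η / 2} (σ n) = {z | |B z| < η / 2} := by
    ext z
    change |∫ ω, tensor fc fc ω ∂(empirical (σ n) z : Measure (G → 𝒳 × 𝒳))| < η / 2 ↔ _
    rw [integral_empirical]
    rfl
  rw [hgood] at hn
  have h1 := integral_sq_le_add_measureReal (m := (square (m n) : Measure (V n → 𝒳 × 𝒳)))
    hBm (a := η / 2) hBC
  have h2 : (C * C) ^ 2 * (1 - (square (m n) : Measure (V n → 𝒳 × 𝒳)).real {z | |B z| < η / 2})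
      ≤ η ^ 2 / 2 := by
    calc _ ≤ (C * C) ^ 2 * (η ^ 2 / (2 * (C * C) ^ 2)) := by gcongr; linarith
      _ = η ^ 2 / 2 := by field_simp
  rw [integral_square (m n) (hBm.pow_const 2)] at h1
  have h3 := sq_integral_sq_mean_le (m n : Measure (V n → 𝒳))
    (u := fun v x => fc (pullbackName (σ n) v x))
    (fun v => measurable_comp_pullbackName (σ n) fc v) (fun v x => hfC _) hw
  have h4 : (∫ x, mean (fun v => w v * fc (pullbackName (σ n) v x)) ^ 2
      ∂(m n : Measure (V n → 𝒳))) ^ 2 ≤ η ^ 2 := by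
    refine (h3.trans h1).trans ?_
    nlinarith
  exact abs_le_of_sq_le_sq' h4 hη.le |>.2

theorem UniformlyDecorrelated.eventually_integral_sq_mean_sub_le {σ : ∀ n, G → Equiv.Perm (V n)}
    {m : ∀ n, ProbabilityMeasure (V n → 𝒳)} {ν : ProbabilityMeasure (G → 𝒳)}
    (h : UniformlyDecorrelated σ m ν) (f : C(G → 𝒳, ℝ)) {η : ℝ} (hη : 0 < η) :
    ∀ᶠ n in atTop, ∫ x, (mean (fun v => f (pullbackName (σ n) v x))
      - ∫ ω, f ω ∂(ν : Measure (G → 𝒳))) ^ 2 ∂(m n : Measure (V n → 𝒳)) ≤ η := by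
  filter_upwards [h f η hη] with n hn
  refine le_of_eq_of_le (integral_congr_ae (Eventually.of_forall fun x => ?_))
    (hn (fun _ => 1) fun _ => by simp)
  simp only [one_mul, sub_eq_add_neg, mean_add, mean_const]

/-- The second factor is arbitrary so that it can be another copy of `m`, for doubly-quenched
convergence, or a power of `m`, for the induction on `k`. -/
theorem UniformlyDecorrelated.eventually_integral_sq_mean_mul_sub_le
    {σ : ∀ n, G → Equiv.Perm (V n)}
    {m : ∀ n, ProbabilityMeasure (V n → 𝒳)} {ν : ProbabilityMeasure (G → 𝒳)}
    (h : UniformlyDecorrelated σ m ν) {Ω : ℕ → Type*} [∀ n, MeasurableSpace (Ω n)]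
    (P : ∀ n, Measure (Ω n)) [∀ n, IsProbabilityMeasure (P n)] (f : C(G → 𝒳, ℝ))
    (g : ∀ n, V n → Ω n → ℝ) (hg : ∀ n v, Measurable (g n v)) {D : ℝ} (hD : 0 < D)
    (hgD : ∀ n v y, |g n v y| ≤ D) {c' : ℝ}
    (hgc : ∀ η > 0, ∀ᶠ n in atTop, ∫ y, (mean (fun v => g n v y) - c') ^ 2 ∂(P n) ≤ η)
    {η : ℝ} (hη : 0 < η) :
    ∀ᶠ n in atTop, ∫ p, (mean (fun v => f (pullbackName (σ n) v p.1) * g n v p.2)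
      - (∫ ω, f ω ∂(ν : Measure (G → 𝒳))) * c') ^ 2
        ∂((m n : Measure (V n → 𝒳)).prod (P n)) ≤ η := by
  set c := ∫ ω, f ω ∂(ν : Measure (G → 𝒳))
  obtain ⟨C, hC, hfC⟩ := exists_abs_le f
  filter_upwards [h.eventually_of_abs_le f (η := η / 4) (by positivity) hD,
    hgc (η / (4 * (c ^ 2 + 1))) (by positivity)] with n h1 h2
  refine (integral_sq_mean_mul_sub_le (m n : Measure (V n → 𝒳)) (P n)
    (fun v => measurable_comp_pullbackName (σ n) f v) (hg n) (fun v x => hfC _) (hgD n)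
    h1 h2).trans ?_
  have h3 : 2 * c ^ 2 * (η / (4 * (c ^ 2 + 1))) ≤ η / 2 := by
    rw [← mul_div_assoc, div_le_div_iff₀ (by positivity) (by positivity)]
    nlinarith [sq_nonneg c]
  linarith

/-- Chebyshev's inequality and a union bound over the finitely many test functions describing `O`.
Allowing a submonoid reduces products of processes to test functions of product form. -/
theorem tendsto_measureReal_goodModels {𝒵 : Type*} [MetricSpace 𝒵] [CompactSpace 𝒵]
    [MeasurableSpace 𝒵] [BorelSpace 𝒵] (σ : ∀ n, G → Equiv.Perm (V n))
    (M : ∀ n, ProbabilityMeasure (V n → 𝒵)) (ν : ProbabilityMeasure (G → 𝒵))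
    (S : Submonoid C(G → 𝒵, ℝ)) (hS : ∀ x y : G → 𝒵, x ≠ y → ∃ f ∈ S, f x ≠ f y)
    (h : ∀ F ∈ S, ∀ η > 0, ∀ᶠ n in atTop, ∫ z, (mean (fun v => F (pullbackName (σ n) v z))
      - ∫ ω, F ω ∂(ν : Measure (G → 𝒵))) ^ 2 ∂(M n : Measure (V n → 𝒵)) ≤ η)
    {O : Set (ProbabilityMeasure (G → 𝒵))} (hO : O ∈ 𝓝 ν) :
    Tendsto (fun n => (M n : Measure (V n → 𝒵)).real (goodModels O (σ n))) atTop (𝓝 1) := by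
  obtain ⟨T, ε, hε, hT⟩ := exists_finset_of_mem_nhds S hS ν hO
  rw [Metric.tendsto_nhds]
  intro r hr
  have hev : ∀ᶠ n in atTop, ∀ F ∈ T, ∫ z, (mean (fun v => F.1 (pullbackName (σ n) v z))
      - ∫ ω, F.1 ω ∂(ν : Measure (G → 𝒵))) ^ 2 ∂(M n : Measure (V n → 𝒵))
        ≤ ε ^ 2 * (r / (2 * (T.card + 1))) :=
    (Filter.eventually_all_finset T).mpr fun F _ => h F.1 F.2 _ (by positivity)
  filter_upwards [hev] with n hn
  let D : S → (V n → 𝒵) → ℝ := fun F z => mean (fun v => F.1 (pullbackName (σ n) v z))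
      - ∫ ω, F.1 ω ∂(ν : Measure (G → 𝒵))
  have hDm : ∀ F, Measurable (D F) := fun F => (measurable_mean fun v =>
    F.1.continuous.measurable.comp (measurable_pullbackName (σ n) v)).sub_const _
  have hDi : ∀ F, Integrable (fun z => D F z ^ 2) (M n : Measure (V n → 𝒵)) := fun F => by
    obtain ⟨C, hC, hFC⟩ := exists_abs_le F.1
    exact integrable_sq_of_abs_le (hDm F) (C := C + C) fun z =>
      (abs_sub _ _).trans (add_le_add (abs_mean_le fun v => hFC _)
        (abs_integral_le_of_abs_le hFC))
  have hsub : (⋃ F ∈ T, {z | ε ≤ |D F z|})ᶜ ⊆ goodModels O (σ n) := by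
    intro z hz
    refine hT _ fun F hF => ?_
    rw [integral_empirical]
    simp only [Set.mem_compl_iff, Set.mem_iUnion, Set.mem_ofPred_eq, not_exists, not_le] at hz
    exact hz F hF
  have hms : MeasurableSet (⋃ F ∈ T, {z | ε ≤ |D F z|}) :=
    Finset.measurableSet_biUnion T fun F _ => measurableSet_le measurable_const (hDm F).abs
  have hbad : (M n : Measure (V n → 𝒵)).real (⋃ F ∈ T, {z | ε ≤ |D F z|}) ≤ r / 2 := by
    calc _ ≤ ∑ F ∈ T, (M n : Measure (V n → 𝒵)).real {z | ε ≤ |D F z|} :=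
          measureReal_biUnion_finset_le _ _
      _ ≤ ∑ _F ∈ T, r / (2 * (T.card + 1)) := Finset.sum_le_sum fun F hF => by
          refine (measureReal_le_integral_sq (hDi F) hε).trans ?_
          rw [div_le_iff₀ (by positivity), mul_comm]
          exact hn F hF
      _ ≤ r / 2 := by
          rw [Finset.sum_const, nsmul_eq_mul, ← mul_div_assoc,
            div_le_div_iff₀ (by positivity) (by positivity)]
          nlinarith [Nat.cast_nonneg (α := ℝ) T.card]
  have h1 : 1 - r / 2 ≤ (M n : Measure (V n → 𝒵)).real (goodModels O (σ n)) := by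
    refine le_trans ?_ (measureReal_mono hsub)
    rw [probReal_compl_eq_one_sub hms]
    linarith
  have h2 : (M n : Measure (V n → 𝒵)).real (goodModels O (σ n)) ≤ 1 := measureReal_le_one
  rw [Real.dist_eq, abs_lt]
  constructor <;> linarith

/-- The weight is the deviation itself: if `a v` is the difference between the expectation of `f` at
`v` and its integral under `ν`, the weighted average with weight `a` has expectation equal to the
mean of `a v ^ 2`. Decorrelation makes this small, so most deviations are small. Continuity of
`square` passes from one process to its square. -/
theorem UniformlyDecorrelated.localWeakStarConverges_square {σ : ∀ n, G → Equiv.Perm (V n)}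
    {m : ∀ n, ProbabilityMeasure (V n → 𝒳)} {ν : ProbabilityMeasure (G → 𝒳)}
    (h : UniformlyDecorrelated σ m ν) :
    LocalWeakStarConverges σ (fun n => square (m n)) (square ν) := by
  intro O hO
  have hcont : Continuous fun P : ProbabilityMeasure (G → 𝒳) => square P :=
    (ProbabilityMeasure.continuous_map (f := zip) (by unfold zip; fun_prop)).comp
      (ProbabilityMeasure.continuous_prod.comp (continuous_id.prodMk continuous_id))
  obtain ⟨T, ε, hε, hT⟩ := exists_finset_of_mem_nhds (⊤ : Submonoid C(G → 𝒳, ℝ))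
    (fun x y hxy => by
      obtain ⟨i, hi⟩ := Function.ne_iff.mp hxy
      exact ⟨⟨fun ω => dist (ω i) (x i), by fun_prop⟩, trivial,
        by simpa using (dist_pos.mpr (Ne.symm hi)).ne⟩) ν (hcont.continuousAt hO)
  refine whp_of_forall_proportion_not_le fun r hr => ?_
  have hev : ∀ᶠ n in atTop, ∀ f ∈ T, mean (fun v : V n =>
      (∫ x, f.1 (pullbackName (σ n) v x) ∂(m n : Measure (V n → 𝒳))
        - ∫ ω, f.1 ω ∂(ν : Measure (G → 𝒳))) ^ 2) ≤ ε ^ 2 * (r / (T.card + 1)) := by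
    refine (Filter.eventually_all_finset T).mpr fun f _ => ?_
    set c := ∫ ω, f.1 ω ∂(ν : Measure (G → 𝒳)) with hc
    obtain ⟨C, hC, hfC⟩ := exists_abs_le f.1
    have hcC : |c| ≤ C := abs_integral_le_of_abs_le hfC
    filter_upwards [h.eventually_of_abs_le f.1 (η := (ε ^ 2 * (r / (T.card + 1))) ^ 2)
      (by positivity) (D := C + C) (by positivity)] with n hn
    set a : V n → ℝ := fun v => ∫ x, f.1 (pullbackName (σ n) v x) ∂(m n : Measure (V n → 𝒳)) - c
      with ha
    have hfi : ∀ v, Integrable (fun x => f.1 (pullbackName (σ n) v x))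
        (m n : Measure (V n → 𝒳)) := fun v =>
      integrable_of_abs_le (measurable_comp_pullbackName (σ n) f.1 v) fun x => hfC _
    have haC : ∀ v, |a v| ≤ C + C := fun v =>
      (abs_sub _ _).trans (add_le_add (abs_integral_le_of_abs_le fun x => hfC _) hcC)
    have h1 := hn a haC
    have h2 : ∫ x, mean (fun v => a v * (f.1 (pullbackName (σ n) v x) - c))
        ∂(m n : Measure (V n → 𝒳)) = mean fun v => a v ^ 2 := by
      rw [integral_mean (u := fun v x => a v * (f.1 (pullbackName (σ n) v x) - c))
        fun v => ((hfi v).sub (integrable_const c)).const_mul (a v)]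
      congr 1
      funext v
      rw [integral_const_mul, integral_sub (hfi v) (integrable_const c), sq]
      simp [ha]
    have hXm : Measurable fun x => mean (fun v => a v * (f.1 (pullbackName (σ n) v x) - c)) :=
      measurable_mean fun v =>
        ((measurable_comp_pullbackName (σ n) f.1 v).sub_const c).const_mul (a v)
    have hXb : ∀ x, |mean (fun v => a v * (f.1 (pullbackName (σ n) v x) - c))|
        ≤ (C + C) * (C + C) := fun x => abs_mean_le fun v => by
      rw [abs_mul]
      exact mul_le_mul (haC v) ((abs_sub _ _).trans (add_le_add (hfC _) hcC)) (abs_nonneg _)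
        (by positivity)
    have h3 : (mean fun v => a v ^ 2) ^ 2 ≤ (ε ^ 2 * (r / (T.card + 1))) ^ 2 := by
      rw [← h2]
      refine le_trans ?_ h1
      -- Nonnegative variance bounds the squared expectation by the second moment.
      have hvar := ProbabilityTheory.variance_nonneg
        (fun x => mean (fun v => a v * (f.1 (pullbackName (σ n) v x) - c)))
        (m n : Measure (V n → 𝒳))
      rw [ProbabilityTheory.variance_eq_sub (MemLp.of_bound hXm.aestronglyMeasurable _
        (Eventually.of_forall hXb))] at hvar
      simpa using hvar
    exact abs_le_of_sq_le_sq' h3 (by positivity) |>.2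
  filter_upwards [hev] with n hn
  let a : (⊤ : Submonoid C(G → 𝒳, ℝ)) → V n → ℝ := fun f v =>
    ∫ x, f.1 (pullbackName (σ n) v x) ∂(m n : Measure (V n → 𝒳))
      - ∫ ω, f.1 ω ∂(ν : Measure (G → 𝒳))
  have hsub : ∀ v, ¬ (square (m n)).map (measurable_pullbackName (σ n) v).aemeasurable ∈ O →
      ∃ f ∈ T, ε ≤ |a f v| := by
    intro v hv
    by_contra! hcon
    refine hv ?_
    rw [toMeasure_square_map_pullbackName]
    refine hT _ fun f hf => ?_
    have : ∫ ω, f.1 ω ∂((m n).map (measurable_pullbackName (σ n) v).aemeasurable :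
        Measure (G → 𝒳)) = ∫ x, f.1 (pullbackName (σ n) v x) ∂(m n : Measure (V n → 𝒳)) :=
      integral_map (measurable_pullbackName (σ n) v).aemeasurable
        f.1.continuous.aestronglyMeasurable
    rw [this]
    exact hcon f hf
  refine (proportion_mono hsub).trans ((proportion_exists_le T _).trans ?_)
  calc ∑ f ∈ T, proportion (fun v => ε ≤ |a f v|) ≤ ∑ _f ∈ T, r / (T.card + 1) := by
        refine Finset.sum_le_sum fun f hf => ?_
        refine (proportion_le_mean (u := fun v => (ε ^ 2)⁻¹ * a f v ^ 2)
          (fun v => by positivity) fun v hv => ?_).trans ?_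
        · rw [← div_eq_inv_mul, one_le_div (by positivity), ← sq_abs (a f v)]
          exact pow_le_pow_left₀ hε.le hv 2
        · rw [mean_const_mul, ← div_eq_inv_mul, div_le_iff₀ (by positivity), mul_comm]
          exact hn f hf
    _ ≤ r := by
        rw [Finset.sum_const, nsmul_eq_mul, ← mul_div_assoc, div_le_iff₀ (by positivity)]
        nlinarith [Nat.cast_nonneg (α := ℝ) T.card]

/-- For `f ⊗ f'`, the values of `f'` along the second, independent copy serve as weights for `f`,
and the second moments of the empirical averages follow. -/
theorem UniformlyDecorrelated.doublyQuenchedConverges {σ : ∀ n, G → Equiv.Perm (V n)}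
    {m : ∀ n, ProbabilityMeasure (V n → 𝒳)} {ν : ProbabilityMeasure (G → 𝒳)}
    (h : UniformlyDecorrelated σ m ν) : DoublyQuenchedConverges σ m ν := by
  refine ⟨h.localWeakStarConverges_square, fun O hO => ?_⟩
  refine tendsto_measureReal_goodModels σ _ (square ν) (tensorSubmonoid G 𝒳)
    tensorSubmonoid_separates ?_ hO
  rintro _ ⟨⟨f, f'⟩, rfl⟩ η hη
  obtain ⟨D, hD, hfD⟩ := exists_abs_le f'
  filter_upwards [h.eventually_integral_sq_mean_mul_sub_le (fun n => (m n : Measure (V n → 𝒳))) f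
    (fun n v y => f' (pullbackName (σ n) v y))
    (fun n v => measurable_comp_pullbackName (σ n) f' v) hD (fun n v y => hfD _)
    (fun η hη => h.eventually_integral_sq_mean_sub_le f' hη) hη] with n hn
  rw [integral_tensor_square, integral_square]
  · exact hn
  · exact ((measurable_mean fun v => (tensor f f').continuous.measurable.comp
      (measurable_pullbackName (σ n) v)).sub_const _).pow_const 2

end Decorrelation

/-! ### Covering numbers of powers of measures -/

section CovPower

variable {V : Type*} [Fintype V] {𝒳 : Type*} [MetricSpace 𝒳] [CompactSpace 𝒳]
  [MeasurableSpace 𝒳] [BorelSpace 𝒳]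

theorem pi_succ_eq_map {Ω : Type*} [MeasurableSpace Ω] (m : Measure Ω) [IsProbabilityMeasure m]
    (k : ℕ) : (Measure.pi fun _ : Fin (k + 1) => m)
      = (m.prod (Measure.pi fun _ : Fin k => m)).map
        (fun p => (Fin.cons p.1 p.2 : Fin (k + 1) → Ω)) := by
  have := (measurePreserving_piFinSuccAbove (fun _ : Fin (k + 1) => m) 0).symm.map_eq
  rw [← this]
  congr 1
  funext p
  simp [MeasurableEquiv.piFinSuccAbove, Fin.consEquiv]

theorem measurable_finCons {Ω : Type*} [MeasurableSpace Ω] (k : ℕ) :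
    Measurable fun p : Ω × (Fin k → Ω) => (Fin.cons p.1 p.2 : Fin (k + 1) → Ω) := by
  refine measurable_pi_lambda _ fun i => ?_
  refine Fin.cases ?_ (fun j => ?_) i
  · simpa using measurable_fst
  · exact (measurable_pi_apply j).comp measurable_snd

theorem measurable_hammingAvg_left (f : V → 𝒳) : Measurable fun x : V → 𝒳 => hammingAvg x f :=
  (Finset.measurable_sum _ fun v _ => (measurable_pi_apply v).dist measurable_const).div_const _

theorem covMeasure_le_encard {ε δ : ℝ} {m : ProbabilityMeasure (V → 𝒳)} {F : Set (V → 𝒳)}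
    (h : 1 - ε < (m : Measure (V → 𝒳)).real (hammingNhd δ F)) : covMeasure ε δ m ≤ F.encard :=
  iInf₂_le F h

/-- A covering of most of a power of `m` by products of balls has at least as many elements as the
power of the covering number of `m`. -/
theorem covMeasure_pow_le (m : ProbabilityMeasure (V → 𝒳)) {ε δ : ℝ} (hε : 0 < ε)
    (hδ : 0 < δ) : ∀ (k : ℕ) (F : Finset (Fin k → V → 𝒳)),
      1 - ε ^ k < (Measure.pi fun _ : Fin k => (m : Measure (V → 𝒳))).real
        {x | ∃ f ∈ F, ∀ j, hammingAvg (x j) (f j) < δ / 2} →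
      covMeasure ε δ m ^ k ≤ F.card := by
  classical
  intro k
  induction k with
  | zero =>
    intro F hF
    -- For `k = 0` the threshold `1 - ε ^ 0` is `0`, which already excludes the empty set.
    have hne : F.Nonempty := by
      by_contra hne
      rw [Finset.not_nonempty_iff_eq_empty] at hne
      subst hne
      simp at hF
    have : 1 ≤ F.card := hne.card_pos
    rw [pow_zero]
    exact_mod_cast this
  | succ k ih =>
    intro F hF
    set N := covMeasure ε δ m with hN
    let P : Measure (Fin k → V → 𝒳) := Measure.pi fun _ : Fin k => (m : Measure (V → 𝒳))
    let A : (V → 𝒳) → Set (Fin k → V → 𝒳) := fun x =>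
      {y | ∃ f ∈ F, hammingAvg x (f 0) < δ / 2 ∧ ∀ j : Fin k, hammingAvg (y j) (f j.succ) < δ / 2}
    have hAm : MeasurableSet {p : (V → 𝒳) × (Fin k → V → 𝒳) | p.2 ∈ A p.1} := by
      have : {p : (V → 𝒳) × (Fin k → V → 𝒳) | p.2 ∈ A p.1}
          = ⋃ f ∈ F, ({p | hammingAvg p.1 (f 0) < δ / 2} ∩
            ⋂ j : Fin k, {p | hammingAvg (p.2 j) (f j.succ) < δ / 2}) := by
        ext p
        simp only [A, Set.mem_ofPred_eq, Set.mem_iUnion, Set.mem_inter_iff, Set.mem_iInter,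
          exists_prop]
      rw [this]
      refine Finset.measurableSet_biUnion F fun f _ => MeasurableSet.inter ?_ ?_
      · exact measurableSet_lt ((measurable_hammingAvg_left (f 0)).comp measurable_fst)
          measurable_const
      · exact MeasurableSet.iInter fun j => measurableSet_lt
          ((measurable_hammingAvg_left (f j.succ)).comp
            ((measurable_pi_apply j).comp measurable_snd)) measurable_const
    have hm1 : Measurable fun x => P.real (A x) :=
      (measurable_measure_prodMk_left (ν := P) hAm).ennreal_toReal
    have hi1 : Integrable (fun x => P.real (A x)) (m : Measure (V → 𝒳)) :=
      integrable_of_abs_le hm1 (C := 1) fun x => by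
        rw [abs_of_nonneg measureReal_nonneg]
        exact measureReal_le_one
    have hprod : (Measure.pi fun _ : Fin (k + 1) => (m : Measure (V → 𝒳))).real
        {x | ∃ f ∈ F, ∀ j, hammingAvg (x j) (f j) < δ / 2}
        = ∫ x, P.real (A x) ∂(m : Measure (V → 𝒳)) := by
      rw [pi_succ_eq_map, map_measureReal_apply (measurable_finCons k)]
      · have hpre : (fun p : (V → 𝒳) × (Fin k → V → 𝒳) => (Fin.cons p.1 p.2 : Fin (k + 1) → V → 𝒳))
            ⁻¹' {x | ∃ f ∈ F, ∀ j, hammingAvg (x j) (f j) < δ / 2}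
            = {p | p.2 ∈ A p.1} := by
          ext p
          simp [A, Fin.forall_fin_succ]
        rw [hpre, measureReal_def, Measure.prod_apply hAm, integral_eq_lintegral_of_nonneg_ae
          (Eventually.of_forall fun _ => measureReal_nonneg) hm1.aestronglyMeasurable]
        congr 1
        refine lintegral_congr fun x => ?_
        rw [ofReal_measureReal]
        rfl
      · have : {x : Fin (k + 1) → V → 𝒳 | ∃ f ∈ F, ∀ j, hammingAvg (x j) (f j) < δ / 2}
            = ⋃ f ∈ F, ⋂ j, {x | hammingAvg (x j) (f j) < δ / 2} := by
          ext x
          simp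
        rw [this]
        exact Finset.measurableSet_biUnion F fun f _ => MeasurableSet.iInter fun j =>
          measurableSet_lt ((measurable_hammingAvg_left (f j)).comp (measurable_pi_apply j))
            measurable_const
    -- The points whose slice is covered beyond `1 - ε ^ k`. The total deficit is below `ε ^ (k +
    -- 1)`, so Markov's inequality at level `ε ^ k` leaves deficit below `ε` for this set.
    let good : Set (V → 𝒳) := {x | 1 - ε ^ k < P.real (A x)}
    have hgm : MeasurableSet good := measurableSet_lt measurable_const hm1
    have hgood : 1 - ε < (m : Measure (V → 𝒳)).real good := by
      have h1 := mul_meas_ge_le_integral_of_nonneg (μ := (m : Measure (V → 𝒳)))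
        (f := fun x => 1 - P.real (A x))
        (Eventually.of_forall fun x => sub_nonneg.mpr measureReal_le_one)
        ((integrable_const 1).sub hi1) (ε ^ k)
      have h2 : {x | ε ^ k ≤ 1 - P.real (A x)} = goodᶜ := by
        ext x
        simp only [good, Set.mem_compl_iff, Set.mem_ofPred_eq, not_lt]
        constructor <;> intro h <;> linarith
      rw [h2, probReal_compl_eq_one_sub hgm, integral_sub (integrable_const 1) hi1, ← hprod] at h1
      have h3 : ε ^ k * (1 - (m : Measure (V → 𝒳)).real good) < ε ^ k * ε := by
        refine h1.trans_lt ?_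
        rw [← pow_succ]
        simp only [integral_const, probReal_univ, smul_eq_mul, mul_one]
        linarith
      have := lt_of_mul_lt_mul_left h3 (by positivity)
      linarith
    -- Greedy choice of a `δ`-separated set: fewer than `N` balls cannot cover a set of measure
    -- above `1 - ε`.
    have hstep : ∀ n : ℕ, (n : ℕ∞) ≤ N → ∃ T : Finset (V → 𝒳), T.card = n ∧ (∀ x ∈ T, x ∈ good) ∧
        ∀ x ∈ T, ∀ y ∈ T, x ≠ y → δ ≤ hammingAvg x y := by
      intro n
      induction n with
      | zero => exact fun _ => ⟨∅, by simp⟩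
      | succ n ihn =>
        intro hn
        have hn' : (n : ℕ∞) < N := lt_of_lt_of_le (by exact_mod_cast Nat.lt_succ_self n) hn
        obtain ⟨T, hT, hTg, hTs⟩ := ihn hn'.le
        have : ¬ good ⊆ hammingNhd δ (T : Set (V → 𝒳)) := fun hsub => by
          have h1 := covMeasure_le_encard (hgood.trans_le (measureReal_mono hsub))
          rw [Set.encard_coe_eq_coe_finsetCard, hT] at h1
          exact absurd h1 (not_le.mpr hn')
        obtain ⟨x, hxg, hx⟩ := Set.not_subset.mp this
        have hxd : ∀ y ∈ T, δ ≤ hammingAvg x y := fun y hy => by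
          by_contra! hlt
          exact hx ⟨y, hy, hlt⟩
        have hxT : x ∉ T := fun hxT => by
          have := hxd x hxT
          rw [hammingAvg_self] at this
          linarith
        refine ⟨insert x T, by rw [Finset.card_insert_of_notMem hxT, hT], ?_, ?_⟩
        · intro y hy
          rcases Finset.mem_insert.mp hy with rfl | hy
          · exact hxg
          · exact hTg y hy
        · intro y hy z hz hyz
          rcases Finset.mem_insert.mp hy with hy | hy <;>
            rcases Finset.mem_insert.mp hz with hz | hz
          · exact absurd (hy.trans hz.symm) hyz
          · exact hy ▸ hxd z hz
          · rw [hammingAvg_comm, hz]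
            exact hxd y hy
          · exact hTs y hy z hz hyz
    have hmul : ∀ n : ℕ, (n : ℕ∞) ≤ N → n * N ^ k ≤ F.card := by
      intro n hn
      obtain ⟨T, hT, hTg, hTs⟩ := hstep n hn
      -- For `δ`-separated points these parts of `F` are disjoint, because a first entry cannot be
      -- within `δ/2` of two of them. By induction each part has at least `N ^ k` elements.
      let Fx : (V → 𝒳) → Finset (Fin (k + 1) → V → 𝒳) := fun x =>
        F.filter fun f => hammingAvg x (f 0) < δ / 2
      have hFx : ∀ x ∈ T, N ^ k ≤ (Fx x).card := fun x hx => by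
        refine (ih ((Fx x).image Fin.tail) ?_).trans (by exact_mod_cast Finset.card_image_le)
        have hset : {y : Fin k → V → 𝒳 | ∃ f ∈ (Fx x).image Fin.tail,
            ∀ j, hammingAvg (y j) (f j) < δ / 2} = A x := by
          ext y
          simp [A, Fx, Fin.tail, and_assoc]
        rw [hset]
        exact hTg x hx
      have hdisj : (T : Set (V → 𝒳)).PairwiseDisjoint Fx := by
        intro x hx y hy hxy
        refine Finset.disjoint_left.mpr fun f hfx hfy => ?_
        have h1 := (Finset.mem_filter.mp hfx).2
        have h2 := (Finset.mem_filter.mp hfy).2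
        rw [hammingAvg_comm] at h2
        linarith [hTs x hx y hy hxy, hammingAvg_triangle x (f 0) y]
      calc (n : ℕ∞) * N ^ k = T.card • N ^ k := by rw [nsmul_eq_mul, hT]
        _ ≤ ∑ x ∈ T, ((Fx x).card : ℕ∞) := Finset.card_nsmul_le_sum _ _ _ hFx
        _ = (T.biUnion Fx).card := by rw [Finset.card_biUnion hdisj]; push_cast; rfl
        _ ≤ F.card := by
            exact_mod_cast Finset.card_le_card
              (Finset.biUnion_subset.mpr fun x _ => Finset.filter_subset _ _)
    rw [pow_succ']
    clear_value N
    cases N with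
    | top =>
      exfalso
      have h1 := hmul (F.card + 1) le_top
      have h2 : ((F.card + 1 : ℕ) : ℕ∞) ≤ F.card :=
        le_trans (le_mul_of_one_le_right' (one_le_pow_of_one_le' le_top k)) h1
      have : F.card + 1 ≤ F.card := by exact_mod_cast h2
      omega
    | coe n => exact hmul n le_rfl

end CovPower

/-! ### Powers of decorrelated sequences of measures -/

section Powers

variable {G : Type*} [Countable G] {V : ℕ → Type*} [∀ n, Fintype (V n)] [∀ n, Nonempty (V n)]
  {𝒳 : Type*} [MetricSpace 𝒳] [CompactSpace 𝒳] [MeasurableSpace 𝒳] [BorelSpace 𝒳]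

/-- Splitting off the first copy, the product over the remaining copies is an independent bounded
family whose mean concentrates by induction. -/
theorem UniformlyDecorrelated.eventually_integral_pi_le {σ : ∀ n, G → Equiv.Perm (V n)}
    {m : ∀ n, ProbabilityMeasure (V n → 𝒳)} {ν : ProbabilityMeasure (G → 𝒳)}
    (h : UniformlyDecorrelated σ m ν) : ∀ (k : ℕ) (f : Fin k → C(G → 𝒳, ℝ)) (η : ℝ), 0 < η →
    ∀ᶠ n in atTop, ∫ x, (mean (fun v => ∏ j, f j (pullbackName (σ n) v (x j)))
      - ∏ j, ∫ ω, f j ω ∂(ν : Measure (G → 𝒳))) ^ 2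
        ∂(Measure.pi fun _ : Fin k => (m n : Measure (V n → 𝒳))) ≤ η := by
  intro k
  induction k with
  | zero =>
    intro f η hη
    refine Eventually.of_forall fun n => ?_
    simpa [mean_const] using hη.le
  | succ k ih =>
    intro f η hη
    choose C hC hfC using fun j => exists_abs_le (f j)
    have hg : ∀ n (v : V n), Measurable fun y : Fin k → V n → 𝒳 =>
        ∏ j, f (Fin.succ j) (pullbackName (σ n) v (y j)) := fun n v =>
      Finset.measurable_prod _ fun j _ =>
        (measurable_comp_pullbackName (σ n) (f j.succ) v).comp (measurable_pi_apply j)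
    filter_upwards [h.eventually_integral_sq_mean_mul_sub_le
      (fun n => Measure.pi fun _ : Fin k => (m n : Measure (V n → 𝒳))) (f 0)
      (fun n v y => ∏ j, f (Fin.succ j) (pullbackName (σ n) v (y j))) hg
      (D := ∏ j : Fin k, C j.succ) (Finset.prod_pos fun j _ => hC _)
      (fun n v y => by
        rw [Finset.abs_prod]
        exact Finset.prod_le_prod (fun _ _ => abs_nonneg _) fun j _ => hfC _ _)
      (ih fun j => f j.succ) hη] with n hn
    rw [pi_succ_eq_map, integral_map (measurable_finCons k).aemeasurable]
    · simpa [Fin.prod_univ_succ] using hn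
    · exact (((measurable_mean fun v => Finset.measurable_prod _ fun j _ =>
        (measurable_comp_pullbackName (σ n) (f j) v).comp (measurable_pi_apply j)).sub_const
          _).pow_const 2).aestronglyMeasurable

/-- The function on the power of a process that is the product of functions of its coordinates. -/
def piTensor {I : Type*} {k : ℕ} (f : Fin k → C(I → 𝒳, ℝ)) : C(I → Fin k → 𝒳, ℝ) :=
  ⟨fun ω => ∏ j, f j (recode (fun x => x j) ω), continuous_finsetProd _ fun j _ =>
    (f j).continuous.comp (continuous_recode (continuous_apply j))⟩

/-- The functions of product form on a power of a process. -/
def piTensorSubmonoid (I 𝒳 : Type*) [MetricSpace 𝒳] [CompactSpace 𝒳] (k : ℕ) :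
    Submonoid C(I → Fin k → 𝒳, ℝ) where
  carrier := Set.range fun f : Fin k → C(I → 𝒳, ℝ) => piTensor f
  one_mem' := ⟨1, by ext; simp [piTensor]⟩
  mul_mem' := by
    rintro _ _ ⟨p, rfl⟩ ⟨q, rfl⟩
    exact ⟨p * q, by ext; simp [piTensor, Finset.prod_mul_distrib]⟩

theorem piTensorSubmonoid_separates {I : Type*} {k : ℕ} (x y : I → Fin k → 𝒳) (h : x ≠ y) :
    ∃ f ∈ piTensorSubmonoid I 𝒳 k, f x ≠ f y := by
  obtain ⟨i, hi⟩ := Function.ne_iff.mp h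
  obtain ⟨j, hj⟩ := Function.ne_iff.mp hi
  refine ⟨_, ⟨Function.update 1 j ⟨fun ω => dist (ω i) (x i j), by fun_prop⟩, rfl⟩, ?_⟩
  have key : ∀ z : I → Fin k → 𝒳, piTensor (Function.update (1 : Fin k → C(I → 𝒳, ℝ)) j
      ⟨fun ω => dist (ω i) (x i j), by fun_prop⟩) z = dist (z i j) (x i j) := fun z => by
    change ∏ l : Fin k, (Function.update (1 : Fin k → C(I → 𝒳, ℝ)) j
      ⟨fun ω => dist (ω i) (x i j), by fun_prop⟩) l (recode (fun x => x l) z) = _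
    rw [Finset.prod_eq_single j]
    · simp [recode]
    · intro l _ hl
      simp [Function.update_of_ne hl]
    · simp
  rw [key, key]
  simpa using (dist_pos.mpr (Ne.symm hj)).ne

theorem integral_piTensor_orbitProcess [Group G] [MulAction G 𝒳] [MeasurableConstSMul G 𝒳]
    (μ : ProbabilityMeasure 𝒳) {k : ℕ} (f : Fin k → C(G → 𝒳, ℝ)) :
    ∫ ω, piTensor f ω
        ∂(orbitProcess G (ProbabilityMeasure.pi fun _ : Fin k => μ) : Measure (G → Fin k → 𝒳))
      = ∏ j, ∫ ω, f j ω ∂(orbitProcess G μ : Measure (G → 𝒳)) := by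
  have h1 : ∀ j, ∫ ω, f j ω ∂(orbitProcess G μ : Measure (G → 𝒳))
      = ∫ x, f j (fun g => g • x) ∂(μ : Measure 𝒳) := fun j => by
    rw [toMeasure_orbitProcess, integral_map measurable_orbit.aemeasurable
      (f j).continuous.aestronglyMeasurable]
  simp only [h1]
  rw [toMeasure_orbitProcess, integral_map measurable_orbit.aemeasurable
    (piTensor f).continuous.aestronglyMeasurable]
  exact integral_fintype_prod_eq_prod (fun j x => f j fun g => g • x)

/-- The identification of tuples of points of `𝒳^V` with points of `(𝒳^k)^V`. -/
def transpose {W : Type*} {k : ℕ} (x : Fin k → W → 𝒳) : W → Fin k → 𝒳 := fun v j => x j v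

theorem measurable_transpose {W : Type*} {k : ℕ} :
    Measurable (transpose (𝒳 := 𝒳) (W := W) (k := k)) :=
  measurable_pi_lambda _ fun v => measurable_pi_lambda _ fun j =>
    (measurable_pi_apply v).comp (measurable_pi_apply j)

/-- The power of a measure on `𝒳^V`, as a measure on `(𝒳^k)^V`. -/
def power {W : Type*} (m : ProbabilityMeasure (W → 𝒳)) (k : ℕ) :
    ProbabilityMeasure (W → Fin k → 𝒳) :=
  (ProbabilityMeasure.pi fun _ : Fin k => m).map measurable_transpose.aemeasurable

theorem toMeasure_power {W : Type*} (m : ProbabilityMeasure (W → 𝒳)) (k : ℕ) :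
    (power m k : Measure (W → Fin k → 𝒳))
      = (Measure.pi fun _ : Fin k => (m : Measure (W → 𝒳))).map transpose := rfl

theorem UniformlyDecorrelated.tendsto_power_goodModels [Group G] [MulAction G 𝒳]
    [MeasurableConstSMul G 𝒳] {σ : ∀ n, G → Equiv.Perm (V n)}
    {m : ∀ n, ProbabilityMeasure (V n → 𝒳)} {μ : ProbabilityMeasure 𝒳}
    (h : UniformlyDecorrelated σ m (orbitProcess G μ)) (k : ℕ)
    {O : Set (ProbabilityMeasure (G → Fin k → 𝒳))}
    (hO : O ∈ 𝓝 (orbitProcess G (ProbabilityMeasure.pi fun _ : Fin k => μ))) :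
    Tendsto (fun n => (power (m n) k : Measure (V n → Fin k → 𝒳)).real (goodModels O (σ n)))
      atTop (𝓝 1) := by
  refine tendsto_measureReal_goodModels σ _ _ (piTensorSubmonoid G 𝒳 k)
    piTensorSubmonoid_separates ?_ hO
  rintro _ ⟨f, rfl⟩ η hη
  filter_upwards [h.eventually_integral_pi_le k f η hη] with n hn
  rw [integral_piTensor_orbitProcess, toMeasure_power, integral_map
    measurable_transpose.aemeasurable]
  · exact hn
  · exact (((measurable_mean fun v => (piTensor f).continuous.measurable.comp
      (measurable_pullbackName (σ n) v)).sub_const _).pow_const 2).aestronglyMeasurable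

/-- The sup distance dominates each coordinate, so a Hamming ball in `(𝒳^k)^V` lies in a product of
balls and `covMeasure_pow_le` applies. -/
theorem covMeasure_pow_le_cov {W : Type*} [Fintype W] (m : ProbabilityMeasure (W → 𝒳)) {ε δ : ℝ}
    (hε : 0 < ε) (hδ : 0 < δ) (k : ℕ) {Z : Set (W → Fin k → 𝒳)}
    (hZ : 1 - ε ^ k < (power m k : Measure (W → Fin k → 𝒳)).real Z) :
    covMeasure ε δ m ^ k ≤ cov (δ / 2) Z := by
  classical
  by_cases htop : cov (δ / 2) Z = ⊤
  · simp [htop]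
  obtain ⟨F, -, hZF, hF⟩ := exists_encard_eq_cov htop
  have hfin : F.Finite := Set.encard_ne_top_iff.mp (by rwa [hF])
  have hle := covMeasure_pow_le m hε hδ k
    (hfin.toFinset.image fun (z : W → Fin k → 𝒳) j v => z v j) (by
      refine (hZ.trans_le (measureReal_mono hZF)).trans_le ?_
      have hms : MeasurableSet (hammingNhd (δ / 2) F) := by
        have : hammingNhd (δ / 2) F = ⋃ f ∈ F, {z | hammingAvg z f < δ / 2} := by
          ext z
          simp [hammingNhd]
        rw [this]
        exact hfin.measurableSet_biUnion fun f _ =>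
          measurableSet_lt (measurable_hammingAvg_left f) measurable_const
      rw [toMeasure_power, map_measureReal_apply measurable_transpose hms]
      refine measureReal_mono ?_
      rintro x ⟨f, hf, hxf⟩
      refine ⟨fun j v => f v j, Finset.mem_image.mpr ⟨f, by simpa using hf, rfl⟩, fun j => ?_⟩
      exact lt_of_le_of_lt (hammingAvg_mono fun v =>
        dist_le_pi_dist (transpose x v) (f v) j) hxf)
  refine hle.trans ?_
  rw [← hF, hfin.encard_eq_coe_toFinset_card]
  exact_mod_cast Finset.card_image_le

end Powers

/-! ### The doubly-quenched entropy is at most the power-stabilized entropy -/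

section DQ

universe u v w

variable {G : Type u} [Group G] [Countable G]

/-- Good models of the `k`-th power eventually carry more than `1 - ε ^ k` of the `k`-th power of `m
i`, so covering them costs at least the `k`-th power of the covering number of `m i`. -/
theorem processDQEntropy_le_div {𝒳 : Type v} [MetricSpace 𝒳] [CompactSpace 𝒳]
    [MeasurableSpace 𝒳] [BorelSpace 𝒳] [MulAction G 𝒳] [MeasurableConstSMul G 𝒳]
    (S : SoficApproximation.{u, w} G) (μ : ProbabilityMeasure 𝒳) {k : ℕ} (hk : 0 < k) :
    processDQEntropy S (orbitProcess G μ)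
      ≤ processEntropy S (orbitProcess G (ProbabilityMeasure.pi fun _ : Fin k => μ)) / k := by
  have hk0 : (0 : EReal) < k := by exact_mod_cast hk
  refine iSup₂_le fun φ hφ => iSup₂_le fun m hm => iSup₂_le fun δ hδ => iSup₂_le fun ε hε => ?_
  rw [EReal.le_div_iff_mul_le hk0 (EReal.natCast_ne_top k), mul_comm,
    ← EReal.limsup_const_mul_of_nonneg_of_ne_top hk0.le (EReal.natCast_ne_top k)]
  refine le_iSup₂_of_le (δ / 2) (by positivity) (le_iInf₂ fun O hO => ?_)
  have hd := hm.uniformlyDecorrelated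
  have hlim := hd.tendsto_power_goodModels k hO
  have hev := hlim.eventually (lt_mem_nhds (show 1 - ε ^ k < (1 : ℝ) from
    sub_lt_self _ (by positivity)))
  calc limsup (fun i => (k : EReal) * logRate (S.V (φ i)) (covMeasure ε δ (m i))) atTop
      ≤ limsup ((fun n => logRate (S.V n) (cov (δ / 2) (goodModels O (S.σ n)))) ∘ φ) atTop := by
        refine limsup_le_limsup ?_
        filter_upwards [hev] with i hi
        rw [← logRate_pow]
        exact logRate_mono (covMeasure_pow_le_cov (m i) hε hδ k hi)
    _ ≤ _ := by
        -- The upper limit along a subsequence is at most the full one.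
        rw [limsup_comp]
        exact limsup_le_limsup_of_le hφ.tendsto_atTop

theorem dqEntropy_le_psEntropy {X : Type v} [MeasurableSpace X] [StandardBorelSpace X]
    [MulAction G X] [MeasurableConstSMul G X] (S : SoficApproximation.{u, w} G)
    (μ : ProbabilityMeasure X) [SMulInvariantMeasure G X (μ : Measure X)] :
    dqEntropy S μ ≤ psEntropy S μ := by
  rw [psEntropy_eq_iInf]
  refine le_iInf₂ fun k hk => ?_
  let := (someMetric X).metric
  have := (someMetric X).compact
  have := (someMetric X).borel
  rw [soficEntropy_eq_processEntropy]
  exact processDQEntropy_le_div S μ hk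

end DQ

/-! ### Counting tuples of words that mostly lie near a small set -/

section Counting

variable {V A : Type*} [Fintype V] [Fintype A] [MetricSpace A]

/-- Chernoff's method: weigh words by `exp(-s ∑ dist)`; the total weight factorizes over `V`, and
each factor is at most `1 + |A| exp(-s)`. -/
theorem card_hammingBall_le (hA : ∀ a b : A, a ≠ b → 1 ≤ dist a b) {s : ℝ} (hs : 0 ≤ s)
    (y₀ : V → A) (δ : ℝ) :
    (Nat.card {y : V → A // hammingAvg y y₀ < δ} : ℝ)
      ≤ Real.exp ((s * δ + Fintype.card A * Real.exp (-s)) * Fintype.card V) := by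
  classical
  rcases isEmpty_or_nonempty V with hV | hV
  · have : Nat.card {y : V → A // hammingAvg y y₀ < δ} ≤ 1 := by
      rw [Finite.card_le_one_iff_subsingleton]
      infer_instance
    simpa using this
  have hn : (0 : ℝ) < Fintype.card V := by exact_mod_cast Fintype.card_pos
  rw [Nat.card_eq_fintype_card, Fintype.card_subtype]
  have hcol : ∀ b₀ : A, ∑ b, Real.exp (-s * dist b b₀)
      ≤ Real.exp (Fintype.card A * Real.exp (-s)) := fun b₀ => by
    calc ∑ b, Real.exp (-s * dist b b₀)
        ≤ ∑ b, ((if b = b₀ then 1 else 0) + Real.exp (-s)) := by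
          refine Finset.sum_le_sum fun b _ => ?_
          split_ifs with hb
          · subst hb
            simp [Real.exp_nonneg]
          · rw [zero_add, Real.exp_le_exp]
            nlinarith [hA b b₀ hb]
      _ = 1 + Fintype.card A * Real.exp (-s) := by
          simp [Finset.sum_add_distrib]
      _ ≤ _ := by
          rw [add_comm]
          exact Real.add_one_le_exp _
  have hpt : ∀ y ∈ Finset.univ.filter fun y : V → A => hammingAvg y y₀ < δ,
      (1 : ℝ) ≤ Real.exp (s * δ * Fintype.card V) * ∏ v, Real.exp (-s * dist (y v) (y₀ v)) := by
    intro y hy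
    have h1 : ∑ v, dist (y v) (y₀ v) < δ * Fintype.card V := by
      have := (Finset.mem_filter.mp hy).2
      rwa [hammingAvg, div_lt_iff₀ hn] at this
    rw [← Real.exp_sum, ← Real.exp_add, Real.one_le_exp_iff, ← Finset.mul_sum]
    nlinarith
  calc ((Finset.univ.filter fun y : V → A => hammingAvg y y₀ < δ).card : ℝ)
      = ∑ _y ∈ Finset.univ.filter fun y : V → A => hammingAvg y y₀ < δ, (1 : ℝ) := by simp
    _ ≤ ∑ y : V → A,
        Real.exp (s * δ * Fintype.card V) * ∏ v, Real.exp (-s * dist (y v) (y₀ v)) :=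
        (Finset.sum_le_sum hpt).trans (Finset.sum_le_sum_of_subset_of_nonneg
          (Finset.subset_univ _) fun _ _ _ => by positivity)
    _ = Real.exp (s * δ * Fintype.card V) * ∏ v, ∑ b, Real.exp (-s * dist b (y₀ v)) := by
        rw [← Finset.mul_sum, Finset.prod_univ_sum, Fintype.piFinset_univ]
    _ ≤ Real.exp (s * δ * Fintype.card V)
        * ∏ _v : V, Real.exp (Fintype.card A * Real.exp (-s)) := by
        gcongr with v _
        exact hcol _
    _ = _ := by
        rw [Finset.prod_const, Finset.card_univ, ← Real.exp_nat_mul, ← Real.exp_add]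
        congr 1
        ring

/-- If on average most coordinates of a tuple in `T` are near the set `R`, then the cardinality of
`T` is controlled by a power of that of `R`. -/
theorem card_le_of_sum_card_le [Nonempty V] (hA : ∀ a b : A, a ≠ b → 1 ≤ dist a b) {s : ℝ}
    (hs : 0 ≤ s) (hs1 : Fintype.card A * Real.exp (-s) ≤ 1) {k : ℕ} {T : Finset (Fin k → V → A)}
    {R : Finset (V → A)} (hR : R.Nonempty) {ε δ : ℝ} (hδ : 0 ≤ δ)
    (h : ∑ a ∈ T, (Nat.card {j : Fin k // ∀ r ∈ R, δ ≤ hammingAvg (a j) r} : ℝ)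
      ≤ ε * k * T.card) :
    (T.card : ℝ) ≤ (R.card * Real.exp
      ((s * (ε + δ) + 2 * (Fintype.card A * Real.exp (-s))) * Fintype.card V)) ^ k := by
  classical
  set n : ℝ := (Fintype.card V : ℝ) with hn
  have hn1 : 1 ≤ n := by
    rw [hn]
    exact_mod_cast Fintype.card_pos (α := V)
  set κ := Fintype.card A * Real.exp (-s) with hκ
  have hκ0 : 0 ≤ κ := by positivity
  let near : (V → A) → Prop := fun y => ∃ r ∈ R, hammingAvg y r < δ
  -- A word near `R` has weight `1`, any other `exp(-s n)`. The weight of a tuple is thus the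
  -- exponential of `-s n` times its number of far entries.
  let g : (V → A) → ℝ := fun y => if near y then 1 else Real.exp (-s * n)
  have hg0 : ∀ y, 0 ≤ g y := fun y => by
    simp only [g]
    split_ifs <;> positivity
  have hprod : ∀ a : Fin k → V → A, ∏ j, g (a j)
      = Real.exp (-s * n * Nat.card {j : Fin k // ∀ r ∈ R, δ ≤ hammingAvg (a j) r}) := by
    intro a
    have h1 : ∀ j, g (a j) = if ∀ r ∈ R, δ ≤ hammingAvg (a j) r then Real.exp (-s * n) else 1 := by
      intro j
      have : near (a j) ↔ ¬ ∀ r ∈ R, δ ≤ hammingAvg (a j) r := by simp [near]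
      simp only [g, this]
      split_ifs <;> simp_all
    simp only [h1]
    rw [Finset.prod_ite, Finset.prod_const, Finset.prod_const_one, mul_one, ← Real.exp_nat_mul,
      Nat.card_eq_fintype_card, Fintype.card_subtype, mul_comm]
  have hlow : T.card * Real.exp (-s * n * (ε * k)) ≤ ∑ a ∈ T, ∏ j, g (a j) := by
    simp only [hprod]
    -- Jensen's inequality by the tangent line at `-s n ε k`: only the average number of far entries
    -- is bounded.
    have h1 : ∀ a ∈ T, Real.exp (-s * n * (ε * k)) * (1 + (-s * n * (Nat.card {j : Fin k //
        ∀ r ∈ R, δ ≤ hammingAvg (a j) r}) - -s * n * (ε * k)))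
        ≤ Real.exp (-s * n * Nat.card {j : Fin k // ∀ r ∈ R, δ ≤ hammingAvg (a j) r}) := by
      intro a _
      have := Real.add_one_le_exp (-s * n * (Nat.card {j : Fin k //
        ∀ r ∈ R, δ ≤ hammingAvg (a j) r}) - -s * n * (ε * k))
      calc _ ≤ Real.exp (-s * n * (ε * k)) * Real.exp (-s * n * (Nat.card {j : Fin k //
            ∀ r ∈ R, δ ≤ hammingAvg (a j) r}) - -s * n * (ε * k)) := by gcongr; linarith
        _ = _ := by
          rw [← Real.exp_add]
          congr 1
          ring
    refine le_trans ?_ (Finset.sum_le_sum h1)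
    rw [← Finset.mul_sum, Finset.sum_add_distrib, Finset.sum_sub_distrib, ← Finset.mul_sum,
      Finset.sum_const, Finset.sum_const, nsmul_eq_mul, nsmul_eq_mul, mul_comm]
    gcongr
    have : s * n * ∑ a ∈ T, (Nat.card {j : Fin k // ∀ r ∈ R, δ ≤ hammingAvg (a j) r} : ℝ)
        ≤ s * n * (ε * k * T.card) := by gcongr
    linarith
  have hup : ∑ y, g y ≤ R.card * Real.exp ((s * δ + 2 * κ) * n) := by
    -- Near words lie in Hamming balls around `R`. The remaining terms total `(|A| exp(-s))^|V|`,
    -- and this is where finiteness of the alphabet makes far entries cheap.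
    have h1 : ∑ y, g y ≤ (∑ r ∈ R, (Nat.card {y : V → A // hammingAvg y r < δ} : ℝ)) + κ := by
      calc ∑ y, g y ≤ ∑ y, ((∑ r ∈ R, if hammingAvg y r < δ then (1 : ℝ) else 0)
            + Real.exp (-s * n)) := by
            refine Finset.sum_le_sum fun y _ => ?_
            have h0 : ∀ r ∈ R, (0 : ℝ) ≤ if hammingAvg y r < δ then (1 : ℝ) else 0 :=
              fun r _ => by split_ifs <;> norm_num
            simp only [g]
            split_ifs with hy
            · obtain ⟨r, hr, hyr⟩ := hy
              have := Finset.single_le_sum h0 hr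
              rw [if_pos hyr] at this
              linarith [Real.exp_nonneg (-s * n)]
            · linarith [Finset.sum_nonneg h0]
        _ = (∑ r ∈ R, (Nat.card {y : V → A // hammingAvg y r < δ} : ℝ)) + κ ^ Fintype.card V := by
            rw [Finset.sum_add_distrib, Finset.sum_comm]
            congr 1
            · refine Finset.sum_congr rfl fun r _ => ?_
              rw [Finset.sum_boole, Nat.card_eq_fintype_card, Fintype.card_subtype]
            · rw [Finset.sum_const, Finset.card_univ, Fintype.card_fun, nsmul_eq_mul, hκ, mul_pow,
                ← Real.exp_nat_mul, mul_comm (-s)]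
              push_cast
              rfl
        _ ≤ _ := by
            gcongr
            exact pow_le_of_le_one hκ0 hs1 Fintype.card_ne_zero
    have h2 : ∑ r ∈ R, (Nat.card {y : V → A // hammingAvg y r < δ} : ℝ)
        ≤ R.card * Real.exp ((s * δ + κ) * n) := by
      rw [← nsmul_eq_mul]
      exact Finset.sum_le_card_nsmul _ _ _ fun r _ => card_hammingBall_le hA hs r δ
    have h3 : (1 : ℝ) ≤ R.card * Real.exp ((s * δ + κ) * n) := by
      have h4 : (1 : ℝ) ≤ R.card := by exact_mod_cast hR.card_pos
      have h5 : 1 ≤ Real.exp ((s * δ + κ) * n) := Real.one_le_exp (by positivity)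
      nlinarith
    calc ∑ y, g y ≤ R.card * Real.exp ((s * δ + κ) * n) * (1 + κ) := by nlinarith
      _ ≤ R.card * Real.exp ((s * δ + κ) * n) * Real.exp (κ * n) := by
          gcongr
          nlinarith [Real.add_one_le_exp (κ * n)]
      _ = _ := by
          rw [mul_assoc, ← Real.exp_add]
          ring_nf
  have hall : ∑ a ∈ T, ∏ j, g (a j) ≤ (∑ y, g y) ^ k := by
    rw [Fintype.sum_pow]
    exact Finset.sum_le_sum_of_subset_of_nonneg (Finset.subset_univ _) fun a _ _ =>
      Finset.prod_nonneg fun j _ => hg0 _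
  have hfin : T.card * Real.exp (-s * n * (ε * k))
      ≤ (R.card * Real.exp ((s * δ + 2 * κ) * n)) ^ k :=
    (hlow.trans hall).trans (pow_le_pow_left₀ (Finset.sum_nonneg fun y _ => hg0 y) hup k)
  calc (T.card : ℝ)
      = T.card * Real.exp (-s * n * (ε * k)) * Real.exp (s * ε * n) ^ k := by
        rw [← Real.exp_nat_mul, mul_assoc, ← Real.exp_add]
        ring_nf
        simp
    _ ≤ (R.card * Real.exp ((s * δ + 2 * κ) * n)) ^ k * Real.exp (s * ε * n) ^ k := by gcongr
    _ = _ := by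
        rw [← mul_pow, mul_assoc, ← Real.exp_add]
        ring_nf

end Counting

/-! ### Uniform averages of point masses -/

section UniformLaw

variable {ι Ω : Type*} [Fintype ι] [Nonempty ι] [MeasurableSpace Ω]

/-- The uniform average of the point masses at a finite family of points. -/
def uniformLaw (y : ι → Ω) : ProbabilityMeasure Ω :=
  ⟨((Fintype.card ι : ℝ≥0∞))⁻¹ • ∑ i, Measure.dirac (y i), ⟨by
    simp [ENNReal.inv_mul_cancel]⟩⟩

theorem integral_uniformLaw [MeasurableSingletonClass Ω] (y : ι → Ω) (f : Ω → ℝ) :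
    ∫ x, f x ∂(uniformLaw y : Measure Ω) = mean fun i => f (y i) := by
  change ∫ x, f x ∂(((Fintype.card ι : ℝ≥0∞))⁻¹ • ∑ i, Measure.dirac (y i)) = _
  rw [integral_smul_measure, integral_finsetSum_measure fun i _ => integrable_dirac (by simp)]
  simp [mean, div_eq_inv_mul]

theorem measureReal_uniformLaw [MeasurableSingletonClass Ω] (y : ι → Ω) (s : Set Ω) :
    (uniformLaw y : Measure Ω).real s = (Nat.card {i // y i ∈ s} : ℝ) / Fintype.card ι := by
  classical
  change (((Fintype.card ι : ℝ≥0∞))⁻¹ • ∑ i, Measure.dirac (y i)).real s = _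
  rw [Measure.real, Measure.smul_apply, Measure.finsetSum_apply, smul_eq_mul, ENNReal.toReal_mul]
  simp [Set.indicator_apply, Nat.card_eq_fintype_card, Fintype.card_subtype, div_eq_inv_mul]

/-- Bessel's inequality for an almost orthogonal family. -/
theorem sum_sq_mean_mul_le {V : Type*} [Fintype V] [Nonempty V] {k : ℕ} {u : Fin k → V → ℝ}
    {C e : ℝ} (hC : ∀ j v, |u j v| ≤ C) (he : 0 ≤ e)
    (h : ∀ i j, i ≠ j → |mean fun v => u i v * u j v| ≤ e) {w : V → ℝ} (hw : ∀ v, |w v| ≤ 1) :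
    ∑ j, mean (fun v => w v * u j v) ^ 2 ≤ C ^ 2 + e * k := by
  classical
  have hn : (0 : ℝ) < Fintype.card V := by exact_mod_cast Fintype.card_pos
  set s : Fin k → ℝ := fun j => mean fun v => w v * u j v with hs
  set S := ∑ j, s j ^ 2 with hS
  have hS0 : 0 ≤ S := Finset.sum_nonneg fun _ _ => sq_nonneg _
  -- Duality: `S` is the correlation of `w` with `∑ s j * u j`, and almost orthogonality bounds the
  -- mean square of that sum by `(C² + e k) S`. Hence `S² ≤ (C² + e k) S`.
  have h1 : S = mean fun v => w v * ∑ j, s j * u j v := by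
    simp only [hS, mean, Finset.mul_sum]
    rw [Finset.sum_comm, Finset.sum_div]
    refine Finset.sum_congr rfl fun j _ => ?_
    have : ∀ v, w v * (s j * u j v) = s j * (w v * u j v) := fun v => by ring
    simp only [this, ← Finset.mul_sum]
    rw [mul_div_assoc, sq]
    rfl
  have h2 : (mean fun v => w v * ∑ j, s j * u j v) ^ 2
      ≤ mean fun v => (∑ j, s j * u j v) ^ 2 := by
    have hcs := Finset.sum_mul_sq_le_sq_mul_sq Finset.univ w fun v => ∑ j, s j * u j v
    have hw2 : ∑ v, w v ^ 2 ≤ Fintype.card V := by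
      calc ∑ v, w v ^ 2 ≤ ∑ _v : V, (1 : ℝ) :=
            Finset.sum_le_sum fun v _ => by rw [← sq_abs]; exact pow_le_one₀ (abs_nonneg _) (hw v)
        _ = Fintype.card V := by simp
    simp only [mean]
    rw [div_pow, div_le_div_iff₀ (by positivity) hn]
    have h0 : 0 ≤ ∑ v, (∑ j, s j * u j v) ^ 2 := Finset.sum_nonneg fun _ _ => sq_nonneg _
    nlinarith [mul_le_mul_of_nonneg_right hw2 h0]
  have h3 : (mean fun v => (∑ j, s j * u j v) ^ 2)
      = ∑ i, ∑ j, s i * s j * mean fun v => u i v * u j v := by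
    have : ∀ v, (∑ j, s j * u j v) ^ 2 = ∑ i, ∑ j, s i * s j * (u i v * u j v) := fun v => by
      rw [sq, Finset.sum_mul_sum]
      exact Finset.sum_congr rfl fun i _ => Finset.sum_congr rfl fun j _ => by ring
    simp only [mean, this]
    rw [Finset.sum_comm, Finset.sum_div]
    refine Finset.sum_congr rfl fun i _ => ?_
    rw [Finset.sum_comm, Finset.sum_div]
    refine Finset.sum_congr rfl fun j _ => ?_
    rw [← Finset.mul_sum, mul_div_assoc]
  have h4 : ∀ i j, s i * s j * (mean fun v => u i v * u j v)
      ≤ (if i = j then C ^ 2 * s i ^ 2 else 0) + e * (|s i| * |s j|) := by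
    intro i j
    split_ifs with hij
    · subst hij
      have : (mean fun v => u i v * u i v) ≤ C ^ 2 := by
        refine (le_abs_self _).trans (abs_mean_le fun v => ?_)
        rw [abs_mul, sq]
        exact mul_le_mul (hC i v) (hC i v) (abs_nonneg _) ((abs_nonneg _).trans (hC i v))
      have h5 := mul_le_mul_of_nonneg_left this (sq_nonneg (s i))
      have h6 : 0 ≤ e * (|s i| * |s i|) := by positivity
      nlinarith
    · rw [zero_add]
      calc _ ≤ |s i * s j * mean fun v => u i v * u j v| := le_abs_self _
        _ = |s i| * |s j| * |mean fun v => u i v * u j v| := by rw [abs_mul, abs_mul]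
        _ ≤ |s i| * |s j| * e := by gcongr; exact h i j hij
        _ = _ := by ring
  have h5 : S ^ 2 ≤ (C ^ 2 + e * k) * S := by
    calc S ^ 2 ≤ ∑ i, ∑ j, s i * s j * mean fun v => u i v * u j v := by
          rw [← h3]
          conv_lhs => rw [h1]
          exact h2
      _ ≤ ∑ i, ∑ j, ((if i = j then C ^ 2 * s i ^ 2 else 0) + e * (|s i| * |s j|)) :=
          Finset.sum_le_sum fun i _ => Finset.sum_le_sum fun j _ => h4 i j
      _ = C ^ 2 * S + e * (∑ i, |s i|) ^ 2 := by
          simp only [Finset.sum_add_distrib, Finset.sum_ite_eq, Finset.mem_univ, if_true,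
            ← Finset.mul_sum, sq (∑ i, |s i|), Finset.sum_mul_sum, hS]
      _ ≤ C ^ 2 * S + e * (k * S) := by
          gcongr
          have := sq_sum_le_card_mul_sum_sq (s := Finset.univ) (f := fun i => |s i|)
          simpa [hS] using this
      _ = _ := by ring
  rcases hS0.eq_or_lt with h0 | h0
  · rw [← h0]
    positivity
  · rw [sq] at h5
    exact le_of_mul_le_mul_right h5 h0

end UniformLaw

/-! ### Decorrelation from almost independent tuples -/

section Decorrelation

variable {G : Type*} [Countable G] {V : ℕ → Type*} [∀ n, Fintype (V n)] [∀ n, Nonempty (V n)]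
  {𝒳 : Type*} [MetricSpace 𝒳] [CompactSpace 𝒳] [MeasurableSpace 𝒳] [BorelSpace 𝒳]

/-- Uniform averages over longer and longer tuples of models, any two of which are almost
independent, are decorrelated. -/
theorem uniformlyDecorrelated_uniformLaw {σ : ∀ n, G → Equiv.Perm (V n)}
    {ν : ProbabilityMeasure (G → 𝒳)} {ι : ℕ → Type*} [∀ n, Fintype (ι n)] [∀ n, Nonempty (ι n)]
    (x : ∀ n, ι n → V n → Fin (n + 1) → 𝒳)
    (h : ∀ U ∈ 𝓝 (square ν), ∀ᶠ n in atTop, ∀ a i j, i ≠ j →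
      (fun v => (x n a v i, x n a v j)) ∈ goodModels U (σ n)) :
    UniformlyDecorrelated σ
      (fun n => uniformLaw fun (p : ι n × Fin (n + 1)) v => x n p.1 v p.2) ν := by
  intro f η hη
  set c := ∫ ω, f ω ∂(ν : Measure (G → 𝒳)) with hc
  let fc : C(G → 𝒳, ℝ) := f - ContinuousMap.const _ c
  have hfc : ∫ ω, fc ω ∂(ν : Measure (G → 𝒳)) = 0 := by
    change ∫ ω, (f ω - c) ∂(ν : Measure (G → 𝒳)) = 0
    rw [integral_sub (integrable_continuousMap f _) (integrable_const _)]
    simp [hc]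
  obtain ⟨C, hC, hfC⟩ := exists_abs_le fc
  have hH : ∫ ω, tensor fc fc ω ∂(square ν : Measure (G → 𝒳 × 𝒳)) = 0 := by
    rw [integral_tensor_square, hfc, mul_zero]
  have hO : {P : ProbabilityMeasure (G → 𝒳 × 𝒳) |
      |∫ ω, tensor fc fc ω ∂(P : Measure (G → 𝒳 × 𝒳))| < η / 2} ∈ 𝓝 (square ν) :=
    (ProbabilityMeasure.continuous_integral_continuousMap
      (tensor fc fc)).abs.continuousAt.eventually_lt continuousAt_const (by simpa [hH] using hη)
  have hlim : Tendsto (fun n : ℕ => C ^ 2 / ((n : ℝ) + 1)) atTop (𝓝 0) := by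
    simpa [div_eq_mul_inv] using
      (tendsto_one_div_add_atTop_nhds_zero_nat (𝕜 := ℝ)).const_mul (C ^ 2)
  filter_upwards [h _ hO, hlim.eventually (ge_mem_nhds (half_pos hη))] with n hn hn2 w hw
  rw [integral_uniformLaw, mean, div_le_iff₀ (by exact_mod_cast Fintype.card_pos),
    Fintype.sum_prod_type]
  -- Bessel's inequality inside each tuple bounds the row by `C² + (η/2)(n + 1)`. The growing tuple
  -- length makes the first term at most half of `η (n + 1)`.
  have hrow : ∀ a, ∑ j, mean (fun v => w v *
      (f (pullbackName (σ n) v fun v' => x n a v' j) - c)) ^ 2 ≤ η * (n + 1 : ℕ) := fun a => by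
    refine (sum_sq_mean_mul_le (u := fun j v => fc (pullbackName (σ n) v fun v' => x n a v' j))
      (fun j v => hfC _) (half_pos hη).le (fun i j hij => ?_) hw).trans ?_
    · have h1 := hn a i j hij
      change |∫ ω, tensor fc fc ω ∂(empirical (σ n) (fun v => (x n a v i, x n a v j)) :
        Measure (G → 𝒳 × 𝒳))| < η / 2 at h1
      rw [integral_empirical] at h1
      exact h1.le
    · rw [div_le_iff₀ (by positivity)] at hn2
      push_cast
      linarith
  refine (Finset.sum_le_sum fun a _ => hrow a).trans ?_
  simp only [Finset.sum_const, Finset.card_univ, nsmul_eq_mul, Fintype.card_prod, Fintype.card_fin]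
  push_cast
  apply le_of_eq
  ring

end Decorrelation

/-! ### Systems with a finite generating partition -/

section Generator

variable {G : Type*} [Group G] [Countable G] {X : Type*} [MeasurableSpace X]
  [StandardBorelSpace X] [MulAction G X] [MeasurableConstSMul G X]

/-- The points of a system with a finite generating partition can almost surely be recovered from
their names. -/
theorem exists_ae_leftInverse (μ : ProbabilityMeasure X) {r : ℕ} {f : X → Fin r}
    (h : ∀ A : Set X, MeasurableSet A →
      ∃ B : Set X, MeasurableSet[⨆ g : G, MeasurableSpace.comap (fun x => f (g • x)) ⊤] B ∧
        A =ᵐ[(μ : Measure X)] B) :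
    ∃ χ : (G → Fin r) → X, Measurable χ ∧
      ∀ᵐ x ∂(μ : Measure X), χ (fun g : G => f (g • x)) = x := by
  have hne : Nonempty X := nonempty_of_isProbabilityMeasure (μ : Measure X)
  -- The generated `σ`-algebra is the pullback of the product one by the name map, so each set of a
  -- countable separating family agrees almost everywhere with a set of names.
  have hcomap : (⨆ g : G, MeasurableSpace.comap (fun x => f (g • x)) ⊤)
      = MeasurableSpace.comap (fun (x : X) (g : G) => f (g • x)) MeasurableSpace.pi := by
    rw [MeasurableSpace.pi, MeasurableSpace.comap_iSup]
    refine iSup_congr fun g => ?_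
    rw [MeasurableSpace.comap_comp]
    rfl
  rw [hcomap] at h
  choose B hB hAB using fun n =>
    h _ (MeasurableSpace.measurableSet_natGeneratingSequence (α := X) n)
  choose C hC hCB using hB
  -- A Borel left inverse of the embedding of `X` into `ℕ → Bool`: names give the bits of a point,
  -- and `q` gives the point.
  obtain ⟨q, hq, hqe⟩ := ((MeasurableSpace.measurable_mapNatBool X).measurableEmbedding
    (MeasurableSpace.injective_mapNatBool X)).exists_measurable_extend measurable_id
      (fun _ => hne)
  classical
  refine ⟨fun η => q fun n => decide (η ∈ C n), hq.comp (measurable_pi_lambda _ fun n =>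
    measurable_to_bool ?_), ?_⟩
  · have : (fun η : G → Fin r => decide (η ∈ C n)) ⁻¹' {true} = C n := by
      ext; simp
    rw [this]
    exact hC n
  · filter_upwards [ae_all_iff.mpr fun n => (hAB n).mem_iff] with x hx
    have : (fun n => decide ((fun g : G => f (g • x)) ∈ C n)) = MeasurableSpace.mapNatBool X x := by
      funext n
      unfold MeasurableSpace.mapNatBool
      congr 1
      rw [hx n, ← hCB n]
      rfl
    rw [this]
    exact congrFun hqe x

end Generator

/-! ### Marginals and names of powers of a system -/

section Marginals

variable {G : Type*} [Group G] [Countable G] {𝒳 A : Type*} [MeasurableSpace 𝒳]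
  [MulAction G 𝒳] [MeasurableConstSMul G 𝒳] [MeasurableSpace A]

theorem recodeLaw_pair_orbitProcess (μ : ProbabilityMeasure 𝒳) {k : ℕ} {i j : Fin k}
    (hij : i ≠ j) :
    recodeLaw ((measurable_pi_apply i).prodMk (measurable_pi_apply j))
        (orbitProcess G (ProbabilityMeasure.pi fun _ : Fin k => μ))
      = square (orbitProcess G μ) := by
  have hJ : Function.Injective ![i, j] := by
    intro a b hab
    fin_cases a <;> fin_cases b <;> simp_all [eq_comm]
  have h1 : (Measure.pi fun _ : Fin k => (μ : Measure 𝒳)).map (fun x => (x i, x j))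
      = (μ : Measure 𝒳).prod (μ : Measure 𝒳) := by
    rw [← (measurePreserving_finTwoArrow (μ : Measure 𝒳)).map_eq,
      ← pi_map_comp_injective (μ : Measure 𝒳) hJ,
      Measure.map_map (MeasurableEquiv.measurable _) (measurable_comp_index _)]
    rfl
  have hp : Measurable fun x : Fin k → 𝒳 => (x i, x j) :=
    (measurable_pi_apply i).prodMk (measurable_pi_apply j)
  apply Subtype.ext
  change ((Measure.pi fun _ : Fin k => (μ : Measure 𝒳)).map fun x h => h • x).map
      (recode fun x : Fin k → 𝒳 => (x i, x j))
    = (((μ : Measure 𝒳).map fun x h => h • x).prod ((μ : Measure 𝒳).map fun x h => h • x)).map zip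
  rw [Measure.map_prod_map _ _ (measurable_orbit (G := G)) (measurable_orbit (G := G)),
    Measure.map_map measurable_zip
      ((measurable_orbit (G := G)).prodMap (measurable_orbit (G := G))), ← h1,
    Measure.map_map (measurable_recode hp) measurable_orbit,
    Measure.map_map (measurable_zip.comp
      ((measurable_orbit (G := G)).prodMap (measurable_orbit (G := G)))) hp]
  rfl

theorem recodeLaw_eval_orbitProcess (μ : ProbabilityMeasure 𝒳) {k : ℕ} (j : Fin k) :
    recodeLaw (measurable_pi_apply j)
        (orbitProcess G (ProbabilityMeasure.pi fun _ : Fin k => μ)) = orbitProcess G μ := by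
  rw [recodeLaw_orbitProcess (measurable_pi_apply j) fun _ _ => rfl]
  congr 1
  apply Subtype.ext
  exact (measurePreserving_eval (fun _ : Fin k => (μ : Measure 𝒳)) j).map_eq

theorem ae_recodeLaw_graph [MetricSpace 𝒳] [CompactSpace 𝒳] [BorelSpace 𝒳] [MetricSpace A]
    [CompactSpace A] [BorelSpace A] {χ : (G → A) → 𝒳} (hχ : Measurable χ) {f : 𝒳 → A}
    (hf : Measurable f) (M : ProbabilityMeasure 𝒳)
    (h : ∀ᵐ x ∂(M : Measure 𝒳), χ (fun g => f (g • x)) = x) :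
    ∀ᵐ ω ∂(recodeLaw (measurable_graph hf) (orbitProcess G M) : Measure (G → 𝒳 × A)),
      χ (recode Prod.snd ω) = (ω 1).1 := by
  have hms : MeasurableSet {ω : G → 𝒳 × A | χ (recode Prod.snd ω) = (ω 1).1} :=
    measurableSet_eq_fun (hχ.comp (measurable_recode measurable_snd))
      (measurable_fst.comp (measurable_pi_apply 1))
  rw [toMeasure_recodeLaw, ae_map_iff (measurable_recode (measurable_graph hf)).aemeasurable hms,
    toMeasure_orbitProcess]
  refine (ae_map_iff measurable_orbit.aemeasurable
    (measurable_recode (measurable_graph hf) hms)).mpr ?_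
  filter_upwards [h] with x hx
  change χ (fun g => f (g • x)) = (1 : G) • x
  rw [hx, one_smul]

theorem ae_pi_leftInverse {χ : (G → A) → 𝒳} {f : 𝒳 → A} (μ : ProbabilityMeasure 𝒳)
    (h : ∀ᵐ x ∂(μ : Measure 𝒳), χ (fun g => f (g • x)) = x) (k : ℕ) :
    ∀ᵐ x ∂(ProbabilityMeasure.pi fun _ : Fin k => μ : Measure (Fin k → 𝒳)),
      (fun j => χ fun g => f ((g • x) j)) = x := by
  have : ∀ j, ∀ᵐ x ∂(ProbabilityMeasure.pi fun _ : Fin k => μ : Measure (Fin k → 𝒳)),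
      χ (fun g => f (g • x j)) = x j := fun j =>
    (measurePreserving_eval (fun _ : Fin k => (μ : Measure 𝒳)) j).quasiMeasurePreserving.ae h
  filter_upwards [ae_all_iff.mpr this] with x hx
  exact funext hx

end Marginals

/-! ### Exponential bounds and growth rates -/

section Rate

variable {V : Type*} [Fintype V] [Nonempty V]

theorem exp_lt_of_lt_logRate {c : ℝ} {N : ℕ} (h : (c : EReal) < logRate V N) :
    Real.exp (c * Fintype.card V) < N := by
  have hn : (0 : EReal) < (Fintype.card V : ℕ) := by exact_mod_cast Fintype.card_pos
  rw [logRate, EReal.lt_div_iff hn (EReal.natCast_ne_top _)] at h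
  have h1 : ((c * Fintype.card V : ℝ) : EReal) < ENNReal.log (N : ℝ≥0∞) := by
    push_cast
    exact_mod_cast h
  rw [← EReal.exp_lt_exp_iff, ENNReal.exp_log, EReal.exp_coe] at h1
  have h2 : ENNReal.ofReal (Real.exp (c * Fintype.card V)) < ENNReal.ofReal N := by
    simpa using h1
  exact (ENNReal.ofReal_lt_ofReal_iff_of_nonneg (Real.exp_nonneg _)).mp h2

theorem le_logRate_of_exp_le {c : ℝ} {N : ℕ} (h : Real.exp (c * Fintype.card V) ≤ N) :
    (c : EReal) ≤ logRate V N := by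
  have hn : (0 : EReal) < (Fintype.card V : ℕ) := by exact_mod_cast Fintype.card_pos
  rw [logRate, EReal.le_div_iff_mul_le hn (EReal.natCast_ne_top _)]
  have h1 : ((c * Fintype.card V : ℝ) : EReal) ≤ ENNReal.log (N : ℝ≥0∞) := by
    rw [← EReal.exp_le_exp_iff, ENNReal.exp_log, EReal.exp_coe]
    simpa using ENNReal.ofReal_le_ofReal h
  push_cast at h1
  exact_mod_cast h1

end Rate

/-! ### Decorrelated measures from good models of powers -/

section Models

universe u w

variable {G : Type u} [Group G] [Countable G] {𝒳 A : Type*}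
  [MetricSpace 𝒳] [CompactSpace 𝒳] [MeasurableSpace 𝒳] [BorelSpace 𝒳]
  [MulAction G 𝒳] [MeasurableConstSMul G 𝒳]
  [Fintype A] [MetricSpace A] [MeasurableSpace A] [BorelSpace A]

/-- Good models of a power of a system that are indexed by their names, and are numerous. -/
theorem frequently_exists_models (S : SoficApproximation.{u, w} G) (μ : ProbabilityMeasure 𝒳)
    [SMulInvariantMeasure G 𝒳 (μ : Measure 𝒳)] {f : 𝒳 → A} (hf : Measurable f)
    {χ : (G → A) → 𝒳} (hχ : Measurable χ)
    (hχf : ∀ᵐ x ∂(μ : Measure 𝒳), χ (fun g => f (g • x)) = x) {k : ℕ} {c : ℝ}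
    (hc : ((k * c : ℝ) : EReal)
      < processEntropy S (orbitProcess G (ProbabilityMeasure.pi fun _ : Fin k => μ)))
    {U : Set (ProbabilityMeasure (G → 𝒳 × 𝒳))} (hU : U ∈ 𝓝 (square (orbitProcess G μ)))
    {W : Set (ProbabilityMeasure (G → A × 𝒳))}
    (hW : W ∈ 𝓝 (recodeLaw (hf.prodMk measurable_id) (orbitProcess G μ))) :
    ∃ᶠ n in atTop, ∃ (T : Finset (Fin k → S.V n → A))
      (x : (Fin k → S.V n → A) → S.V n → Fin k → 𝒳),
      Real.exp (k * c * Fintype.card (S.V n)) ≤ T.card ∧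
      ∀ a ∈ T, (∀ i j, i ≠ j → (fun v => (x a v i, x a v j)) ∈ goodModels U (S.σ n)) ∧
        ∀ j, (fun v => (a j v, x a v j)) ∈ goodModels W (S.σ n) := by
  classical
  have hne : Nonempty 𝒳 := nonempty_of_isProbabilityMeasure (μ : Measure 𝒳)
  have hΦ : Measurable fun (x : Fin k → 𝒳) j => f (x j) :=
    measurable_pi_lambda _ fun j => hf.comp (measurable_pi_apply j)
  set ν := orbitProcess G (ProbabilityMeasure.pi fun _ : Fin k => μ) with hν
  let lam := recodeLaw (measurable_graph hΦ) ν
  obtain ⟨δ, hδc⟩ := lt_iSup_iff.mp hc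
  obtain ⟨hδ, hδc⟩ := lt_iSup_iff.mp hδc
  have hχk : Measurable fun (η : G → Fin k → A) j => χ fun g => η g j :=
    measurable_pi_lambda _ fun j => hχ.comp (measurable_pi_lambda _ fun g =>
      (measurable_pi_apply j).comp (measurable_pi_apply g))
  -- The generator enters here: points are functions of names, so good models with the same name are
  -- within `δ`.
  obtain ⟨δ', hδ', O, hO, hsep⟩ := exists_separation lam hχk 1
    (ae_recodeLaw_graph hχk hΦ _ (ae_pi_leftInverse μ hχf k)) hδ
  have hcp : ∀ i j : Fin k, Continuous fun p : (Fin k → 𝒳) × (Fin k → A) => (p.1 i, p.1 j) :=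
    fun i j => by fun_prop
  have hcj : ∀ j : Fin k, Continuous fun p : (Fin k → 𝒳) × (Fin k → A) => (p.2 j, p.1 j) :=
    fun j => by fun_prop
  have hlp : ∀ i j, i ≠ j → recodeLaw (hcp i j).measurable lam = square (orbitProcess G μ) :=
    fun i j hij => by
      rw [recodeLaw_recodeLaw, ← recodeLaw_pair_orbitProcess (G := G) μ hij]
  have hlj : ∀ j, recodeLaw (hcj j).measurable lam
      = recodeLaw (hf.prodMk measurable_id) (orbitProcess G μ) := fun j => by
    rw [recodeLaw_recodeLaw, ← recodeLaw_eval_orbitProcess (G := G) μ j, recodeLaw_recodeLaw]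
  have hO2 := inter_mem (inter_mem hO (iInter_mem.mpr fun i => iInter_mem.mpr fun j =>
      iInter_mem.mpr fun hij : i ≠ j =>
        exists_nhds_recode (hcp i j) lam (O := U) (by rwa [hlp i j hij])))
    (iInter_mem.mpr fun j => exists_nhds_recode (hcj j) lam (O := W) (by rwa [hlj j]))
  obtain ⟨ψ, hψ, O₁, hO₁, hlift⟩ := exists_lift
    (ProbabilityMeasure.pi fun _ : Fin k => μ : Measure (Fin k → 𝒳)) ν
    (orbitProcess_map_eval _) hΦ hO2
  refine (frequently_lt_of_lt_limsup (h := hδc.trans_le (iInf₂_le O₁ hO₁))).mono fun n hn => ?_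
  have hgood : ∀ x ∈ goodModels O₁ (S.σ n), empirical (S.σ n) (fun v => (x v, ψ (x v))) ∈
      O ∩ (⋂ (i) (j) (_ : i ≠ j), recodeLaw (hcp i j).measurable ⁻¹' U)
        ∩ ⋂ j, recodeLaw (hcj j).measurable ⁻¹' W := fun x hx => by
    rw [empirical_recode (S.σ n) (measurable_graph hψ) x]
    exact hlift _ hx
  let Y : (S.V n → Fin k → 𝒳) → Fin k → S.V n → A := fun x j v => ψ (x v) j
  have hex : ∀ a ∈ Y '' goodModels O₁ (S.σ n), ∃ x ∈ goodModels O₁ (S.σ n), Y x = a :=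
    fun a ha => ha
  choose! x hx hxY using hex
  -- One model per name is a `δ`-dense set, so there are at least as many names as the covering
  -- number.
  have hcov : cov δ (goodModels O₁ (S.σ n))
      ≤ ((Y '' goodModels O₁ (S.σ n)).toFinite.toFinset.card : ℕ∞) := by
    refine (cov_le_encard (F := x '' (Y '' goodModels O₁ (S.σ n))) ?_ ?_).trans ?_
    · rintro _ ⟨a, ha, rfl⟩
      exact hx a ha
    · intro z hz
      have hYz := Set.mem_image_of_mem Y hz
      refine ⟨_, ⟨Y z, hYz, rfl⟩, ?_⟩
      have hzx : ∀ v, ψ (z v) = ψ (x (Y z) v) := fun v => funext fun j =>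
        (congrFun (congrFun (hxY _ hYz) j) v).symm
      refine hsep (S.σ n) (fun v => (z v, ψ (z v))) (fun v => (x (Y z) v, ψ (x (Y z) v)))
        (hgood z hz).1.1 (hgood _ (hx _ hYz)).1.1 ?_
      simp only [hzx]
      rwa [hammingAvg_self]
    · refine (Set.encard_image_le _ _).trans (le_of_eq ?_)
      exact (Y '' goodModels O₁ (S.σ n)).toFinite.encard_eq_coe_toFinset_card
  refine ⟨(Y '' goodModels O₁ (S.σ n)).toFinite.toFinset, x,
    (exp_lt_of_lt_logRate (hn.trans_le (logRate_mono hcov))).le, fun a ha => ?_⟩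
  rw [Set.Finite.mem_toFinset] at ha
  have hg := hgood _ (hx a ha)
  refine ⟨fun i j hij => ?_, fun j => ?_⟩
  · have h1 := Set.mem_iInter.mp (Set.mem_iInter.mp (Set.mem_iInter.mp hg.1.2 i) j) hij
    rw [Set.mem_preimage, ← empirical_recode] at h1
    exact h1
  · have h1 := Set.mem_iInter.mp hg.2 j
    rw [Set.mem_preimage, ← empirical_recode] at h1
    have h2 : ∀ v, a j v = ψ (x a v) j := fun v => (congrFun (congrFun (hxY a ha) j) v).symm
    simp only [h2]
    exact h1

theorem natCard_subtype_eq_sum {ι : Type*} [Fintype ι] (P : ι → Prop) [DecidablePred P] :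
    (Nat.card {i // P i} : ℝ) = ∑ i, if P i then 1 else 0 := by
  rw [Finset.sum_boole, Nat.card_eq_fintype_card, Fintype.card_subtype]

/-- The covering numbers of a uniform average of point masses at models whose names form a large
set of tuples. -/
theorem le_logRate_covMeasure {V : Type w} [Fintype V] [Nonempty V]
    (hA : ∀ a b : A, a ≠ b → 1 ≤ dist a b) {s : ℝ} (hs : 0 ≤ s)
    (hs1 : Fintype.card A * Real.exp (-s) ≤ 1) {k : ℕ} [Nonempty (Fin k)]
    {T : Finset (Fin k → V → A)} [Nonempty T] {x : T → V → Fin k → 𝒳} {c ε δ δ' : ℝ}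
    (hε1 : ε ≤ 1) (hδ' : 0 ≤ δ')
    (hsep : ∀ (a a' : T) (j j' : Fin k), hammingAvg (fun v => x a v j) (fun v => x a' v j') < δ →
      hammingAvg (a.1 j) (a'.1 j') < δ')
    (hT : Real.exp (k * c * Fintype.card V) ≤ T.card) :
    ((c - (s * (ε + δ') + 2 * (Fintype.card A * Real.exp (-s))) : ℝ) : EReal)
      ≤ logRate V (covMeasure ε (δ / 2)
        (uniformLaw fun (p : T × Fin k) v => x p.1 v p.2)) := by
  classical
  set y : T × Fin k → V → 𝒳 := fun p v => x p.1 v p.2 with hy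
  set E := s * (ε + δ') + 2 * (Fintype.card A * Real.exp (-s)) with hE
  obtain ⟨F, hF⟩ := ciInf_mem (fun F : Set (V → 𝒳) =>
    ⨅ (_ : 1 - ε < (uniformLaw y : Measure (V → 𝒳)).real (hammingNhd (δ / 2) F)), F.encard)
  change _ = covMeasure ε (δ / 2) (uniformLaw y) at hF
  rw [← hF]
  by_cases htop : (⨅ (_ : 1 - ε < (uniformLaw y : Measure (V → 𝒳)).real
      (hammingNhd (δ / 2) F)), F.encard) = ⊤
  · obtain ⟨N, hN⟩ := exists_nat_ge (Real.exp ((c - E) * Fintype.card V))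
    exact (le_logRate_of_exp_le hN).trans (logRate_mono (by simp only [htop]; exact le_top))
  have hm : 1 - ε < (uniformLaw y : Measure (V → 𝒳)).real (hammingNhd (δ / 2) F) := by
    by_contra hcon
    exact htop (by simp only [hcon, iInf_false])
  simp only [hm, iInf_true] at htop ⊢
  have hfin : F.Finite := Set.encard_ne_top_iff.mp htop
  rw [hfin.encard_eq_coe_toFinset_card]
  rw [measureReal_uniformLaw, natCard_subtype_eq_sum,
    lt_div_iff₀ (by exact_mod_cast Fintype.card_pos)] at hm
  let near : (V → 𝒳) → T × Fin k → Prop := fun z p => hammingAvg (y p) z < δ / 2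
  have hrep : ∃ rep : (V → 𝒳) → T × Fin k, ∀ z, (∃ p, near z p) → near z (rep z) := by
    refine ⟨fun z => if h : ∃ p, near z p then h.choose else Classical.arbitrary _, fun z h => ?_⟩
    simp only [h, dif_pos]
    exact h.choose_spec
  obtain ⟨rep, hrep⟩ := hrep
  -- Elements of `F` need not be models and have no names. Each is replaced by a nearby model when
  -- there is one, which accounts for the radius `δ / 2`; the others get a default and cover
  -- nothing.
  let R : Finset (V → A) := hfin.toFinset.image fun z => (rep z).1.1 (rep z).2
  have hnear : ∀ p, y p ∈ hammingNhd (δ / 2) F → ∃ r ∈ R, hammingAvg (p.1.1 p.2) r < δ' := by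
    rintro p ⟨z, hz, hpz⟩
    refine ⟨_, Finset.mem_image_of_mem _ (hfin.mem_toFinset.mpr hz), hsep _ _ _ _ ?_⟩
    have h1 : hammingAvg (y (rep z)) z < δ / 2 := hrep z ⟨p, hpz⟩
    rw [hammingAvg_comm] at h1
    have h2 := hammingAvg_triangle (y p) z (y (rep z))
    change hammingAvg (y p) (y (rep z)) < δ
    linarith
  have hR : R.Nonempty := by
    by_contra hcon
    have h0 : ∀ p, ¬ y p ∈ hammingNhd (δ / 2) F := fun p hp => by
      obtain ⟨r, hr, -⟩ := hnear p hp
      exact hcon ⟨r, hr⟩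
    simp only [h0, if_false, Finset.sum_const_zero] at hm
    have : 0 ≤ (1 - ε) * (Fintype.card (T × Fin k) : ℝ) :=
      mul_nonneg (by linarith) (Nat.cast_nonneg _)
    linarith
  have havg : ∑ a ∈ T, (Nat.card {j : Fin k // ∀ r ∈ R, δ' ≤ hammingAvg (a j) r} : ℝ)
      ≤ ε * k * T.card := by
    simp only [natCard_subtype_eq_sum]
    rw [← Finset.sum_coe_sort T, ← Fintype.sum_prod_type (f := fun p : T × Fin k =>
      if ∀ r ∈ R, δ' ≤ hammingAvg (p.1.1 p.2) r then (1 : ℝ) else 0)]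
    have h1 : ∀ p : T × Fin k, (if ∀ r ∈ R, δ' ≤ hammingAvg (p.1.1 p.2) r then (1 : ℝ) else 0)
        ≤ 1 - if y p ∈ hammingNhd (δ / 2) F then 1 else 0 := fun p => by
      by_cases hp : y p ∈ hammingNhd (δ / 2) F
      · obtain ⟨r, hr, hlt⟩ := hnear p hp
        have : ¬ ∀ r ∈ R, δ' ≤ hammingAvg (p.1.1 p.2) r := fun h => absurd (h r hr) (not_le.mpr hlt)
        simp [hp, this]
      · simp only [hp, if_false, sub_zero]
        split_ifs <;> norm_num
    refine (Finset.sum_le_sum fun p _ => h1 p).trans ?_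
    rw [Finset.sum_sub_distrib, Finset.sum_const, Finset.card_univ, nsmul_eq_mul, mul_one]
    have h2 : (Fintype.card (T × Fin k) : ℝ) = T.card * k := by simp
    rw [h2] at hm ⊢
    linarith
  have hcard := card_le_of_sum_card_le hA hs hs1 hR hδ' havg
  rw [← hE] at hcard
  have hk : k ≠ 0 := by
    rintro rfl
    exact (Classical.arbitrary (Fin 0)).elim0
  have h1 : Real.exp (c * Fintype.card V) ^ k ≤ (R.card * Real.exp (E * Fintype.card V)) ^ k := by
    rw [← Real.exp_nat_mul, ← mul_assoc]
    exact hT.trans hcard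
  have h2 := le_of_pow_le_pow_left₀ hk (by positivity) h1
  refine le_logRate_of_exp_le ?_
  rw [sub_mul, Real.exp_sub, div_le_iff₀ (Real.exp_pos _)]
  refine h2.trans ?_
  gcongr
  exact Finset.card_image_le

/-- A diagonal choice of tuples, with length tending to infinity and pair laws tending to `μ × μ`,
gives one doubly-quenched sequence. Its names are numerous enough that its covering numbers have
rate at least `c`. -/
theorem le_processDQEntropy (hA : ∀ a b : A, a ≠ b → 1 ≤ dist a b)
    (S : SoficApproximation.{u, w} G) (μ : ProbabilityMeasure 𝒳)
    [SMulInvariantMeasure G 𝒳 (μ : Measure 𝒳)] {f : 𝒳 → A} (hf : Measurable f)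
    {χ : (G → A) → 𝒳} (hχ : Measurable χ)
    (hχf : ∀ᵐ x ∂(μ : Measure 𝒳), χ (fun g => f (g • x)) = x) {c c' : ℝ} (hcc' : c < c')
    (hc' : ∀ k : ℕ, 0 < k → ((k * c' : ℝ) : EReal)
      < processEntropy S (orbitProcess G (ProbabilityMeasure.pi fun _ : Fin k => μ))) :
    (c : EReal) ≤ processDQEntropy S (orbitProcess G μ) := by
  have hη : 0 < c' - c := sub_pos.mpr hcc'
  -- The loss `s (ε + δ') + 2 |A| exp(-s)` must stay within `c' - c`. First `s` bounds the last term
  -- by a half, then `δ'` and `ε ≤ δ'` cost a quarter each.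
  obtain ⟨s, hs, hs1, hs2⟩ : ∃ s : ℝ, 0 < s ∧ Fintype.card A * Real.exp (-s) ≤ 1 ∧
      Fintype.card A * Real.exp (-s) ≤ (c' - c) / 4 := by
    have hlim : Tendsto (fun s => (Fintype.card A : ℝ) * Real.exp (-s)) atTop (𝓝 0) := by
      simpa using Real.tendsto_exp_neg_atTop_nhds_zero.const_mul (Fintype.card A : ℝ)
    exact ((eventually_gt_atTop 0).and ((hlim.eventually (ge_mem_nhds one_pos)).and
      (hlim.eventually (ge_mem_nhds (by positivity))))).exists
  set δ' := (c' - c) / (4 * s) with hδ'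
  have hδ'0 : 0 < δ' := by positivity
  have hsδ : s * δ' = (c' - c) / 4 := by
    rw [hδ']
    field_simp
  set ε := min 1 δ' with hε
  have hε0 : 0 < ε := lt_min one_pos hδ'0
  have hae : ∀ᵐ ω ∂(recodeLaw (hf.prodMk measurable_id) (orbitProcess G μ) :
      Measure (G → A × 𝒳)), (fun η : G → 𝒳 => f (η 1)) (recode Prod.snd ω) = (ω 1).1 := by
    refine (ae_map_iff (measurable_recode (hf.prodMk measurable_id)).aemeasurable
      (measurableSet_eq_fun ?_ ?_)).mpr (Eventually.of_forall fun ω => rfl)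
    · exact hf.comp ((measurable_pi_apply 1).comp (measurable_recode measurable_snd))
    · exact measurable_fst.comp (measurable_pi_apply 1)
  -- Separation in the other direction: letters are functions of points, so models close in `𝒳` have
  -- close names. This turns a covering of models into one of words.
  obtain ⟨δ, hδ, W, hW, hsep⟩ := exists_separation
    (recodeLaw (hf.prodMk measurable_id) (orbitProcess G μ))
    (hf.comp (measurable_pi_apply 1)) 1 hae hδ'0
  obtain ⟨U, hU⟩ := (𝓝 (square (orbitProcess G μ))).exists_antitone_basis
  -- At stage `t` the tuples have length `t + 1` and their pairs lie in the `t`-th basic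
  -- neighbourhood, while `W` stays fixed.
  obtain ⟨φ, hφ, hex⟩ := extraction_forall_of_frequently fun t : ℕ =>
    frequently_exists_models S μ hf hχ hχf (hc' (t + 1) t.succ_pos) (hU.mem t) hW
  choose T x hcard hgood using hex
  have hT : ∀ t, Nonempty (T t) := fun t => by
    have h1 := (Real.exp_pos _).trans_le (hcard t)
    have h2 : 0 < (T t).card := by exact_mod_cast h1
    exact (Finset.card_pos.mp h2).to_subtype
  have hdec : UniformlyDecorrelated (fun t => S.σ (φ t)) (fun t =>
      uniformLaw fun (p : T t × Fin (t + 1)) v => x t p.1.1 v p.2) (orbitProcess G μ) := by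
    refine uniformlyDecorrelated_uniformLaw (fun t (a : T t) => x t a.1) fun O hO => ?_
    obtain ⟨t₀, -, ht₀⟩ := hU.toHasBasis.mem_iff.mp hO
    filter_upwards [eventually_ge_atTop t₀] with t ht a i j hij
    exact ht₀ (hU.antitone ht ((hgood t a.1 a.2).1 i j hij))
  refine le_iSup₂_of_le φ hφ (le_iSup₂_of_le _ hdec.doublyQuenchedConverges
    (le_iSup₂_of_le (δ / 2) (by positivity) (le_iSup₂_of_le ε hε0 ?_)))
  refine le_limsup_of_frequently_le (Eventually.of_forall fun t => ?_).frequently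
  refine le_trans ?_ (le_logRate_covMeasure (x := fun a : T t => x t a.1) hA hs.le hs1
    (min_le_left _ _) hδ'0.le (fun a a' j j' h => ?_) (hcard t))
  · rw [EReal.coe_le_coe_iff]
    have h1 : s * ε ≤ s * δ' := by gcongr; exact min_le_right _ _
    rw [mul_add]
    linarith
  · exact hsep (S.σ (φ t)) (fun v => (a.1 j v, x t a.1 v j)) (fun v => (a'.1 j' v, x t a'.1 v j'))
      ((hgood t a.1 a.2).2 j) ((hgood t a'.1 a'.2).2 j') h

end Models

/-! ### Equality for systems with a finite generating partition -/

section Equality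

universe u v w

variable {G : Type u} [Group G] [Countable G] {X : Type v} [MeasurableSpace X]
  [StandardBorelSpace X] [MulAction G X] [MeasurableConstSMul G X]

theorem psEntropy_le_dqEntropy (S : SoficApproximation.{u, w} G) (μ : ProbabilityMeasure X)
    [SMulInvariantMeasure G X (μ : Measure X)] (h : HasFiniteGeneratingPartition G μ) :
    psEntropy S μ ≤ dqEntropy S μ := by
  obtain ⟨r, f, hf, hgen⟩ := h
  obtain ⟨χ, hχ, hχf⟩ := exists_ae_leftInverse μ hgen
  let := (someMetric X).metric
  have := (someMetric X).compact
  have := (someMetric X).borel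
  have hinj : Function.Injective fun i : Fin r => (i.1 : ℝ) :=
    Nat.cast_injective.comp Fin.val_injective
  -- The metric of `ℝ` puts distinct letters at distance at least `1`, as the counting of words
  -- requires.
  let : MetricSpace (Fin r) := MetricSpace.induced (fun i => (i.1 : ℝ)) hinj inferInstance
  have : DiscreteTopology (Fin r) := Finite.instDiscreteTopology
  have : BorelSpace (Fin r) := ⟨by rw [borel_eq_top_of_discrete]; rfl⟩
  have hA : ∀ a b : Fin r, a ≠ b → 1 ≤ dist a b := fun a b hab => by
    change 1 ≤ dist (a.1 : ℝ) (b.1 : ℝ)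
    rw [Nat.dist_cast_real]
    exact Nat.pairwise_one_le_dist fun h => hab (Fin.ext h)
  rw [psEntropy_eq_iInf]
  refine EReal.ge_of_forall_gt_iff_ge.mp fun c hc => ?_
  -- The gap between `c` and `c'` pays for the counting errors. Since the limit is an infimum, `c'`
  -- lies below `h_k / k` for every `k > 0`.
  obtain ⟨c', hcc', hc'⟩ := EReal.lt_iff_exists_real_btwn.mp hc
  refine le_processDQEntropy hA S μ hf hχ hχf (EReal.coe_lt_coe_iff.mp hcc') fun k hk => ?_
  have h1 := hc'.trans_le (iInf₂_le k hk)
  rw [soficEntropy_eq_processEntropy,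
    EReal.lt_div_iff (by exact_mod_cast hk) (EReal.natCast_ne_top k)] at h1
  rw [mul_comm]
  push_cast
  exact_mod_cast h1

end Equality

end

end SoficEntropy

theorem theoremD {G : Type*} [Group G] [Countable G]
    (S : SoficEntropy.SoficApproximation G)
    {X : Type*} [MeasurableSpace X] [StandardBorelSpace X]
    [MulAction G X] [MeasurableConstSMul G X]
    (μ : ProbabilityMeasure X) [SMulInvariantMeasure G X (μ : Measure X)] :
    Tendsto (fun k : ℕ =>
        SoficEntropy.soficEntropy S (ProbabilityMeasure.pi (fun _ : Fin k => μ)) / (k : EReal))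
      atTop (𝓝 (SoficEntropy.psEntropy S μ)) ∧
    SoficEntropy.dqEntropy S μ ≤ SoficEntropy.psEntropy S μ ∧
    (SoficEntropy.HasFiniteGeneratingPartition G μ →
      SoficEntropy.psEntropy S μ = SoficEntropy.dqEntropy S μ) := by
  refine ⟨?_, SoficEntropy.dqEntropy_le_psEntropy S μ, fun h => ?_⟩
  · rw [SoficEntropy.psEntropy_eq_iInf]
    exact SoficEntropy.tendsto_soficEntropy_pi S μ
  · exact le_antisymm (SoficEntropy.psEntropy_le_dqEntropy S μ h)
      (SoficEntropy.dqEntropy_le_psEntropy S μ)
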